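/- Let $\mathbb E^4_2$ be $\mathbb R^4$ with the metric $\langle\,,\rangle=dx_1^2+dx_2^2-dx_3^2-dx_4^2$, and let $M$ be a connected smooth surface immersed in $\mathbb E^4_2$ which is Lorentz (the induced metric has signature $(1,1)$) and quasi-minimal (its mean curvature vector $H$ satisfies $H\neq0$, $\langle H,H\rangle=0$ at every point). Assume that the normal curvature $\varkappa=-\langle R^D(x,y)n_1,n_2\rangle$ vanishes nowhere, where $R^D$ is the curvature tensor of the normal connection and $\{x,y\}$, $\{n_1,n_2\}$ are pseudo-orthonormal frames of the tangent and normal planes ($\langle x,x\rangle=\langle y,y\rangle=0$, $\langle x,y\rangle=-1$, and likewise for $n_1,n_2$). Then the following are equivalent. (a) $M$ has pointwise 1-type Gauss map: for a smooth Gauss map $G=x\wedge y:M\to\wedge^2\mathbb E^4_2$ (for some orientation of $M$) there are a smooth nowhere vanishing function $\phi$ on $M$ and a constant $C\in\wedge^2\mathbb E^4_2$ with $\Delta G=\phi\,(G+C)$, where $\Delta$ is the Laplacian of the induced metric. (b) There is a sign $\varepsilon\in\{1,-1\}$ such that $M$ is locally congruent to $$z(s,t)=-s\lambda_3(t)\,n_1'(t)-\varepsilon\,\frac{3\sqrt6\,\lambda_3(t)\sqrt{-s\lambda_1(t)}}{\lambda_1(t)^2}\,n_1(t)+\xi(t),\qquad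 -s\lambda_1(t)>0,$$ that is, around every point of $M$ there are local coordinates $(s,t)$ in which the immersion, followed by an isometry of $\mathbb E^4_2$, has this form, where on an open interval of $t$ the functions $\lambda_1,\lambda_3$ are smooth and nowhere zero and the $\mathbb E^4_2$-valued functions $n_1,\xi$ are smooth and satisfy $$\langle n_1,n_1\rangle=\langle n_1',n_1'\rangle=\langle n_1,\xi'\rangle=\langle\xi',\xi'\rangle=0,\qquad \langle n_1',\xi'\rangle=\frac1{\lambda_3},$$ $$n_1''-\left(\frac{\lambda_3'}{\lambda_3}-\frac{3\lambda_1'}{\lambda_1}\right)n_1'+\frac1{\lambda_3}n_1=0,$$ $$\xi'''+\left(\frac{3\lambda_3'}{\lambda_3}-\frac{3\lambda_1'}{\lambda_1}\right)\xi''+\frac{-3\lambda_1(\lambda_1'\lambda_3'+\lambda_3\lambda_1'')+3\lambda_3\lambda_1'^2+\lambda_1^2(2\lambda_3''+1)}{\lambda_1^2\lambda_3}\,\xi'=\zeta,$$ $$\zeta=81\,\frac{8\lambda_1'^2\lambda_3^2-2\lambda_1\lambda_1''\lambda_3^2+\lambda_1^2\lambda_3\lambda_3''-7\lambda_1\lambda_1'\lambda_3\lambda_3'+\lambda_1^2\lambda_3'^2}{\lambda_1^5\lambda_3}\,n_1+162\,\frac{\lambda_1\lambda_3'-2\lambda_3\lambda_1'}{\lambda_1^4}\,n_1'.$$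 -/

import Mathlib

open scoped Manifold ContDiff

namespace QuasiMinimal

noncomputable section

/-- The underlying vector space of the pseudo-Euclidean space `E^4_2`. -/
abbrev E42 : Type := Fin 4 → ℝ

/-- The coordinate plane, with coordinates `u 0`, `u 1`. -/
abbrev Plane : Type := EuclideanSpace ℝ (Fin 2)

/-- The neutral metric `dx₁² + dx₂² - dx₃² - dx₄²`. -/
def ip (v w : E42) : ℝ := v 0 * w 0 + v 1 * w 1 - v 2 * w 2 - v 3 * w 3

/-- Bivectors, identified with their components `(v ∧ w)ᵢⱼ = vᵢ wⱼ - vⱼ wᵢ`;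
the space `∧² E^4_2` is the six-dimensional subspace of antisymmetric arrays. -/
abbrev Bivec : Type := Fin 4 → Fin 4 → ℝ

/-- The exterior product `v ∧ w`. -/
def wedge (v w : E42) : Bivec := fun i j => v i * w j - v j * w i

/-- A pseudo-orthonormal pair: `⟨v,v⟩ = ⟨w,w⟩ = 0`, `⟨v,w⟩ = -1`. -/
def IsPseudoOrthonormal (v w : E42) : Prop := ip v v = 0 ∧ ip w w = 0 ∧ ip v w = -1

section Local

/-! Local theory of a parametrized surface `X` defined near a point of the plane. -/

/-- The partial derivative `∂ᵢ f`. -/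
def pd {V : Type*} [NormedAddCommGroup V] [NormedSpace ℝ V] (i : Fin 2) (f : Plane → V)
    (u : Plane) : V :=
  fderiv ℝ f u (EuclideanSpace.single i 1)

/-- The induced metric `gᵢⱼ = ⟨∂ᵢX, ∂ⱼX⟩`. -/
def metric (X : Plane → E42) (u : Plane) : Matrix (Fin 2) (Fin 2) ℝ :=
  Matrix.of fun i j => ip (pd i X u) (pd j X u)

/-- The induced metric is Lorentzian, i.e. of signature `(1,1)`
(in particular `X` is an immersion at `u`). -/
def IsLorentzAt (X : Plane → E42) (u : Plane) : Prop := (metric X u).det < 0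

/-- The tangent vector with components `a` in the coordinate frame. -/
def tangentVec (X : Plane → E42) (u : Plane) (a : Fin 2 → ℝ) : E42 :=
  ∑ i, a i • pd i X u

/-- `ν` is normal to the surface at `u`. -/
def IsNormal (X : Plane → E42) (u : Plane) (ν : E42) : Prop := ∀ i, ip ν (pd i X u) = 0

/-- The normal component of `w` at `u`: `w - gⁱʲ ⟨w, ∂ᵢX⟩ ∂ⱼX`. -/
def nor (X : Plane → E42) (u : Plane) (w : E42) : E42 :=
  w - ∑ i, ∑ j, ((metric X u)⁻¹ i j * ip w (pd i X u)) • pd j X u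

/-- The second fundamental form `h(∂ᵢ, ∂ⱼ)`. -/
def secondForm (X : Plane → E42) (i j : Fin 2) (u : Plane) : E42 :=
  nor X u (pd i (pd j X) u)

/-- The mean curvature vector `H = (1/2) tr h`. -/
def meanCurv (X : Plane → E42) (u : Plane) : E42 :=
  (1 / 2 : ℝ) • ∑ i, ∑ j, (metric X u)⁻¹ i j • secondForm X i j u

/-- Lorentzian, with lightlike mean curvature vector. -/
def IsQuasiMinimalAt (X : Plane → E42) (u : Plane) : Prop :=
  IsLorentzAt X u ∧ meanCurv X u ≠ 0 ∧ ip (meanCurv X u) (meanCurv X u) = 0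

/-- The normal connection `D` in the direction `∂ᵢ`, on normal vector fields. -/
def normalD (X : Plane → E42) (i : Fin 2) (ν : Plane → E42) (u : Plane) : E42 :=
  nor X u (pd i ν u)

/-- The normal curvature tensor `R^D(∂₀, ∂₁) ν` on a normal vector `ν` at `u`. It is tensorial in
`ν`, so it may be computed with the normal field `v ↦ nor X v ν`, which extends `ν`. -/
def normalR (X : Plane → E42) (u : Plane) (ν : E42) : E42 :=
  normalD X 0 (normalD X 1 fun v => nor X v ν) u - normalD X 1 (normalD X 0 fun v => nor X v ν) u

/-- `ϰ = -R^D(x, y, n₁, n₂) = -⟨R^D(x, y) n₁, n₂⟩`, where `x`, `y` are the tangent vectors with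
components `a`, `b`. -/
def normalCurv (X : Plane → E42) (u : Plane) (a b : Fin 2 → ℝ) (n₁ n₂ : E42) : ℝ :=
  -((a 0 * b 1 - a 1 * b 0) * ip (normalR X u n₁) n₂)

/-- The normal curvature is non-zero at `u`: `ϰ ≠ 0` with respect to a pseudo-orthonormal frame
`x, y, n₁, n₂` (another such frame changes at most the sign of `ϰ`). -/
def NormalCurvNeZeroAt (X : Plane → E42) (u : Plane) : Prop :=
  ∃ (a b : Fin 2 → ℝ) (n₁ n₂ : E42),
    IsPseudoOrthonormal (tangentVec X u a) (tangentVec X u b) ∧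
    IsNormal X u n₁ ∧ IsNormal X u n₂ ∧ IsPseudoOrthonormal n₁ n₂ ∧
    normalCurv X u a b n₁ n₂ ≠ 0

/-- Christoffel symbols `Γᵏᵢⱼ` of the induced connection: `(∂ᵢ∂ⱼX)ᵀ = Γᵏᵢⱼ ∂ₖX`. -/
def christoffel (X : Plane → E42) (k i j : Fin 2) (u : Plane) : ℝ :=
  ∑ l, (metric X u)⁻¹ k l * ip (pd i (pd j X) u) (pd l X u)

/-- The Laplacian of the induced metric, `Δf = -gⁱʲ (∂ᵢ∂ⱼf - Γᵏᵢⱼ ∂ₖf)`, on vector-valued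
functions. -/
def lap {V : Type*} [NormedAddCommGroup V] [NormedSpace ℝ V] (X : Plane → E42) (f : Plane → V)
    (u : Plane) : V :=
  -∑ i, ∑ j, (metric X u)⁻¹ i j • (pd i (pd j f) u - ∑ k, christoffel X k i j u • pd k f u)

end Local

section Global

variable {M : Type*} [TopologicalSpace M] [ChartedSpace Plane M]

/-- `e` is a local coordinate system of the smooth surface `M`. -/
def IsChart (e : OpenPartialHomeomorph M Plane) : Prop :=
  e ∈ IsManifold.maximalAtlas (𝓡 2) ∞ M

/-- `F : M → E^4_2` is (the immersion of) a quasi-minimal Lorentz surface. -/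
def IsQuasiMinimalSurface (F : M → E42) : Prop :=
  ContMDiff (𝓡 2) 𝓘(ℝ, E42) ∞ F ∧
    ∀ e : OpenPartialHomeomorph M Plane, IsChart e →
      ∀ u ∈ e.target, IsQuasiMinimalAt (F ∘ e.symm) u

/-- The normal curvature of the surface vanishes nowhere. -/
def HasNonvanishingNormalCurv (F : M → E42) : Prop :=
  ∀ e : OpenPartialHomeomorph M Plane, IsChart e →
    ∀ u ∈ e.target, NormalCurvNeZeroAt (F ∘ e.symm) u

/-- `G` is a Gauss map of the surface: a smooth map with `G = x ∧ y` for pseudo-orthonormal tangent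
vectors `x, y`. (The two choices `± G` correspond to the orientations of `M`.) -/
def IsGaussMap (F : M → E42) (G : M → Bivec) : Prop :=
  ContMDiff (𝓡 2) 𝓘(ℝ, Bivec) ∞ G ∧
    ∀ e : OpenPartialHomeomorph M Plane, IsChart e → ∀ u ∈ e.target,
      ∃ a b : Fin 2 → ℝ,
        IsPseudoOrthonormal (tangentVec (F ∘ e.symm) u a) (tangentVec (F ∘ e.symm) u b) ∧
        G (e.symm u) = wedge (tangentVec (F ∘ e.symm) u a) (tangentVec (F ∘ e.symm) u b)

/-- Pointwise 1-type Gauss map: `ΔG = φ (G + C)` for a smooth non-vanishing function `φ` and a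
constant bivector `C`. -/
def HasPointwiseOneTypeGaussMap (F : M → E42) : Prop :=
  ∃ (G : M → Bivec) (φ : M → ℝ) (C : Bivec),
    IsGaussMap F G ∧ ContMDiff (𝓡 2) 𝓘(ℝ, ℝ) ∞ φ ∧ (∀ p, φ p ≠ 0) ∧ (∀ i j, C i j = -C j i) ∧
    ∀ e : OpenPartialHomeomorph M Plane, IsChart e → ∀ u ∈ e.target,
      lap (F ∘ e.symm) (G ∘ e.symm) u = φ (e.symm u) • (G (e.symm u) + C)

/-- The curve-valued coefficient `ζ` of the third order equation. -/
def zeta (l₁ l₃ : ℝ → ℝ) (n : ℝ → E42) (t : ℝ) : E42 :=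
  (81 * (8 * (deriv l₁ t) ^ 2 * (l₃ t) ^ 2 - 2 * l₁ t * deriv (deriv l₁) t * (l₃ t) ^ 2
      + (l₁ t) ^ 2 * l₃ t * deriv (deriv l₃) t - 7 * l₁ t * deriv l₁ t * l₃ t * deriv l₃ t
      + (l₁ t) ^ 2 * (deriv l₃ t) ^ 2) / ((l₁ t) ^ 5 * l₃ t)) • n t
    + (162 * (l₁ t * deriv l₃ t - 2 * l₃ t * deriv l₁ t) / (l₁ t) ^ 4) • deriv n t

/-- The functions `λ₁, λ₃` and the curves `n₁, ξ` are smooth on the interval `(α, β)`, with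
`λ₁, λ₃` non-vanishing, and satisfy there the algebraic and differential conditions. -/
structure IsAdmissible (α β : ℝ) (l₁ l₃ : ℝ → ℝ) (n ξ : ℝ → E42) : Prop where
  smooth_l₁ : ContDiffOn ℝ ∞ l₁ (Set.Ioo α β)
  smooth_l₃ : ContDiffOn ℝ ∞ l₃ (Set.Ioo α β)
  smooth_n : ContDiffOn ℝ ∞ n (Set.Ioo α β)
  smooth_ξ : ContDiffOn ℝ ∞ ξ (Set.Ioo α β)
  l₁_ne : ∀ t ∈ Set.Ioo α β, l₁ t ≠ 0
  l₃_ne : ∀ t ∈ Set.Ioo α β, l₃ t ≠ 0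
  n_n : ∀ t ∈ Set.Ioo α β, ip (n t) (n t) = 0
  n'_n' : ∀ t ∈ Set.Ioo α β, ip (deriv n t) (deriv n t) = 0
  n_ξ' : ∀ t ∈ Set.Ioo α β, ip (n t) (deriv ξ t) = 0
  ξ'_ξ' : ∀ t ∈ Set.Ioo α β, ip (deriv ξ t) (deriv ξ t) = 0
  n'_ξ' : ∀ t ∈ Set.Ioo α β, ip (deriv n t) (deriv ξ t) = 1 / l₃ t
  ode_n : ∀ t ∈ Set.Ioo α β,
    deriv (deriv n) t - (deriv l₃ t / l₃ t - 3 * deriv l₁ t / l₁ t) • deriv n t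
      + (1 / l₃ t) • n t = 0
  ode_ξ : ∀ t ∈ Set.Ioo α β,
    deriv (deriv (deriv ξ)) t
      + (3 * deriv l₃ t / l₃ t - 3 * deriv l₁ t / l₁ t) • deriv (deriv ξ) t
      + ((-3 * l₁ t * (deriv l₁ t * deriv l₃ t + l₃ t * deriv (deriv l₁) t)
          + 3 * l₃ t * (deriv l₁ t) ^ 2 + (l₁ t) ^ 2 * (2 * deriv (deriv l₃) t + 1))
          / ((l₁ t) ^ 2 * l₃ t)) • deriv ξ t
      = zeta l₁ l₃ n t

/-- `z(s,t) = -s λ₃ n₁' - ε (3 √6 λ₃ √(-s λ₁) / λ₁²) n₁ + ξ`, where the sign `ε` selects the branch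
of the square root. -/
def modelMap (ε : ℝ) (l₁ l₃ : ℝ → ℝ) (n ξ : ℝ → E42) (s t : ℝ) : E42 :=
  -((s * l₃ t) • deriv n t)
    - (ε * (3 * √6 * l₃ t * √(-(s * l₁ t)) / (l₁ t) ^ 2)) • n t + ξ t

/-- Near `p`, the surface is congruent to (an open piece of) the surface `z` with sign `ε`, for some
admissible data: in suitable local coordinates `(s,t)` around `p`, `F` followed by an isometry
`w ↦ A w + v` of `E^4_2` equals `z(s,t)`. -/
def IsCongruentToModelNear (F : M → E42) (ε : ℝ) (p : M) : Prop :=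
  ∃ (α β : ℝ) (l₁ l₃ : ℝ → ℝ) (n ξ : ℝ → E42), IsAdmissible α β l₁ l₃ n ξ ∧
    ∃ (A : E42 ≃ₗ[ℝ] E42) (v : E42), (∀ w w', ip (A w) (A w') = ip w w') ∧
      ∃ e : OpenPartialHomeomorph M Plane, IsChart e ∧ p ∈ e.source ∧
        ∀ u ∈ e.target, u 1 ∈ Set.Ioo α β ∧ 0 < -(u 0 * l₁ (u 1)) ∧
          A (F (e.symm u)) + v = modelMap ε l₁ l₃ n ξ (u 0) (u 1)

end Global

end

end QuasiMinimal

namespace QuasiMinimal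

/-! ### Linear algebra of `E^4_2` -/

/-! Take a null tangent frame `x, y` with `G = x ∧ y` and a null normal frame `H, n₂`, and put A =
⟨h(x,x),H⟩, B = ⟨h(y,y),H⟩, m = ⟨h(x,x),n₂⟩, k = ⟨h(y,y),n₂⟩. Then h(x,y) = -H, and by the Ricci
equation (`normalCurv_eq`) the curvature hypothesis says Ak - Bm ≠ 0. The Laplacian of `G` is
computed in coordinates whose Christoffel symbols vanish at the point (`lap_gauss`,
`bdot_gauss_lap`). Comparing components with φ(G + C) gives C(x,H) = C(y,H) = 0, φ C(n₂,H) = -2(Ak -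
Bm) and φ(C(x,y) - 1) = 2(Ak + Bm) (`OneTypeOn.ev_components`). Differentiating the first two
identities yields A(C(x,y) - C(n₂,H)) = 0 and B(C(x,y) + C(n₂,H)) = 0, so exactly one of A, B
vanishes (`OneTypeOn.dichotomy`). Passing from (G, C) to (-G, -C) exchanges `x` and `y`, so B = 0
may be assumed. Then C(x,y) = 1/2 and φ = -4Ak, and the skew endomorphism C has eigenvalues ±1/2
with totally null eigenplanes, the one for -1/2 being spanned by `y` and `H`
(`OneTypeOn.exists_splitFrame`).

Along the null curves tangent to `y` both `H` and (1/2 + C)X are constant, so they are curves -n(t)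
and q(t). In coordinates (s,t) with ∂ₛ parallel to `y` one has q' = x + R n with ∂ₛR ≠ 0, and -R can
serve as the coordinate s (`IsOneType.exists_normalized_chart`). Now ∂ₛX = -λ₃ n' + f n with 1/λ₃ =
⟨n',q'⟩, and the remaining equations reduce to f = -2s ∂ₛf and φ = -4 ∂ₛf/λ₃
(`IsNormalizedOn.fCoef_eqs`). Hence s ≠ 0, f is a function of t times |s|^(-1/2), and integration in
s produces the shape of the model. Comparing ∂ₜX with q' gives a polynomial identity in √|s|, whose
coefficients are the equations for n and the relation ξ' = q' + c n (`IsNormalizedOn.curve_eqs`).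
The function λ₁ encodes the constant of integration through a cube root. The equation for ξ combines
the second order equation of q', dual to that of n (`IsNullPair.ode_Q`), with the fact that ζ is the
image of c n under the same operator (`coefC_smul_eq_zeta`). The sign ε is opposite to that of φ,
which is constant because M is connected.

Conversely, for admissible curves put Q = ξ' - c n. A combination of n∧Q', n'∧Q and n∧Q is a
constant bivector C with eigenvalues ±1/2 (`IsAdmissible.modelC_const`, `IsAdmissible.act_modelC`),
and a direct computation gives ΔG = φ(G + C) (`IsModelOn.lap_gaussM`). The local solutions glue
because a normalized solution (G, φ, C) is unique wherever two of them meet: ⟨C,G⟩ = 1/2 fixes φ,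
and the orientation is fixed since -1/2, but not 1/2, is an eigenvalue of C on a tangent direction
(`IsLocalSolution.eq_of_mem`). -/

theorem ip_comm (v w : E42) : ip v w = ip w v := by simp only [ip]; ring

theorem ip_add_left (u v w : E42) : ip (u + v) w = ip u w + ip v w := by
  simp only [ip, Pi.add_apply]; ring

theorem ip_add_right (u v w : E42) : ip u (v + w) = ip u v + ip u w := by
  simp only [ip, Pi.add_apply]; ring

theorem ip_sub_left (u v w : E42) : ip (u - v) w = ip u w - ip v w := by
  simp only [ip, Pi.sub_apply]; ring

theorem ip_sub_right (u v w : E42) : ip u (v - w) = ip u v - ip u w := by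
  simp only [ip, Pi.sub_apply]; ring

theorem ip_smul_left (c : ℝ) (v w : E42) : ip (c • v) w = c * ip v w := by
  simp only [ip, Pi.smul_apply, smul_eq_mul]; ring

theorem ip_smul_right (c : ℝ) (v w : E42) : ip v (c • w) = c * ip v w := by
  simp only [ip, Pi.smul_apply, smul_eq_mul]; ring

theorem ip_neg_left (v w : E42) : ip (-v) w = -ip v w := by
  simp only [ip, Pi.neg_apply]; ring

theorem ip_neg_right (v w : E42) : ip v (-w) = -ip v w := by
  simp only [ip, Pi.neg_apply]; ring

theorem ip_zero_left (w : E42) : ip 0 w = 0 := by simp [ip]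

theorem ip_zero_right (w : E42) : ip w 0 = 0 := by simp [ip]

theorem eq_zero_of_ip_eq_zero {v : E42} (h : ∀ w, ip v w = 0) : v = 0 := by
  have h0 := h (Pi.single 0 1)
  have h1 := h (Pi.single 1 1)
  have h2 := h (Pi.single 2 1)
  have h3 := h (Pi.single 3 1)
  simp [ip] at h0 h1 h2 h3
  ext i
  fin_cases i <;> simpa

/-- The neutral metric as a continuous bilinear map. -/
noncomputable def ipB : E42 →L[ℝ] E42 →L[ℝ] ℝ :=
  (LinearMap.mk₂ ℝ ip ip_add_left ip_smul_left ip_add_right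
    ip_smul_right).toContinuousBilinearMap

@[simp] theorem ipB_apply (v w : E42) : ipB v w = ip v w := rfl

theorem wedge_add_left (u v w : E42) : wedge (u + v) w = wedge u w + wedge v w := by
  ext i j; simp only [wedge, Pi.add_apply]; ring

theorem wedge_add_right (u v w : E42) : wedge u (v + w) = wedge u v + wedge u w := by
  ext i j; simp only [wedge, Pi.add_apply]; ring

theorem wedge_smul_left (c : ℝ) (v w : E42) : wedge (c • v) w = c • wedge v w := by
  ext i j; simp only [wedge, Pi.smul_apply, smul_eq_mul]; ring

theorem wedge_smul_right (c : ℝ) (v w : E42) : wedge v (c • w) = c • wedge v w := by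
  ext i j; simp only [wedge, Pi.smul_apply, smul_eq_mul]; ring

theorem wedge_sub_left (u v w : E42) : wedge (u - v) w = wedge u w - wedge v w := by
  ext i j; simp only [wedge, Pi.sub_apply]; ring

theorem wedge_sub_right (u v w : E42) : wedge u (v - w) = wedge u v - wedge u w := by
  ext i j; simp only [wedge, Pi.sub_apply]; ring

theorem wedge_neg_left (v w : E42) : wedge (-v) w = -wedge v w := by
  ext i j; simp only [wedge, Pi.neg_apply]; ring

theorem wedge_neg_right (v w : E42) : wedge v (-w) = -wedge v w := by
  ext i j; simp only [wedge, Pi.neg_apply]; ring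

theorem wedge_self (v : E42) : wedge v v = 0 := by
  ext i j; simp only [wedge, Pi.zero_apply]; ring

theorem wedge_comm (v w : E42) : wedge v w = -wedge w v := by
  ext i j; simp only [wedge, Pi.neg_apply]; ring

theorem wedge_zero_left (v : E42) : wedge 0 v = 0 := by
  ext i j; simp [wedge]

theorem wedge_zero_right (v : E42) : wedge v 0 = 0 := by
  ext i j; simp [wedge]

/-- The exterior product as a continuous bilinear map. -/
noncomputable def wedgeB : E42 →L[ℝ] E42 →L[ℝ] Bivec :=
  (LinearMap.mk₂ ℝ wedge wedge_add_left wedge_smul_left wedge_add_right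
    wedge_smul_right).toContinuousBilinearMap

@[simp] theorem wedgeB_apply (v w : E42) : wedgeB v w = wedge v w := rfl

/-- The contraction of a bivector with a vector:
`(v ∧ w) ⌟ u = ⟨w, u⟩ v - ⟨v, u⟩ w`. -/
def act (C : Bivec) (v : E42) : E42 := fun i =>
  C i 0 * v 0 + C i 1 * v 1 - C i 2 * v 2 - C i 3 * v 3

theorem act_add (C : Bivec) (v w : E42) : act C (v + w) = act C v + act C w := by
  ext i; simp only [act, Pi.add_apply]; ring

theorem act_sub (C : Bivec) (v w : E42) : act C (v - w) = act C v - act C w := by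
  ext i; simp only [act, Pi.sub_apply]; ring

theorem act_smul (C : Bivec) (c : ℝ) (v : E42) : act C (c • v) = c • act C v := by
  ext i; simp only [act, Pi.smul_apply, smul_eq_mul]; ring

theorem act_neg (C : Bivec) (v : E42) : act C (-v) = -act C v := by
  ext i; simp only [act, Pi.neg_apply]; ring

theorem add_act (C D : Bivec) (v : E42) : act (C + D) v = act C v + act D v := by
  ext i; simp only [act, Pi.add_apply]; ring

theorem smul_act (c : ℝ) (C : Bivec) (v : E42) : act (c • C) v = c • act C v := by
  ext i; simp only [act, Pi.smul_apply, smul_eq_mul]; ring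

theorem sub_act (C D : Bivec) (v : E42) : act (C - D) v = act C v - act D v := by
  ext i; simp only [act, Pi.sub_apply]; ring

theorem neg_act (C : Bivec) (v : E42) : act (-C) v = -act C v := by
  ext i; simp only [act, Pi.neg_apply]; ring

theorem act_wedge (v w u : E42) : act (wedge v w) u = ip w u • v - ip v u • w := by
  ext i; simp only [act, wedge, ip, Pi.sub_apply, Pi.smul_apply, smul_eq_mul]; ring

/-- The contraction with a fixed bivector as a continuous linear map. -/
noncomputable def actL (C : Bivec) : E42 →L[ℝ] E42 :=
  LinearMap.toContinuousLinearMap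
    { toFun := act C, map_add' := act_add C, map_smul' := act_smul C }

@[simp] theorem actL_apply (C : Bivec) (v : E42) : actL C v = act C v := rfl

/-- The value of a bivector on a pair of vectors. -/
def ev (C : Bivec) (u v : E42) : ℝ := ip u (act C v)

theorem ev_add_left (C : Bivec) (u v w : E42) : ev C (u + v) w = ev C u w + ev C v w :=
  ip_add_left _ _ _

theorem ev_add_right (C : Bivec) (u v w : E42) : ev C u (v + w) = ev C u v + ev C u w := by
  simp only [ev, act_add, ip_add_right]

theorem ev_sub_left (C : Bivec) (u v w : E42) : ev C (u - v) w = ev C u w - ev C v w :=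
  ip_sub_left _ _ _

theorem ev_sub_right (C : Bivec) (u v w : E42) : ev C u (v - w) = ev C u v - ev C u w := by
  simp only [ev, act_sub, ip_sub_right]

theorem ev_smul_left (C : Bivec) (c : ℝ) (v w : E42) : ev C (c • v) w = c * ev C v w :=
  ip_smul_left _ _ _

theorem ev_smul_right (C : Bivec) (c : ℝ) (v w : E42) : ev C v (c • w) = c * ev C v w := by
  simp only [ev, act_smul, ip_smul_right]

theorem add_ev (C D : Bivec) (u v : E42) : ev (C + D) u v = ev C u v + ev D u v := by
  simp only [ev, add_act, ip_add_right]

theorem sub_ev (C D : Bivec) (u v : E42) : ev (C - D) u v = ev C u v - ev D u v := by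
  simp only [ev, sub_act, ip_sub_right]

theorem smul_ev (c : ℝ) (C : Bivec) (u v : E42) : ev (c • C) u v = c * ev C u v := by
  simp only [ev, smul_act, ip_smul_right]

theorem ev_wedge (p q u v : E42) :
    ev (wedge p q) u v = ip p u * ip q v - ip q u * ip p v := by
  simp only [ev, act_wedge, ip_sub_right, ip_smul_right, ip_comm p u, ip_comm q u]; ring

theorem ev_antisymm {C : Bivec} (hC : ∀ i j, C i j = -C j i) (u v : E42) :
    ev C u v = -ev C v u := by
  have d (i) : C i i = 0 := by have := hC i i; linarith
  simp only [ev, ip, act, d, hC 1 0, hC 2 0, hC 3 0, hC 2 1, hC 3 1, hC 3 2]; ring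

theorem ev_self {C : Bivec} (hC : ∀ i j, C i j = -C j i) (u : E42) : ev C u u = 0 := by
  have := ev_antisymm hC u u; linarith

/-- The scalar product of bivectors induced by the neutral metric (on decomposable bivectors it is
the Gram determinant). -/
noncomputable def bdot (C D : Bivec) : ℝ :=
  C 0 1 * D 0 1 - C 0 2 * D 0 2 - C 0 3 * D 0 3 - C 1 2 * D 1 2 - C 1 3 * D 1 3 + C 2 3 * D 2 3

theorem bdot_comm (C D : Bivec) : bdot C D = bdot D C := by simp only [bdot]; ring

theorem bdot_add_left (C D B : Bivec) : bdot (C + D) B = bdot C B + bdot D B := by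
  simp only [bdot, Pi.add_apply]; ring

theorem bdot_add_right (C D B : Bivec) : bdot B (C + D) = bdot B C + bdot B D := by
  simp only [bdot, Pi.add_apply]; ring

theorem bdot_smul_left (c : ℝ) (C B : Bivec) : bdot (c • C) B = c * bdot C B := by
  simp only [bdot, Pi.smul_apply, smul_eq_mul]; ring

theorem bdot_smul_right (c : ℝ) (C B : Bivec) : bdot B (c • C) = c * bdot B C := by
  simp only [bdot, Pi.smul_apply, smul_eq_mul]; ring

theorem bdot_sub_right (C D B : Bivec) : bdot B (C - D) = bdot B C - bdot B D := by
  simp only [bdot, Pi.sub_apply]; ring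

theorem bdot_wedge {C : Bivec} (hC : ∀ i j, C i j = -C j i) (u v : E42) :
    bdot C (wedge u v) = ev C u v := by
  have d (i) : C i i = 0 := by have := hC i i; linarith
  simp only [bdot, wedge, ev, ip, act, d, hC 1 0, hC 2 0, hC 3 0, hC 2 1, hC 3 1, hC 3 2]; ring

theorem wedge_antisymm (u v : E42) (i j : Fin 4) : wedge u v i j = -wedge u v j i := by
  simp only [wedge]; ring

/-- The scalar product of bivectors as a continuous bilinear map. -/
noncomputable def bdotB : Bivec →L[ℝ] Bivec →L[ℝ] ℝ :=
  (LinearMap.mk₂ ℝ bdot bdot_add_left bdot_smul_left (fun B C D => bdot_add_right C D B)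
    (fun c B C => bdot_smul_right c C B)).toContinuousBilinearMap

@[simp] theorem bdotB_apply (v w : Bivec) : bdotB v w = bdot v w := rfl

/-- A null tetrad: `x, y` and `n₁, n₂` are mutually orthogonal pseudo-orthonormal pairs. -/
structure IsTetrad (x y n₁ n₂ : E42) : Prop where
  xx : ip x x = 0
  yy : ip y y = 0
  xy : ip x y = -1
  pp : ip n₁ n₁ = 0
  qq : ip n₂ n₂ = 0
  pq : ip n₁ n₂ = -1
  xp : ip x n₁ = 0
  xq : ip x n₂ = 0
  yp : ip y n₁ = 0
  yq : ip y n₂ = 0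

/-- Pairing a linear relation with each of the four vectors isolates one coefficient, so a tetrad is
a basis and the nondegenerate metric separates vectors by their pairings with it. -/
theorem IsTetrad.eq_of_ip {x y p q : E42} (h : IsTetrad x y p q) {v w : E42}
    (hx : ip v x = ip w x) (hy : ip v y = ip w y) (hp : ip v p = ip w p)
    (hq : ip v q = ip w q) : v = w := by
  obtain ⟨xx, yy, xy, pp, qq, pq, xp, xq, yp, yq⟩ := h
  have hli : LinearIndependent ℝ ![x, y, p, q] := by
    rw [Fintype.linearIndependent_iff]
    intro g hg
    simp only [Fin.sum_univ_four, Matrix.cons_val] at hg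
    have e (u : E42) := congrArg (fun z => ip z u) hg
    simp only [ip_add_left, ip_smul_left, ip_zero_left] at e
    have ex := e x
    have ey := e y
    have ep := e p
    have eq := e q
    rw [ip_comm p x, ip_comm q x, ip_comm y x, xx, xy, xp, xq] at ex
    rw [ip_comm p y, ip_comm q y, xy, yy, yp, yq] at ey
    rw [ip_comm q p, xp, yp, pp, pq] at ep
    rw [xq, yq, pq, qq] at eq
    intro i
    fin_cases i <;> simp <;> linarith
  have hsp := hli.span_eq_top_of_card_eq_finrank' (by simp)
  rw [← sub_eq_zero]
  apply eq_zero_of_ip_eq_zero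
  intro z
  have hz : z ∈ Submodule.span ℝ (Set.range ![x, y, p, q]) := by rw [hsp]; trivial
  induction hz using Submodule.span_induction with
  | mem z hz =>
    obtain ⟨i, rfl⟩ := hz
    fin_cases i <;> simp [ip_sub_left, *]
  | zero => exact ip_zero_right _
  | add a b _ _ ha hb => rw [ip_add_right, ha, hb, add_zero]
  | smul c a _ ha => rw [ip_smul_right, ha, mul_zero]

theorem IsTetrad.expand {x y p q : E42} (h : IsTetrad x y p q) (v : E42) :
    v = (-ip v y) • x - ip v x • y - ip v q • p - ip v p • q := by
  apply h.eq_of_ip <;>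
    simp [ip_sub_left, ip_smul_left, ip_neg_left, h.xx, h.yy, h.xy, h.pp, h.qq, h.pq, h.xp, h.xq,
      h.yp, h.yq, ip_comm y x, ip_comm p x, ip_comm p y, ip_comm q x, ip_comm q y, ip_comm q p]

/-! ### Partial derivatives -/

section Calculus

variable {V W Z : Type*} [NormedAddCommGroup V] [NormedSpace ℝ V] [NormedAddCommGroup W]
  [NormedSpace ℝ W] [NormedAddCommGroup Z] [NormedSpace ℝ Z]

theorem contDiffAt_pd {f : Plane → V} {u : Plane} (i : Fin 2) (hf : ContDiffAt ℝ ∞ f u) :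
    ContDiffAt ℝ ∞ (pd i f) u :=
  (hf.fderiv_right (m := ∞) le_rfl).clm_apply contDiffAt_const

theorem _root_.ContDiffAt.dAt {f : Plane → V} {u : Plane} (hf : ContDiffAt ℝ ∞ f u) :
    DifferentiableAt ℝ f u := hf.differentiableAt (by simp)

theorem pd_bilin (B : V →L[ℝ] W →L[ℝ] Z) {f : Plane → V} {g : Plane → W} {u : Plane} (i : Fin 2)
    (hf : DifferentiableAt ℝ f u) (hg : DifferentiableAt ℝ g u) :
    pd i (fun v => B (f v) (g v)) u = B (pd i f u) (g u) + B (f u) (pd i g u) := by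
  simp only [pd]
  rw [B.fderiv_of_bilinear hf hg]
  simp [add_comm]

theorem pd_ip {f g : Plane → E42} {u : Plane} (i : Fin 2)
    (hf : DifferentiableAt ℝ f u) (hg : DifferentiableAt ℝ g u) :
    pd i (fun v => ip (f v) (g v)) u = ip (pd i f u) (g u) + ip (f u) (pd i g u) :=
  pd_bilin ipB i hf hg

theorem pd_smul {f : Plane → ℝ} {g : Plane → V} {u : Plane} (i : Fin 2)
    (hf : DifferentiableAt ℝ f u) (hg : DifferentiableAt ℝ g u) :
    pd i (fun v => f v • g v) u = pd i f u • g u + f u • pd i g u :=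
  pd_bilin (ContinuousLinearMap.lsmul ℝ ℝ) i hf hg

theorem pd_mul {f g : Plane → ℝ} {u : Plane} (i : Fin 2)
    (hf : DifferentiableAt ℝ f u) (hg : DifferentiableAt ℝ g u) :
    pd i (fun v => f v * g v) u = pd i f u * g u + f u * pd i g u :=
  pd_smul i hf hg

theorem pd_add {f g : Plane → V} {u : Plane} (i : Fin 2)
    (hf : DifferentiableAt ℝ f u) (hg : DifferentiableAt ℝ g u) :
    pd i (fun v => f v + g v) u = pd i f u + pd i g u := by
  simp only [pd]; rw [fderiv_fun_add hf hg]; rfl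

theorem pd_sub {f g : Plane → V} {u : Plane} (i : Fin 2)
    (hf : DifferentiableAt ℝ f u) (hg : DifferentiableAt ℝ g u) :
    pd i (fun v => f v - g v) u = pd i f u - pd i g u := by
  simp only [pd]; rw [fderiv_fun_sub hf hg]; rfl

theorem pd_neg {f : Plane → V} {u : Plane} (i : Fin 2) :
    pd i (fun v => -f v) u = -pd i f u := by
  simp only [pd]; rw [fderiv_fun_neg]; rfl

theorem pd_const (c : V) (u : Plane) (i : Fin 2) : pd i (fun _ => c) u = 0 := by
  simp [pd]

theorem pd_clm (T : V →L[ℝ] W) {f : Plane → V} {u : Plane} (i : Fin 2)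
    (hf : DifferentiableAt ℝ f u) : pd i (fun v => T (f v)) u = T (pd i f u) := by
  simp only [pd]
  have := (T.hasFDerivAt (x := f u)).comp u hf.hasFDerivAt
  rw [show (fun v => T (f v)) = T ∘ f from rfl, this.fderiv]; rfl

theorem pd_congr {f g : Plane → V} {u : Plane} (i : Fin 2) (h : f =ᶠ[nhds u] g) :
    pd i f u = pd i g u := by
  simp only [pd]; rw [h.fderiv_eq]

theorem eventually_pd_eq {f g : Plane → V} {u : Plane} (i : Fin 2) (h : f =ᶠ[nhds u] g) :
    pd i f =ᶠ[nhds u] pd i g :=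
  h.eventually_nhds.mono fun _ hv => pd_congr i hv

theorem pd_comm_of_two {f : Plane → V} {u : Plane} (hf : ContDiffAt ℝ 2 f u) (i j : Fin 2) :
    pd i (pd j f) u = pd j (pd i f) u := by
  have hd : DifferentiableAt ℝ (fderiv ℝ f) u :=
    ((hf.fderiv_right (m := 1) le_rfl)).differentiableAt (by simp)
  have e (k l : Fin 2) : pd k (pd l f) u =
      fderiv ℝ (fderiv ℝ f) u (EuclideanSpace.single k 1) (EuclideanSpace.single l 1) := by
    change fderiv ℝ (fun v => fderiv ℝ f v (EuclideanSpace.single l 1)) u _ = _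
    rw [fderiv_clm_apply hd (differentiableAt_const _)]
    simp
  have hs : IsSymmSndFDerivAt ℝ f u := by
    refine hf.isSymmSndFDerivAt ?_
    simp only [minSmoothness_of_isRCLikeNormedField]
    exact le_rfl
  rw [e, e, hs.eq]

theorem _root_.ContDiffAt.two {f : Plane → V} {u : Plane} (hf : ContDiffAt ℝ ∞ f u) :
    ContDiffAt ℝ 2 f u := hf.of_le (WithTop.coe_le_coe.2 (le_top : (2 : ℕ∞) ≤ ⊤))

theorem pd_comm {f : Plane → V} {u : Plane} (hf : ContDiffAt ℝ ∞ f u) (i j : Fin 2) :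
    pd i (pd j f) u = pd j (pd i f) u := pd_comm_of_two hf.two i j

theorem eventually_pd_comm {f : Plane → V} {u : Plane} (hf : ContDiffAt ℝ ∞ f u) (i j : Fin 2) :
    pd i (pd j f) =ᶠ[nhds u] pd j (pd i f) := by
  filter_upwards [hf.two.eventually (by simp)] with v hv
  exact pd_comm_of_two hv i j

/-- `f` is differentiable at `u`, with `i`-th partial derivative `f'`. -/
def HasPd (i : Fin 2) (f : Plane → V) (f' : V) (u : Plane) : Prop :=
  DifferentiableAt ℝ f u ∧ pd i f u = f'

section HasPd

variable {i : Fin 2} {u : Plane} {f g : Plane → V} {f' g' : V}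

theorem _root_.ContDiffAt.hasPd (hf : ContDiffAt ℝ ∞ f u) (i : Fin 2) :
    HasPd i f (pd i f u) u := ⟨hf.dAt, rfl⟩

theorem HasPd.of_eq {f'' : V} (hf : HasPd i f f' u) (h : f' = f'') : HasPd i f f'' u := h ▸ hf

theorem HasPd.unique (hf : HasPd i f f' u) (hg : HasPd i f g' u) : f' = g' :=
  hf.2.symm.trans hg.2

theorem HasPd.congr (hf : HasPd i f f' u) (h : g =ᶠ[nhds u] f) : HasPd i g f' u :=
  ⟨hf.1.congr_of_eventuallyEq h, (pd_congr i h).trans hf.2⟩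

theorem hasPd_const (c : V) : HasPd i (fun _ => c) 0 u :=
  ⟨differentiableAt_const c, pd_const c u i⟩

theorem HasPd.add (hf : HasPd i f f' u) (hg : HasPd i g g' u) :
    HasPd i (fun v => f v + g v) (f' + g') u :=
  ⟨hf.1.fun_add hg.1, by rw [pd_add i hf.1 hg.1, hf.2, hg.2]⟩

theorem HasPd.sub (hf : HasPd i f f' u) (hg : HasPd i g g' u) :
    HasPd i (fun v => f v - g v) (f' - g') u :=
  ⟨hf.1.fun_sub hg.1, by rw [pd_sub i hf.1 hg.1, hf.2, hg.2]⟩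

theorem HasPd.neg (hf : HasPd i f f' u) : HasPd i (fun v => -f v) (-f') u :=
  ⟨hf.1.fun_neg, by rw [pd_neg i, hf.2]⟩

theorem HasPd.bilin (B : V →L[ℝ] W →L[ℝ] Z) {k : Plane → W} {k' : W}
    (hf : HasPd i f f' u) (hk : HasPd i k k' u) :
    HasPd i (fun v => B (f v) (k v)) (B f' (k u) + B (f u) k') u :=
  ⟨(B.hasFDerivAt_of_bilinear hf.1.hasFDerivAt hk.1.hasFDerivAt).differentiableAt,
    by rw [pd_bilin B i hf.1 hk.1, hf.2, hk.2]⟩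

theorem HasPd.smul {c : Plane → ℝ} {c' : ℝ} (hc : HasPd i c c' u) (hf : HasPd i f f' u) :
    HasPd i (fun v => c v • f v) (c' • f u + c u • f') u :=
  hc.bilin (ContinuousLinearMap.lsmul ℝ ℝ) hf

theorem HasPd.mul {c d : Plane → ℝ} {c' d' : ℝ} (hc : HasPd i c c' u) (hd : HasPd i d d' u) :
    HasPd i (fun v => c v * d v) (c' * d u + c u * d') u := hc.smul hd

theorem HasPd.const_smul (c : ℝ) (hf : HasPd i f f' u) :
    HasPd i (fun v => c • f v) (c • f') u :=
  ((hasPd_const c).smul hf).of_eq (by simp)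

theorem HasPd.clm (T : V →L[ℝ] W) (hf : HasPd i f f' u) :
    HasPd i (fun v => T (f v)) (T f') u :=
  ⟨T.differentiableAt.comp u hf.1, by rw [pd_clm T i hf.1, hf.2]⟩

theorem HasPd.ip {f g : Plane → E42} {f' g' : E42} (hf : HasPd i f f' u) (hg : HasPd i g g' u) :
    HasPd i (fun v => ip (f v) (g v)) (ip f' (g u) + ip (f u) g') u :=
  hf.bilin ipB hg

theorem HasPd.wedge {f g : Plane → E42} {f' g' : E42} (hf : HasPd i f f' u)
    (hg : HasPd i g g' u) :
    HasPd i (fun v => wedge (f v) (g v)) (wedge f' (g u) + wedge (f u) g') u :=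
  hf.bilin wedgeB hg

theorem HasPd.bdot {f g : Plane → Bivec} {f' g' : Bivec} (hf : HasPd i f f' u)
    (hg : HasPd i g g' u) :
    HasPd i (fun v => bdot (f v) (g v)) (bdot f' (g u) + bdot (f u) g') u :=
  hf.bilin bdotB hg

end HasPd

theorem plane_eq_sum (w : Plane) :
    w = ∑ i, w i • (EuclideanSpace.single i (1 : ℝ) : Plane) := by
  ext j; fin_cases j <;> simp

theorem fderiv_eq_sum_pd (f : Plane → V) (u w : Plane) :
    fderiv ℝ f u w = ∑ i, w i • pd i f u := by
  conv_lhs => rw [plane_eq_sum w]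
  simp [pd]

/-- The chain rule for partial derivatives. -/
theorem pd_comp {f : Plane → V} {ψ : Plane → Plane} {u : Plane} (i : Fin 2)
    (hf : DifferentiableAt ℝ f (ψ u)) (hψ : DifferentiableAt ℝ ψ u) :
    pd i (f ∘ ψ) u = ∑ a, pd i ψ u a • pd a f (ψ u) := by
  rw [← fderiv_eq_sum_pd, pd, fderiv_comp u hf hψ]; rfl

theorem pd_apply {ψ : Plane → Plane} {u : Plane} (i a : Fin 2) (hψ : DifferentiableAt ℝ ψ u) :
    pd i (fun v => ψ v a) u = pd i ψ u a :=
  pd_clm (EuclideanSpace.proj a) i hψ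

end Calculus

/-! ### Invariance of the Laplacian under changes of coordinates -/

section Invariance

open Matrix

variable {V : Type*} [NormedAddCommGroup V] [NormedSpace ℝ V]

theorem metric_apply (X : Plane → E42) (u : Plane) (i j : Fin 2) :
    metric X u i j = ip (pd i X u) (pd j X u) := rfl

theorem metric_transpose (X : Plane → E42) (u : Plane) : (metric X u)ᵀ = metric X u := by
  ext i j; exact ip_comm _ _

theorem metric_inv_symm (X : Plane → E42) (u : Plane) (i j : Fin 2) :
    (metric X u)⁻¹ i j = (metric X u)⁻¹ j i := by
  have := congrArg Inv.inv (metric_transpose X u)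
  rw [← transpose_nonsing_inv] at this
  exact congrFun (congrFun this j) i

/-- The linear map which sends `∂ₖX` to `∂ₖf` and vanishes on the normal space. -/
noncomputable def tanOp (X : Plane → E42) (f : Plane → V) (u : Plane) (w : E42) : V :=
  ∑ k, (∑ l, (metric X u)⁻¹ k l * ip w (pd l X u)) • pd k f u

theorem tanOp_add (X : Plane → E42) (f : Plane → V) (u : Plane) (v w : E42) :
    tanOp X f u (v + w) = tanOp X f u v + tanOp X f u w := by
  simp only [tanOp, Fin.sum_univ_two, ip_add_left]; module

theorem tanOp_smul (X : Plane → E42) (f : Plane → V) (u : Plane) (c : ℝ) (w : E42) :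
    tanOp X f u (c • w) = c • tanOp X f u w := by
  simp only [tanOp, Fin.sum_univ_two, ip_smul_left]; module

theorem tanOp_pd {X : Plane → E42} (f : Plane → V) {u : Plane} (h : (metric X u).det ≠ 0)
    (a : Fin 2) : tanOp X f u (pd a X u) = pd a f u := by
  have hg : (metric X u)⁻¹ * metric X u = 1 :=
    nonsing_inv_mul _ (isUnit_iff_ne_zero.2 h)
  have e (k) : ∑ l, (metric X u)⁻¹ k l * ip (pd a X u) (pd l X u) = (1 : Matrix _ _ ℝ) k a := by
    rw [← hg, mul_apply]
    simp only [metric_apply, ip_comm (pd a X u)]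
  simp only [tanOp, e]
  simp [Matrix.one_apply, Finset.sum_ite_eq']

theorem lap_eq_tanOp (X : Plane → E42) (f : Plane → V) (u : Plane) :
    lap X f u = -∑ i, ∑ j, (metric X u)⁻¹ i j •
      (pd i (pd j f) u - tanOp X f u (pd i (pd j X) u)) := rfl

theorem nor_eq_tanOp (X : Plane → E42) (u : Plane) (w : E42) :
    nor X u w = w - tanOp X X u w := by
  simp only [nor, tanOp, Fin.sum_univ_two, metric_inv_symm X u 1 0]; module

/-- Beltrami's formula; the coordinate invariance of `H` is deduced from that of the Laplacian. -/
theorem meanCurv_eq_lap (X : Plane → E42) (u : Plane) :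
    meanCurv X u = (-(1 / 2) : ℝ) • lap X X u := by
  simp only [meanCurv, lap_eq_tanOp, secondForm, nor_eq_tanOp]; module

/-- The Jacobian matrix `∂ᵢψᵃ`. -/
noncomputable def jac (ψ : Plane → Plane) (u : Plane) : Matrix (Fin 2) (Fin 2) ℝ :=
  Matrix.of fun a i => pd i ψ u a

variable {X : Plane → E42} {f : Plane → V} {ψ : Plane → Plane} {u : Plane}

theorem metric_comp (hX : DifferentiableAt ℝ X (ψ u)) (hψ : DifferentiableAt ℝ ψ u) :
    metric (X ∘ ψ) u = (jac ψ u)ᵀ * metric X (ψ u) * jac ψ u := by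
  ext i j
  simp only [metric_apply, pd_comp _ hX hψ, jac, mul_apply, Fin.sum_univ_two, transpose_apply,
    of_apply, ip_add_left, ip_add_right, ip_smul_left, ip_smul_right]
  ring

/-- The contravariance of the inverse metric; every invariance statement below reduces to this
matrix identity. -/
theorem jac_mul_metric_comp_inv (hX : DifferentiableAt ℝ X (ψ u)) (hψ : DifferentiableAt ℝ ψ u)
    (hJ : (jac ψ u).det ≠ 0) :
    jac ψ u * (metric (X ∘ ψ) u)⁻¹ * (jac ψ u)ᵀ = (metric X (ψ u))⁻¹ := by
  have h1 : IsUnit (jac ψ u).det := isUnit_iff_ne_zero.2 hJ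
  have h2 : IsUnit (jac ψ u)ᵀ.det := by rwa [det_transpose]
  rw [metric_comp hX hψ, Matrix.mul_inv_rev, Matrix.mul_inv_rev]
  rw [← Matrix.mul_assoc (jac ψ u), mul_nonsing_inv _ h1, Matrix.one_mul, Matrix.mul_assoc, nonsing_inv_mul _ h2,
    Matrix.mul_one]

theorem tanOp_comp (hX : DifferentiableAt ℝ X (ψ u)) (hf : DifferentiableAt ℝ f (ψ u))
    (hψ : DifferentiableAt ℝ ψ u) (hJ : (jac ψ u).det ≠ 0) (w : E42) :
    tanOp (X ∘ ψ) (f ∘ ψ) u w = tanOp X f (ψ u) w := by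
  have K := jac_mul_metric_comp_inv hX hψ hJ
  simp only [tanOp, ← K, pd_comp _ hX hψ, pd_comp _ hf hψ, Fin.sum_univ_two, mul_apply,
    transpose_apply, jac, of_apply, ip_add_right, ip_smul_right]
  module

theorem nor_comp (hX : DifferentiableAt ℝ X (ψ u))
    (hψ : DifferentiableAt ℝ ψ u) (hJ : (jac ψ u).det ≠ 0) (w : E42) :
    nor (X ∘ ψ) u w = nor X (ψ u) w := by
  rw [nor_eq_tanOp, nor_eq_tanOp, tanOp_comp hX hX hψ hJ]

theorem pd_pd_comp (hf : ContDiffAt ℝ ∞ f (ψ u)) (hψ : ContDiffAt ℝ ∞ ψ u) (i j : Fin 2) :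
    pd i (pd j (f ∘ ψ)) u = ∑ a, (pd i (pd j ψ) u a • pd a f (ψ u)
      + pd j ψ u a • ∑ b, pd i ψ u b • pd b (pd a f) (ψ u)) := by
  have hev : pd j (f ∘ ψ) =ᶠ[nhds u] fun v => ∑ a, pd j ψ v a • pd a f (ψ v) := by
    have h1 : ∀ᶠ v in nhds u, ContDiffAt ℝ 1 ψ v :=
      (hψ.of_le (by simp)).eventually (by simp)
    have h2 : ∀ᶠ v in nhds u, ContDiffAt ℝ 1 f (ψ v) :=
      hψ.continuousAt.eventually ((hf.of_le (by simp)).eventually (by simp))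
    filter_upwards [h1, h2] with v hv hv'
    exact pd_comp j (hv'.differentiableAt (by simp)) (hv.differentiableAt (by simp))
  rw [pd_congr i hev]
  have hd (a : Fin 2) : DifferentiableAt ℝ (fun v => pd j ψ v a) u :=
    (EuclideanSpace.proj a : Plane →L[ℝ] ℝ).differentiableAt.comp u (contDiffAt_pd j hψ).dAt
  have hd' (a : Fin 2) : DifferentiableAt ℝ (fun v => pd a f (ψ v)) u :=
    (contDiffAt_pd a hf).dAt.comp u hψ.dAt
  have e (a : Fin 2) : pd i (fun v => pd j ψ v a • pd a f (ψ v)) u =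
      pd i (pd j ψ) u a • pd a f (ψ u)
        + pd j ψ u a • ∑ b, pd i ψ u b • pd b (pd a f) (ψ u) := by
    rw [pd_smul i (hd a) (hd' a), pd_apply i a (contDiffAt_pd j hψ).dAt,
      show (fun v => pd a f (ψ v)) = pd a f ∘ ψ from rfl,
      pd_comp i (contDiffAt_pd a hf).dAt hψ.dAt]
  simp only [Fin.sum_univ_two] at e ⊢
  rw [pd_add i ((hd 0).fun_smul (hd' 0)) ((hd 1).fun_smul (hd' 1)), e, e]

/-- The second derivatives of ψ enter the Hessian of `f` and, through `X`, the Christoffel term.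
Since `tanOp` sends ∂ₐX to ∂ₐf, these two contributions cancel, and what remains is contracted with
the inverse metric. -/
theorem lap_comp (hX : ContDiffAt ℝ ∞ X (ψ u)) (hf : ContDiffAt ℝ ∞ f (ψ u))
    (hψ : ContDiffAt ℝ ∞ ψ u) (hJ : (jac ψ u).det ≠ 0) (hg : (metric X (ψ u)).det ≠ 0) :
    lap (X ∘ ψ) (f ∘ ψ) u = lap X f (ψ u) := by
  have K := jac_mul_metric_comp_inv hX.dAt hψ.dAt hJ
  rw [lap_eq_tanOp, lap_eq_tanOp]
  simp only [tanOp_comp hX.dAt hf.dAt hψ.dAt hJ, pd_pd_comp hX hψ, pd_pd_comp hf hψ,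
    Fin.sum_univ_two, tanOp_add, tanOp_smul, tanOp_pd f hg]
  simp only [← K, Fin.sum_univ_two, mul_apply, transpose_apply, jac, of_apply]
  module

theorem meanCurv_comp (hX : ContDiffAt ℝ ∞ X (ψ u)) (hψ : ContDiffAt ℝ ∞ ψ u)
    (hJ : (jac ψ u).det ≠ 0) (hg : (metric X (ψ u)).det ≠ 0) :
    meanCurv (X ∘ ψ) u = meanCurv X (ψ u) := by
  rw [meanCurv_eq_lap, meanCurv_eq_lap, lap_comp hX hX hψ hJ hg]

theorem metric_congr {Y : Plane → E42} (h : X =ᶠ[nhds u] Y) : metric X u = metric Y u := by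
  ext i j; simp only [metric_apply, pd_congr _ h]

theorem lap_congr {Y : Plane → E42} {g : Plane → V} (h : X =ᶠ[nhds u] Y)
    (h' : f =ᶠ[nhds u] g) : lap X f u = lap Y g u := by
  simp only [lap, christoffel, metric_congr h, pd_congr _ h, pd_congr _ h',
    pd_congr _ (eventually_pd_eq _ h), pd_congr _ (eventually_pd_eq _ h')]

theorem lap_smul_const (c : ℝ) : lap X (fun v => c • f v) u = c • lap X f u := by
  have e (i : Fin 2) : pd i (fun v => c • f v) = fun v => c • pd i f v := by
    ext v
    simp only [pd]
    rw [show (fun v => c • f v) = c • f from rfl, fderiv_const_smul_field]; rfl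
  have e' (i j : Fin 2) : pd i (fun v => c • pd j f v) u = c • pd i (pd j f) u := by
    simp only [pd]
    rw [show (fun v => c • fderiv ℝ f v (EuclideanSpace.single j 1)) =
      c • (fun v => fderiv ℝ f v (EuclideanSpace.single j 1)) from rfl,
      fderiv_const_smul_field]; rfl
  simp only [lap, e, e', Fin.sum_univ_two]
  module

/-- Tangent vectors are independent of the coordinates. -/
theorem tangentVec_comp (hX : DifferentiableAt ℝ X (ψ u)) (hψ : DifferentiableAt ℝ ψ u)
    (a : Fin 2 → ℝ) : tangentVec (X ∘ ψ) u a = tangentVec X (ψ u) ((jac ψ u).mulVec a) := by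
  simp only [tangentVec, pd_comp _ hX hψ, mulVec, dotProduct, jac, of_apply, Fin.sum_univ_two]
  module

end Invariance

/-! ### Smoothness of the geometric quantities -/

section Smooth

variable {X : Plane → E42} {u : Plane}

theorem contDiffAt_ip {f g : Plane → E42} (hf : ContDiffAt ℝ ∞ f u) (hg : ContDiffAt ℝ ∞ g u) :
    ContDiffAt ℝ ∞ (fun v => ip (f v) (g v)) u :=
  (ipB.contDiff.contDiffAt.comp u hf).clm_apply hg

theorem contDiffAt_wedge {f g : Plane → E42} (hf : ContDiffAt ℝ ∞ f u)
    (hg : ContDiffAt ℝ ∞ g u) : ContDiffAt ℝ ∞ (fun v => wedge (f v) (g v)) u :=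
  (wedgeB.contDiff.contDiffAt.comp u hf).clm_apply hg

theorem contDiffAt_bdot {f g : Plane → Bivec} (hf : ContDiffAt ℝ ∞ f u)
    (hg : ContDiffAt ℝ ∞ g u) : ContDiffAt ℝ ∞ (fun v => bdot (f v) (g v)) u :=
  (bdotB.contDiff.contDiffAt.comp u hf).clm_apply hg

theorem metric_det (X : Plane → E42) (u : Plane) :
    (metric X u).det = ip (pd 0 X u) (pd 0 X u) * ip (pd 1 X u) (pd 1 X u)
      - ip (pd 0 X u) (pd 1 X u) * ip (pd 0 X u) (pd 1 X u) := by
  rw [Matrix.det_fin_two]; simp only [metric_apply, ip_comm (pd 1 X u) (pd 0 X u)]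

theorem metric_inv_00 (X : Plane → E42) (u : Plane) :
    (metric X u)⁻¹ 0 0 = (metric X u).det⁻¹ * ip (pd 1 X u) (pd 1 X u) := by
  simp [Matrix.inv_def, Matrix.adjugate_fin_two, metric_apply]

theorem metric_inv_01 (X : Plane → E42) (u : Plane) :
    (metric X u)⁻¹ 0 1 = -((metric X u).det⁻¹ * ip (pd 0 X u) (pd 1 X u)) := by
  simp [Matrix.inv_def, Matrix.adjugate_fin_two, metric_apply]

theorem metric_inv_11 (X : Plane → E42) (u : Plane) :
    (metric X u)⁻¹ 1 1 = (metric X u).det⁻¹ * ip (pd 0 X u) (pd 0 X u) := by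
  simp [Matrix.inv_def, Matrix.adjugate_fin_two, metric_apply]

theorem contDiffAt_metric_det (hX : ContDiffAt ℝ ∞ X u) :
    ContDiffAt ℝ ∞ (fun v => (metric X v).det) u := by
  simp only [metric_det]
  have h0 := contDiffAt_pd 0 hX
  have h1 := contDiffAt_pd 1 hX
  exact ((contDiffAt_ip h0 h0).mul (contDiffAt_ip h1 h1)).sub
    ((contDiffAt_ip h0 h1).mul (contDiffAt_ip h0 h1))

theorem contDiffAt_metric_inv (hX : ContDiffAt ℝ ∞ X u) (h : (metric X u).det ≠ 0)
    (i j : Fin 2) : ContDiffAt ℝ ∞ (fun v => (metric X v)⁻¹ i j) u := by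
  have hd := (contDiffAt_metric_det hX).inv h
  have h0 := contDiffAt_pd 0 hX
  have h1 := contDiffAt_pd 1 hX
  have h01 : ContDiffAt ℝ ∞ (fun v => (metric X v)⁻¹ 0 1) u := by
    simp only [metric_inv_01]; exact (hd.mul (contDiffAt_ip h0 h1)).neg
  fin_cases i <;> fin_cases j
  · simp only [Fin.zero_eta, metric_inv_00]; exact hd.mul (contDiffAt_ip h1 h1)
  · exact h01
  · simpa only [Fin.zero_eta, Fin.mk_one, metric_inv_symm X _ 1 0] using h01
  · simp only [Fin.mk_one, metric_inv_11]; exact hd.mul (contDiffAt_ip h0 h0)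

theorem contDiffAt_tanOp {V : Type*} [NormedAddCommGroup V] [NormedSpace ℝ V] {f : Plane → V}
    {w : Plane → E42} (hX : ContDiffAt ℝ ∞ X u) (hf : ContDiffAt ℝ ∞ f u)
    (hw : ContDiffAt ℝ ∞ w u) (h : (metric X u).det ≠ 0) :
    ContDiffAt ℝ ∞ (fun v => tanOp X f v (w v)) u := by
  unfold tanOp
  refine ContDiffAt.sum fun k _ => ?_
  refine ContDiffAt.smul (𝕜' := ℝ) ?_ (contDiffAt_pd k hf)
  refine ContDiffAt.sum fun l _ => ?_
  exact (contDiffAt_metric_inv hX h k l).mul (contDiffAt_ip hw (contDiffAt_pd l hX))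

theorem contDiffAt_meanCurv (hX : ContDiffAt ℝ ∞ X u) (h : (metric X u).det ≠ 0) :
    ContDiffAt ℝ ∞ (meanCurv X) u := by
  have hij (i j) := contDiffAt_pd i (contDiffAt_pd j hX)
  have hs (i j) : ContDiffAt ℝ ∞ (fun v => (metric X v)⁻¹ i j • secondForm X i j v) u := by
    simp only [secondForm, nor_eq_tanOp]
    exact (contDiffAt_metric_inv hX h i j).smul ((hij i j).sub (contDiffAt_tanOp hX hX (hij i j) h))
  exact (contDiffAt_const (c := (1 / 2 : ℝ))).smul (ContDiffAt.sum fun i _ => ContDiffAt.sum fun j _ => hs i j)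

theorem ip_tanOp_pd (h : (metric X u).det ≠ 0) (w : E42) (k : Fin 2) :
    ip (tanOp X X u w) (pd k X u) = ip w (pd k X u) := by
  have hg : metric X u * (metric X u)⁻¹ = 1 :=
    Matrix.mul_nonsing_inv _ (isUnit_iff_ne_zero.2 h)
  have e (l) : (metric X u)⁻¹ 0 l * ip (pd 0 X u) (pd k X u)
      + (metric X u)⁻¹ 1 l * ip (pd 1 X u) (pd k X u) = (1 : Matrix _ _ ℝ) k l := by
    rw [← hg, Matrix.mul_apply, Fin.sum_univ_two]
    simp only [metric_apply, ip_comm _ (pd k X u)]; ring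
  have e0 := e 0
  have e1 := e 1
  simp only [tanOp, Fin.sum_univ_two, ip_add_left, ip_smul_left]
  have : ip w (pd k X u) = (1 : Matrix (Fin 2) (Fin 2) ℝ) k 0 * ip w (pd 0 X u)
      + (1 : Matrix (Fin 2) (Fin 2) ℝ) k 1 * ip w (pd 1 X u) := by
    obtain rfl | rfl : k = 0 ∨ k = 1 := by fin_cases k <;> simp
    all_goals simp
  rw [this, ← e0, ← e1]
  ring

theorem ip_nor_pd (h : (metric X u).det ≠ 0) (w : E42) (k : Fin 2) :
    ip (nor X u w) (pd k X u) = 0 := by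
  rw [nor_eq_tanOp, ip_sub_left, ip_tanOp_pd h, sub_self]

theorem ip_meanCurv_pd (h : (metric X u).det ≠ 0) (k : Fin 2) :
    ip (meanCurv X u) (pd k X u) = 0 := by
  simp only [meanCurv, secondForm, Fin.sum_univ_two, ip_smul_left, ip_add_left, ip_nor_pd h]
  ring

theorem tanOp_of_normal {V : Type*} [NormedAddCommGroup V] [NormedSpace ℝ V] (f : Plane → V)
    {w : E42} (hw : ∀ l, ip w (pd l X u) = 0) : tanOp X f u w = 0 := by
  simp [tanOp, hw]

end Smooth

/-! ### Formulas in coordinates which are normal at a point -/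

/-- At `u` the coordinate frame is pseudo-orthonormal and the Christoffel symbols vanish. -/
structure IsNullNormalAt (X : Plane → E42) (u : Plane) : Prop where
  smooth : ContDiffAt ℝ ∞ X u
  g00 : ip (pd 0 X u) (pd 0 X u) = 0
  g11 : ip (pd 1 X u) (pd 1 X u) = 0
  g01 : ip (pd 0 X u) (pd 1 X u) = -1
  normal : ∀ i j k, ip (pd i (pd j X) u) (pd k X u) = 0

namespace IsNullNormalAt

variable {X : Plane → E42} {u : Plane} (h : IsNullNormalAt X u)

include h

theorem det_eq : (metric X u).det = -1 := by
  rw [metric_det, h.g00, h.g11, h.g01]; norm_num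

theorem det_ne : (metric X u).det ≠ 0 := by rw [h.det_eq]; norm_num

theorem inv00 : (metric X u)⁻¹ 0 0 = 0 := by rw [metric_inv_00, h.g11, mul_zero]

theorem inv11 : (metric X u)⁻¹ 1 1 = 0 := by rw [metric_inv_11, h.g00, mul_zero]

theorem inv01 : (metric X u)⁻¹ 0 1 = -1 := by
  rw [metric_inv_01, h.g01, h.det_eq]; norm_num

theorem inv10 : (metric X u)⁻¹ 1 0 = -1 := by rw [metric_inv_symm, h.inv01]

theorem pd_metric (i j k : Fin 2) : pd k (fun v => ip (pd i X v) (pd j X v)) u = 0 := by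
  rw [pd_ip k (contDiffAt_pd i h.smooth).dAt (contDiffAt_pd j h.smooth).dAt, h.normal,
    ip_comm, h.normal, add_zero]

theorem pd_det (k : Fin 2) : pd k (fun v => (metric X v).det) u = 0 := by
  have h0 := contDiffAt_pd 0 h.smooth
  have h1 := contDiffAt_pd 1 h.smooth
  simp only [metric_det]
  rw [pd_sub k ((contDiffAt_ip h0 h0).mul (contDiffAt_ip h1 h1)).dAt
    ((contDiffAt_ip h0 h1).mul (contDiffAt_ip h0 h1)).dAt,
    pd_mul k (contDiffAt_ip h0 h0).dAt (contDiffAt_ip h1 h1).dAt,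
    pd_mul k (contDiffAt_ip h0 h1).dAt (contDiffAt_ip h0 h1).dAt]
  simp only [h.pd_metric]; ring

theorem eventually_det_ne : ∀ᶠ v in nhds u, (metric X v).det ≠ 0 :=
  (contDiffAt_metric_det h.smooth).continuousAt.eventually_ne h.det_ne

/-- Differentiate g⁻¹g = 1: the derivatives of g vanish at `u`, and g is invertible there. -/
theorem pd_metric_inv (i j k : Fin 2) : pd k (fun v => (metric X v)⁻¹ i j) u = 0 := by
  have hs (a b) := contDiffAt_metric_inv h.smooth h.det_ne a b
  have hm (a b) := contDiffAt_ip (contDiffAt_pd a h.smooth) (contDiffAt_pd b h.smooth)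
  have key (l : Fin 2) : pd k (fun v => (metric X v)⁻¹ i 0 * ip (pd 0 X v) (pd l X v)
      + (metric X v)⁻¹ i 1 * ip (pd 1 X v) (pd l X v)) u = 0 := by
    rw [pd_congr k (g := fun _ => (1 : Matrix (Fin 2) (Fin 2) ℝ) i l), pd_const]
    filter_upwards [h.eventually_det_ne] with v hv
    rw [← Matrix.nonsing_inv_mul _ (isUnit_iff_ne_zero.2 hv), Matrix.mul_apply,
      Fin.sum_univ_two]
    simp only [metric_apply]
  have key' (l : Fin 2) : pd k (fun v => (metric X v)⁻¹ i 0) u * ip (pd 0 X u) (pd l X u)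
      + pd k (fun v => (metric X v)⁻¹ i 1) u * ip (pd 1 X u) (pd l X u) = 0 := by
    rw [← key l, pd_add k ((hs i 0).mul (hm 0 l)).dAt ((hs i 1).mul (hm 1 l)).dAt,
      pd_mul k (hs i 0).dAt (hm 0 l).dAt, pd_mul k (hs i 1).dAt (hm 1 l).dAt, h.pd_metric,
      h.pd_metric]
    ring
  have k0 := key' 0
  have k1 := key' 1
  rw [h.g00, ip_comm, h.g01] at k0
  rw [h.g01, h.g11] at k1
  fin_cases j <;> simp only [Fin.zero_eta, Fin.mk_one] <;> linarith

theorem meanCurv_eq : meanCurv X u = -pd 0 (pd 1 X) u := by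
  have e (i j) : secondForm X i j u = pd i (pd j X) u := by
    rw [secondForm, nor_eq_tanOp, tanOp_of_normal _ (h.normal i j), sub_zero]
  simp only [meanCurv, Fin.sum_univ_two, h.inv00, h.inv01, h.inv10, h.inv11, e]
  rw [pd_comm h.smooth 1 0]
  module

/-- Up to tangent vectors, `∂ₖH = -∂ₖ∂₀∂₁X`. -/
theorem pd_meanCurv (k : Fin 2) : ∃ p q : ℝ,
    pd k (meanCurv X) u = -pd k (pd 0 (pd 1 X)) u + p • pd 0 X u + q • pd 1 X u := by
  have hs (a b) := contDiffAt_metric_inv h.smooth h.det_ne a b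
  have hp (a) := contDiffAt_pd a h.smooth
  have hpp (a b) := contDiffAt_pd a (hp b)
  -- Y is the trace of the second derivatives and μ holds its tangential components, so H = (Y -
  -- μᵃ∂ₐX)/2. As μ vanishes at `u`, differentiating it contributes only tangent vectors, the source
  -- of p and q.
  let Y : Plane → E42 := fun v => ∑ i, ∑ j, (metric X v)⁻¹ i j • pd i (pd j X) v
  let μ : Fin 2 → Plane → ℝ := fun a v => ∑ l, (metric X v)⁻¹ a l * ip (Y v) (pd l X v)
  have hY : ContDiffAt ℝ ∞ Y u :=
    ContDiffAt.sum fun i _ => ContDiffAt.sum fun j _ => (hs i j).smul (hpp i j)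
  have hμ (a) : ContDiffAt ℝ ∞ (μ a) u :=
    ContDiffAt.sum fun l _ => (hs a l).mul (contDiffAt_ip hY (hp l))
  have hH : meanCurv X = fun v => (1 / 2 : ℝ) • (Y v - (μ 0 v • pd 0 X v + μ 1 v • pd 1 X v)) := by
    ext1 v
    have : μ 0 v • pd 0 X v + μ 1 v • pd 1 X v = tanOp X X v (Y v) := by
      simp [tanOp, μ]
    rw [this, meanCurv]
    simp only [Y, secondForm, nor_eq_tanOp, Fin.sum_univ_two, tanOp_add, tanOp_smul]
    module
  have hμ0 (a) : μ a u = 0 := by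
    have hl (l : Fin 2) : ip (Y u) (pd l X u) = 0 := by
      simp only [Y, Fin.sum_univ_two, ip_add_left, ip_smul_left, h.normal]; ring
    simp [μ, hl]
  have hdY : pd k Y u = -(2 : ℝ) • pd k (pd 0 (pd 1 X)) u := by
    have e (i j) : HasPd k (fun v => (metric X v)⁻¹ i j • pd i (pd j X) v)
        ((metric X u)⁻¹ i j • pd k (pd i (pd j X)) u) u :=
      (((hs i j).hasPd k).smul ((hpp i j).hasPd k)).of_eq (by
        rw [h.pd_metric_inv, zero_smul, zero_add])
    have hc : pd k (pd 1 (pd 0 X)) u = pd k (pd 0 (pd 1 X)) u :=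
      pd_congr k (eventually_pd_comm h.smooth 1 0)
    have hYe := (((e 0 0).add (e 0 1)).add ((e 1 0).add (e 1 1))).2
    simp only [Y, Fin.sum_univ_two]
    rw [hYe, h.inv00, h.inv01, h.inv10, h.inv11, hc]
    module
  refine ⟨-(1 / 2) * pd k (μ 0) u, -(1 / 2) * pd k (μ 1) u, ?_⟩
  rw [hH]
  have hm (a) := ((hμ a).hasPd k).smul ((hp a).hasPd k)
  have e := (((hY.hasPd k).sub ((hm 0).add (hm 1))).const_smul (1 / 2)).2
  rw [e, hμ0, hμ0, hdY]
  module

theorem lap_eq {V : Type*} [NormedAddCommGroup V] [NormedSpace ℝ V] {f : Plane → V}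
    (hf : ContDiffAt ℝ ∞ f u) : lap X f u = (2 : ℝ) • pd 0 (pd 1 f) u := by
  simp only [lap_eq_tanOp, tanOp_of_normal f (h.normal _ _), Fin.sum_univ_two, h.inv00, h.inv01,
    h.inv10, h.inv11]
  rw [pd_comm hf 1 0]
  module

end IsNullNormalAt

theorem bdot_wedge_wedge (p q r s : E42) :
    bdot (wedge p q) (wedge r s) = ip p r * ip q s - ip q r * ip p s := by
  rw [bdot_wedge (wedge_antisymm p q), ev_wedge]

/-- Near `u`, `G` is the exterior product of a pseudo-orthonormal tangent frame. -/
def IsLocalGaussMap (X : Plane → E42) (G : Plane → Bivec) (u : Plane) : Prop :=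
  ∃ a b : Fin 2 → ℝ, IsPseudoOrthonormal (tangentVec X u a) (tangentVec X u b) ∧
    G u = wedge (tangentVec X u a) (tangentVec X u b)

theorem IsLocalGaussMap.exists_eq_smul {X : Plane → E42} {G : Plane → Bivec} {u : Plane}
    (hG : IsLocalGaussMap X G u) : ∃ c : ℝ, G u = c • wedge (pd 0 X u) (pd 1 X u) := by
  obtain ⟨a, b, -, h⟩ := hG
  refine ⟨a 0 * b 1 - a 1 * b 0, ?_⟩
  rw [h]
  simp only [tangentVec, Fin.sum_univ_two, wedge_add_left, wedge_add_right, wedge_smul_left,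
    wedge_smul_right, wedge_self, wedge_comm (pd 1 X u) (pd 0 X u)]
  module

theorem IsLocalGaussMap.bdot_self {X : Plane → E42} {G : Plane → Bivec} {u : Plane}
    (hG : IsLocalGaussMap X G u) : bdot (G u) (G u) = -1 := by
  obtain ⟨a, b, ⟨h1, h2, h3⟩, h⟩ := hG
  rw [h, bdot_wedge_wedge, h1, h2, h3, ip_comm, h3]; norm_num

namespace IsNullNormalAt

variable {X : Plane → E42} {u : Plane} (h : IsNullNormalAt X u)
  {G : Plane → Bivec} (hGs : ContDiffAt ℝ ∞ G u)
  (hG : ∀ᶠ v in nhds u, IsLocalGaussMap X G v)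
  (hGu : G u = wedge (pd 0 X u) (pd 1 X u))

include h hGs hG hGu

/-- From ⟨G,G⟩ = -1 the factor satisfies c² det g = -1. The determinant is stationary at `u`, hence
so is c. Its second derivatives are not controlled. -/
theorem exists_gauss_factor : ∃ c : Plane → ℝ, ContDiffAt ℝ ∞ c u ∧ c u = 1 ∧
    (∀ k, pd k c u = 0) ∧
    G =ᶠ[nhds u] fun v => c v • wedge (pd 0 X v) (pd 1 X v) := by
  have hp (a) := contDiffAt_pd a h.smooth
  have hW := contDiffAt_wedge (hp 0) (hp 1)
  have hdet := contDiffAt_metric_det h.smooth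
  have hWW (v) : bdot (wedge (pd 0 X v) (pd 1 X v)) (wedge (pd 0 X v) (pd 1 X v))
      = (metric X v).det := by
    rw [bdot_wedge_wedge, metric_det, ip_comm (pd 1 X v) (pd 0 X v)]
  let c : Plane → ℝ := fun v => bdot (G v) (wedge (pd 0 X v) (pd 1 X v)) * (metric X v).det⁻¹
  have hc : ContDiffAt ℝ ∞ c u := (contDiffAt_bdot hGs hW).mul (hdet.inv h.det_ne)
  have hcG : G =ᶠ[nhds u] fun v => c v • wedge (pd 0 X v) (pd 1 X v) := by
    filter_upwards [hG, h.eventually_det_ne] with v hv hd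
    obtain ⟨d, hd'⟩ := hv.exists_eq_smul
    simp only [c, hd', bdot_smul_left, hWW]
    rw [mul_assoc, mul_inv_cancel₀ hd, mul_one]
  have hcu : c u = 1 := by
    simp only [c, hGu, hWW, h.det_eq]; norm_num
  refine ⟨c, hc, hcu, fun k => ?_, hcG⟩
  have hcc : (fun v => c v * c v * (metric X v).det) =ᶠ[nhds u] fun _ => -1 := by
    filter_upwards [hG, hcG] with v hv hv'
    rw [← hv.bdot_self, hv', bdot_smul_left, bdot_smul_right, hWW]; ring
  have e := (((hc.hasPd k).mul (hc.hasPd k)).mul (hdet.hasPd k)).unique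
    ((hasPd_const (-1)).congr hcc)
  rw [h.pd_det, h.det_eq, hcu] at e
  linarith

theorem pd_gauss (k : Fin 2) : pd k G u =
    wedge (pd k (pd 0 X) u) (pd 1 X u) + wedge (pd 0 X u) (pd k (pd 1 X) u) := by
  obtain ⟨c, hc, hcu, hck, hcG⟩ := h.exists_gauss_factor hGs hG hGu
  have hp (a) := (contDiffAt_pd a h.smooth).hasPd k
  rw [(((hc.hasPd k).smul ((hp 0).wedge (hp 1))).congr hcG).2, hck, hcu, zero_smul, zero_add,
    one_smul]

/-- Obtained by differentiating c ∂₀X∧∂₁X twice; the unknown ∂₀∂₁c is the number θ. It need not be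
computed, since the component along G is found separately in `bdot_gauss_lap`. -/
theorem pd_pd_gauss : ∃ θ : ℝ, pd 0 (pd 1 G) u =
    θ • G u + wedge (pd 0 (pd 0 X) u) (pd 1 (pd 1 X) u)
      + wedge (pd 0 (pd 0 (pd 1 X)) u) (pd 1 X u)
      + wedge (pd 0 X u) (pd 1 (pd 0 (pd 1 X)) u) := by
  obtain ⟨c, hc, hcu, hck, hcG⟩ := h.exists_gauss_factor hGs hG hGu
  have hp (a) := contDiffAt_pd a h.smooth
  have hev : pd 1 G =ᶠ[nhds u] fun v => pd 1 c v • wedge (pd 0 X v) (pd 1 X v)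
      + c v • (wedge (pd 1 (pd 0 X) v) (pd 1 X v) + wedge (pd 0 X v) (pd 1 (pd 1 X) v)) := by
    have hd {W : Type} [NormedAddCommGroup W] [NormedSpace ℝ W] {f : Plane → W}
        (hf : ContDiffAt ℝ ∞ f u) : ∀ᶠ v in nhds u, DifferentiableAt ℝ f v :=
      (hf.two.eventually (by simp)).mono fun v hv => hv.differentiableAt (by simp)
    filter_upwards [hcG.eventually_nhds, hd hc, hd (hp 0), hd (hp 1)] with v hv h1 h2 h3
    have e0 : HasPd 1 (pd 0 X) (pd 1 (pd 0 X) v) v := ⟨h2, rfl⟩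
    have e1 : HasPd 1 (pd 1 X) (pd 1 (pd 1 X) v) v := ⟨h3, rfl⟩
    have ec : HasPd 1 c (pd 1 c v) v := ⟨h1, rfl⟩
    exact ((ec.smul (e0.wedge e1)).congr hv).2
  have hpp (a b) := (contDiffAt_pd a (hp b)).hasPd 0
  have e := (((((contDiffAt_pd 1 hc).hasPd 0).smul (((hp 0).hasPd 0).wedge ((hp 1).hasPd 0))).add
    ((hc.hasPd 0).smul (((hpp 1 0).wedge ((hp 1).hasPd 0)).add
      (((hp 0).hasPd 0).wedge (hpp 1 1))))).congr hev).2
  refine ⟨pd 0 (pd 1 c) u, ?_⟩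
  have h1 : pd 0 (pd 1 (pd 0 X)) u = pd 0 (pd 0 (pd 1 X)) u :=
    pd_congr 0 (eventually_pd_comm h.smooth 1 0)
  have h2 : pd 0 (pd 1 (pd 1 X)) u = pd 1 (pd 0 (pd 1 X)) u := pd_comm (hp 1) 0 1
  rw [e, hck, hck, hcu, h1, h2, pd_comm h.smooth 1 0, wedge_self, hGu]
  module

theorem lap_gauss : ∃ θ : ℝ, lap X G u = (2 : ℝ) • (θ • G u
    + wedge (pd 0 (pd 0 X) u) (pd 1 (pd 1 X) u)
    - wedge (pd 0 (meanCurv X) u) (pd 1 X u) - wedge (pd 0 X u) (pd 1 (meanCurv X) u)) := by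
  obtain ⟨θ, hθ⟩ := h.pd_pd_gauss hGs hG hGu
  obtain ⟨p, q, h0⟩ := h.pd_meanCurv 0
  obtain ⟨r, s, h1⟩ := h.pd_meanCurv 1
  refine ⟨θ + p + s, ?_⟩
  rw [h.lap_eq hGs, hθ, h0, h1, hGu]
  simp only [wedge_add_left, wedge_add_right, wedge_neg_left, wedge_neg_right, wedge_smul_left,
    wedge_smul_right, wedge_self]
  module

/-- Differentiating ⟨G,G⟩ = -1 twice gives ⟨G,∂₀∂₁G⟩ = -⟨∂₀G,∂₁G⟩, and the first derivatives are
known exactly. The term in ⟨H,H⟩ drops because H is null. -/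
theorem bdot_gauss_lap (hH : ip (meanCurv X u) (meanCurv X u) = 0) : bdot (G u) (lap X G u) =
    -2 * ip (pd 0 (pd 0 X) u) (pd 1 (pd 1 X) u) := by
  have hev : (fun v => bdot (G v) (pd 1 G v)) =ᶠ[nhds u] fun _ => 0 := by
    have hd := (hGs.two.eventually (by simp)).mono fun v hv => hv.differentiableAt (by simp)
    filter_upwards [hG.eventually_nhds, hd] with v hv hd
    have e1 : HasPd 1 G (pd 1 G v) v := ⟨hd, rfl⟩
    have hev : (fun v => bdot (G v) (G v)) =ᶠ[nhds v] fun _ => -1 :=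
      hv.mono fun w hw => hw.bdot_self
    have := (e1.bdot e1).unique ((hasPd_const (-1)).congr hev)
    rw [bdot_comm (pd 1 G v)] at this
    linarith
  have e := ((hGs.hasPd 0).bdot ((contDiffAt_pd 1 hGs).hasPd 0)).unique
    ((hasPd_const 0).congr hev)
  rw [h.meanCurv_eq, ip_neg_left, ip_neg_right, neg_neg] at hH
  rw [h.pd_gauss hGs hG hGu, h.pd_gauss hGs hG hGu, pd_comm h.smooth 1 0] at e
  simp only [bdot_add_left, bdot_add_right, bdot_wedge_wedge, hH, h.normal, h.g01, h.g00, h.g11,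
    ip_comm (pd 0 X u) (pd _ (pd _ X) u), ip_comm (pd 1 X u) (pd _ (pd _ X) u),
    ip_comm (pd 1 X u) (pd 0 X u)] at e
  rw [h.lap_eq hGs, bdot_smul_right]
  linarith

end IsNullNormalAt

/-! ### Coordinates adapted to a null frame at a point -/

section Adapted

variable {V : Type*} [NormedAddCommGroup V] [NormedSpace ℝ V]

/-- The derivative of `f` in the direction with components `a`. -/
noncomputable def dir (f : Plane → V) (u : Plane) (a : Fin 2 → ℝ) : V := ∑ i, a i • pd i f u

/-- The second derivative of `f` in the directions with components `a` and `b`. -/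
noncomputable def dir₂ (f : Plane → V) (u : Plane) (a b : Fin 2 → ℝ) : V :=
  ∑ i, ∑ j, (a i * b j) • pd i (pd j f) u

theorem hasPd_coord (i j : Fin 2) (u : Plane) :
    HasPd i (fun v : Plane => v j) (if j = i then 1 else 0) u := by
  refine ⟨(EuclideanSpace.proj j : Plane →L[ℝ] ℝ).differentiableAt, ?_⟩
  have := pd_clm (EuclideanSpace.proj j : Plane →L[ℝ] ℝ) (f := id) (u := u) i differentiableAt_id
  refine this.trans ?_
  simp [pd]

/-- A quadratic change of coordinates. -/
noncomputable def quadMap (u A B c00 c01 c11 : Plane) (w : Plane) : Plane :=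
  u + w 0 • A + w 1 • B - (w 0 * w 0 / 2) • c00 - (w 0 * w 1) • c01 - (w 1 * w 1 / 2) • c11

theorem contDiff_quadMap (u A B c00 c01 c11 : Plane) :
    ContDiff ℝ ∞ (quadMap u A B c00 c01 c11) := by
  unfold quadMap; fun_prop

theorem quadMap_zero (u A B c00 c01 c11 : Plane) : quadMap u A B c00 c01 c11 0 = u := by
  simp [quadMap]

theorem hasPd_quadMap (u A B c00 c01 c11 : Plane) (i : Fin 2) (w : Plane) :
    HasPd i (quadMap u A B c00 c01 c11)
      ((if (0 : Fin 2) = i then (1 : ℝ) else 0) • (A - w 0 • c00 - w 1 • c01)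
        + (if (1 : Fin 2) = i then (1 : ℝ) else 0) • (B - w 0 • c01 - w 1 • c11)) w := by
  have c0 := hasPd_coord i 0 w
  have c1 := hasPd_coord i 1 w
  have h : HasPd i (fun w : Plane => u + w 0 • A + w 1 • B - (1 / 2 : ℝ) • (w 0 * w 0) • c00
      - (w 0 * w 1) • c01 - (1 / 2 : ℝ) • (w 1 * w 1) • c11) _ w :=
    (((((hasPd_const u).add (c0.smul (hasPd_const A))).add (c1.smul (hasPd_const B))).sub
      (((c0.mul c0).smul (hasPd_const c00)).const_smul (1 / 2))).sub
      ((c0.mul c1).smul (hasPd_const c01))).sub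
      (((c1.mul c1).smul (hasPd_const c11)).const_smul (1 / 2))
  have e : quadMap u A B c00 c01 c11 = fun w : Plane => u + w 0 • A + w 1 • B
      - (1 / 2 : ℝ) • (w 0 * w 0) • c00
      - (w 0 * w 1) • c01 - (1 / 2 : ℝ) • (w 1 * w 1) • c11 := by
    ext1 w; simp only [quadMap]; module
  rw [e]
  refine h.of_eq ?_
  module

theorem pd_quadMap (u A B c00 c01 c11 : Plane) (w : Plane) :
    pd 0 (quadMap u A B c00 c01 c11) w = A - w 0 • c00 - w 1 • c01 ∧
    pd 1 (quadMap u A B c00 c01 c11) w = B - w 0 • c01 - w 1 • c11 := by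
  rw [(hasPd_quadMap u A B c00 c01 c11 0 w).2, (hasPd_quadMap u A B c00 c01 c11 1 w).2]
  simp

theorem pd_pd_quadMap (u A B c00 c01 c11 : Plane) (i j : Fin 2) :
    pd i (pd j (quadMap u A B c00 c01 c11)) 0 = -(![![c00, c01], ![c01, c11]] i j) := by
  have aux (A c d : Plane) : HasPd i (fun w : Plane => A - w 0 • c - w 1 • d)
      (-((if (0 : Fin 2) = i then (1 : ℝ) else 0) • c
      + (if (1 : Fin 2) = i then (1 : ℝ) else 0) • d)) 0 :=
    (((hasPd_const A).sub ((hasPd_coord i 0 0).smul (hasPd_const c))).sub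
      ((hasPd_coord i 1 0).smul (hasPd_const d))).of_eq (by module)
  have h0 : pd 0 (quadMap u A B c00 c01 c11) = _ := funext fun w => (pd_quadMap _ _ _ _ _ _ w).1
  have h1 : pd 1 (quadMap u A B c00 c01 c11) = _ := funext fun w => (pd_quadMap _ _ _ _ _ _ w).2
  obtain rfl | rfl : j = 0 ∨ j = 1 := by fin_cases j <;> simp
  · rw [h0, (aux _ _ _).2]
    obtain rfl | rfl : i = 0 ∨ i = 1 := by fin_cases i <;> simp
    all_goals simp
  · rw [h1, (aux _ _ _).2]
    obtain rfl | rfl : i = 0 ∨ i = 1 := by fin_cases i <;> simp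
    all_goals simp

theorem jac_quadMap_zero (u A B c00 c01 c11 : Plane) :
    jac (quadMap u A B c00 c01 c11) 0 = Matrix.of ![![A 0, B 0], ![A 1, B 1]] := by
  ext a i
  have := pd_quadMap u A B c00 c01 c11 0
  fin_cases a <;> fin_cases i <;> simp [jac, this.1, this.2]

variable {X : Plane → E42} {u : Plane} {a b : Fin 2 → ℝ}

/-- The components of the tangential part of `w`. -/
noncomputable def tanComp (X : Plane → E42) (u : Plane) (w : E42) : Plane :=
  WithLp.toLp 2 fun k => ∑ l, (metric X u)⁻¹ k l * ip w (pd l X u)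

/-- Coordinates in which the frame with components `a`, `b` is the coordinate frame at `0` and the
Christoffel symbols vanish there. -/
noncomputable def adapted (X : Plane → E42) (u : Plane) (a b : Fin 2 → ℝ) : Plane → Plane :=
  quadMap u (WithLp.toLp 2 a) (WithLp.toLp 2 b) (tanComp X u (dir₂ X u a a))
    (tanComp X u (dir₂ X u a b)) (tanComp X u (dir₂ X u b b))

theorem adapted_zero : adapted X u a b 0 = u := quadMap_zero _ _ _ _ _ _

theorem contDiff_adapted : ContDiff ℝ ∞ (adapted X u a b) := contDiff_quadMap _ _ _ _ _ _

theorem pd_comp_adapted {f : Plane → V} (hf : DifferentiableAt ℝ f u) :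
    pd 0 (f ∘ adapted X u a b) 0 = dir f u a ∧ pd 1 (f ∘ adapted X u a b) 0 = dir f u b := by
  have hψ : DifferentiableAt ℝ (adapted X u a b) 0 := contDiff_adapted.contDiffAt.dAt
  have e0 : pd 0 (adapted X u a b) 0 = WithLp.toLp 2 a := by
    unfold adapted; rw [(pd_quadMap _ _ _ _ _ _ _).1]; simp
  have e1 : pd 1 (adapted X u a b) 0 = WithLp.toLp 2 b := by
    unfold adapted; rw [(pd_quadMap _ _ _ _ _ _ _).2]; simp
  rw [← adapted_zero (X := X) (u := u) (a := a) (b := b)] at hf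
  rw [pd_comp 0 hf hψ, pd_comp 1 hf hψ, e0, e1, adapted_zero]
  exact ⟨rfl, rfl⟩

theorem sum_tanComp (w : E42) (f : Plane → V) :
    ∑ k, tanComp X u w k • pd k f u = tanOp X f u w := rfl

theorem pd_pd_comp_adapted (hX : ContDiffAt ℝ ∞ X u) :
    pd 0 (pd 0 (X ∘ adapted X u a b)) 0 = nor X u (dir₂ X u a a) ∧
    pd 0 (pd 1 (X ∘ adapted X u a b)) 0 = nor X u (dir₂ X u a b) ∧
    pd 1 (pd 1 (X ∘ adapted X u a b)) 0 = nor X u (dir₂ X u b b) := by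
  have hψ : ContDiffAt ℝ ∞ (adapted X u a b) 0 := contDiff_adapted.contDiffAt
  have e0 : pd 0 (adapted X u a b) 0 = WithLp.toLp 2 a := by
    unfold adapted; rw [(pd_quadMap _ _ _ _ _ _ _).1]; simp
  have e1 : pd 1 (adapted X u a b) 0 = WithLp.toLp 2 b := by
    unfold adapted; rw [(pd_quadMap _ _ _ _ _ _ _).2]; simp
  have hX' := hX
  rw [← adapted_zero (X := X) (u := u) (a := a) (b := b)] at hX'
  have hc (i j) : pd i (pd j (adapted X u a b)) 0 = _ := pd_pd_quadMap _ _ _ _ _ _ i j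
  simp only [nor_eq_tanOp, ← sum_tanComp, dir₂, pd_pd_comp hX' hψ, e0, e1, adapted_zero, hc,
    Fin.sum_univ_two, PiLp.neg_apply, Matrix.cons_val]
  rw [pd_comm hX 1 0]
  refine ⟨?_, ?_, ?_⟩ <;> module

theorem dir₂_comm (hX : ContDiffAt ℝ ∞ X u) (a b : Fin 2 → ℝ) :
    dir₂ X u a b = dir₂ X u b a := by
  simp only [dir₂, Fin.sum_univ_two]; rw [pd_comm hX 1 0]; module

theorem det_ne_of_frame (h : IsPseudoOrthonormal (tangentVec X u a) (tangentVec X u b)) :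
    a 0 * b 1 - a 1 * b 0 ≠ 0 ∧ (a 0 * b 1 - a 1 * b 0) ^ 2 * (metric X u).det = -1 := by
  have key : (a 0 * b 1 - a 1 * b 0) ^ 2 * (metric X u).det = -1 := by
    obtain ⟨h1, h2, h3⟩ := h
    have e : (a 0 * b 1 - a 1 * b 0) ^ 2 * (metric X u).det =
        ip (tangentVec X u a) (tangentVec X u a) * ip (tangentVec X u b) (tangentVec X u b)
        - ip (tangentVec X u a) (tangentVec X u b) ^ 2 := by
      simp only [metric_det, tangentVec, Fin.sum_univ_two, ip_add_left, ip_add_right, ip_smul_left,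
        ip_smul_right, ip_comm (pd 1 X u) (pd 0 X u)]
      ring
    rw [e, h1, h2, h3]; norm_num
  exact ⟨fun h0 => by rw [h0] at key; norm_num at key, key⟩

theorem metric_det_ne_of_frame
    (h : IsPseudoOrthonormal (tangentVec X u a) (tangentVec X u b)) : (metric X u).det ≠ 0 :=
  fun h0 => by have := (det_ne_of_frame h).2; rw [h0] at this; norm_num at this

theorem jac_adapted_det : (jac (adapted X u a b) 0).det = a 0 * b 1 - a 1 * b 0 := by
  unfold adapted
  rw [jac_quadMap_zero, Matrix.det_fin_two_of]; ring

/-- The quadratic terms of the change of coordinates subtract precisely the tangential parts of the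
second derivatives, leaving normal vectors. -/
theorem isNullNormalAt_adapted (hX : ContDiffAt ℝ ∞ X u)
    (h : IsPseudoOrthonormal (tangentVec X u a) (tangentVec X u b)) :
    IsNullNormalAt (X ∘ adapted X u a b) 0 := by
  have hg := metric_det_ne_of_frame h
  have hs : ContDiffAt ℝ ∞ (X ∘ adapted X u a b) 0 := by
    refine ContDiffAt.comp 0 ?_ contDiff_adapted.contDiffAt
    rwa [adapted_zero]
  obtain ⟨e0, e1⟩ := pd_comp_adapted (X := X) (a := a) (b := b) hX.dAt
  obtain ⟨e00, e01, e11⟩ := pd_pd_comp_adapted (a := a) (b := b) hX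
  have hn (w : E42) (c) : ip (nor X u w) (dir X u c) = 0 := by
    simp only [dir, Fin.sum_univ_two, ip_add_right, ip_smul_right, ip_nor_pd hg]; ring
  refine ⟨hs, ?_, ?_, ?_, ?_⟩
  · rw [e0]; exact h.1
  · rw [e1]; exact h.2.1
  · rw [e0, e1]; exact h.2.2
  · intro i j k
    have hij : ∃ w, pd i (pd j (X ∘ adapted X u a b)) 0 = nor X u w := by
      obtain rfl | rfl : i = 0 ∨ i = 1 := by fin_cases i <;> simp
      all_goals obtain rfl | rfl : j = 0 ∨ j = 1 := by fin_cases j <;> simp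
      exacts [⟨_, e00⟩, ⟨_, e01⟩, ⟨_, (pd_comm hs 1 0).trans e01⟩, ⟨_, e11⟩]
    obtain ⟨w, hw⟩ := hij
    rw [hw]
    obtain rfl | rfl : k = 0 ∨ k = 1 := by fin_cases k <;> simp
    · rw [e0, hn]
    · rw [e1, hn]

theorem lap_comp_adapted {f : Plane → V} (hX : ContDiffAt ℝ ∞ X u) (hf : ContDiffAt ℝ ∞ f u)
    (h : IsPseudoOrthonormal (tangentVec X u a) (tangentVec X u b)) :
    lap (X ∘ adapted X u a b) (f ∘ adapted X u a b) 0 = lap X f u := by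
  have hX' := hX
  have hf' := hf
  have hg := metric_det_ne_of_frame h
  rw [← adapted_zero (X := X) (u := u) (a := a) (b := b)] at hX' hf'
  rw [lap_comp hX' hf' contDiff_adapted.contDiffAt (by
    rw [jac_adapted_det]; exact (det_ne_of_frame h).1) (by rwa [adapted_zero]), adapted_zero]

theorem contDiffAt_jac_det {ψ : Plane → Plane} {w : Plane} (hψ : ContDiffAt ℝ ∞ ψ w) :
    ContDiffAt ℝ ∞ (fun v => (jac ψ v).det) w := by
  have h (i a : Fin 2) : ContDiffAt ℝ ∞ (fun v => pd i ψ v a) w :=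
    (EuclideanSpace.proj a : Plane →L[ℝ] ℝ).contDiff.contDiffAt.comp w (contDiffAt_pd i hψ)
  simp only [Matrix.det_fin_two, jac, Matrix.of_apply]
  exact ((h 0 0).mul (h 1 1)).sub ((h 1 0).mul (h 0 1))

theorem meanCurv_comp_adapted (hX : ∀ᶠ v in nhds u, ContDiffAt ℝ ∞ X v)
    (h : IsPseudoOrthonormal (tangentVec X u a) (tangentVec X u b)) :
    meanCurv (X ∘ adapted X u a b) =ᶠ[nhds 0] meanCurv X ∘ adapted X u a b := by
  have hψ : ContDiffAt ℝ ∞ (adapted X u a b) 0 := contDiff_adapted.contDiffAt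
  have hXu := hX.self_of_nhds
  have ht : Filter.Tendsto (adapted X u a b) (nhds 0) (nhds u) := by
    have := hψ.continuousAt.tendsto
    rwa [adapted_zero] at this
  have hdet : ∀ᶠ v in nhds u, (metric X v).det ≠ 0 :=
    (contDiffAt_metric_det hXu).continuousAt.eventually_ne (metric_det_ne_of_frame h)
  have hJ : ∀ᶠ w in nhds 0, (jac (adapted X u a b) w).det ≠ 0 :=
    (contDiffAt_jac_det hψ).continuousAt.eventually_ne
      (by rw [jac_adapted_det]; exact (det_ne_of_frame h).1)
  filter_upwards [ht.eventually hX, ht.eventually hdet, hJ] with w h1 h2 h3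
  exact meanCurv_comp h1 contDiff_adapted.contDiffAt h3 h2

theorem meanCurv_eq_of_frame (hX : ∀ᶠ v in nhds u, ContDiffAt ℝ ∞ X v)
    (h : IsPseudoOrthonormal (tangentVec X u a) (tangentVec X u b)) :
    nor X u (dir₂ X u a b) = -meanCurv X u := by
  have := (isNullNormalAt_adapted hX.self_of_nhds h).meanCurv_eq
  rw [(pd_pd_comp_adapted hX.self_of_nhds).2.1] at this
  have h2 := (meanCurv_comp_adapted hX h).self_of_nhds
  rw [Function.comp, adapted_zero] at h2
  rw [← h2, this, neg_neg]

theorem IsLocalGaussMap.comp {G : Plane → Bivec} {ψ : Plane → Plane} {w : Plane}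
    (hX : DifferentiableAt ℝ X (ψ w)) (hψ : DifferentiableAt ℝ ψ w) (hJ : (jac ψ w).det ≠ 0)
    (hG : IsLocalGaussMap X G (ψ w)) : IsLocalGaussMap (X ∘ ψ) (G ∘ ψ) w := by
  obtain ⟨c, d, hcd, hw⟩ := hG
  have e (c : Fin 2 → ℝ) : tangentVec (X ∘ ψ) w ((jac ψ w)⁻¹.mulVec c) = tangentVec X (ψ w) c := by
    rw [tangentVec_comp hX hψ, Matrix.mulVec_mulVec,
      Matrix.mul_nonsing_inv _ (isUnit_iff_ne_zero.2 hJ), Matrix.one_mulVec]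
  refine ⟨(jac ψ w)⁻¹.mulVec c, (jac ψ w)⁻¹.mulVec d, ?_, ?_⟩
  · rwa [e, e]
  · rw [e, e]; exact hw

section Gauss

variable {G : Plane → Bivec} (hX : ∀ᶠ v in nhds u, ContDiffAt ℝ ∞ X v)
  (hGs : ContDiffAt ℝ ∞ G u) (hG : ∀ᶠ v in nhds u, IsLocalGaussMap X G v)
  (h : IsPseudoOrthonormal (tangentVec X u a) (tangentVec X u b))
  (hGu : G u = wedge (tangentVec X u a) (tangentVec X u b))

include hX hGs hG h hGu

theorem gauss_comp_adapted : ContDiffAt ℝ ∞ (G ∘ adapted X u a b) 0 ∧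
    (∀ᶠ w in nhds 0, IsLocalGaussMap (X ∘ adapted X u a b) (G ∘ adapted X u a b) w) ∧
    (G ∘ adapted X u a b) 0 =
      wedge (pd 0 (X ∘ adapted X u a b) 0) (pd 1 (X ∘ adapted X u a b) 0) := by
  have hψ : ContDiffAt ℝ ∞ (adapted X u a b) 0 := contDiff_adapted.contDiffAt
  have ht : Filter.Tendsto (adapted X u a b) (nhds 0) (nhds u) := by
    have := hψ.continuousAt.tendsto
    rwa [adapted_zero] at this
  refine ⟨ContDiffAt.comp 0 (by rwa [adapted_zero]) hψ, ?_, ?_⟩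
  · have hJ : ∀ᶠ w in nhds 0, (jac (adapted X u a b) w).det ≠ 0 :=
      (contDiffAt_jac_det hψ).continuousAt.eventually_ne
        (by rw [jac_adapted_det]; exact (det_ne_of_frame h).1)
    filter_upwards [ht.eventually hX, ht.eventually hG, hJ] with w h1 hw h3
    have hd : DifferentiableAt ℝ (adapted X u a b) w := contDiff_adapted.contDiffAt.dAt
    exact IsLocalGaussMap.comp h1.dAt hd h3 hw
  · obtain ⟨e0, e1⟩ := pd_comp_adapted (X := X) (a := a) (b := b) hX.self_of_nhds.dAt
    rw [e0, e1, Function.comp, adapted_zero, hGu]; rfl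

/-- The derivatives of the Gauss map. -/
theorem dir_gauss :
    dir G u a = wedge (nor X u (dir₂ X u a a)) (tangentVec X u b)
      - wedge (tangentVec X u a) (meanCurv X u) ∧
    dir G u b = wedge (tangentVec X u a) (nor X u (dir₂ X u b b))
      - wedge (meanCurv X u) (tangentVec X u b) := by
  obtain ⟨g1, g2, g3⟩ := gauss_comp_adapted hX hGs hG h hGu
  have hN := isNullNormalAt_adapted hX.self_of_nhds h
  obtain ⟨e0, e1⟩ := pd_comp_adapted (X := X) (a := a) (b := b) hX.self_of_nhds.dAt
  obtain ⟨e00, e01, e11⟩ := pd_pd_comp_adapted (a := a) (b := b) hX.self_of_nhds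
  obtain ⟨d0, d1⟩ := pd_comp_adapted (X := X) (a := a) (b := b) hGs.dAt
  rw [← d0, ← d1, hN.pd_gauss g1 g2 g3, hN.pd_gauss g1 g2 g3, pd_comm hN.smooth 1 0, e00, e01,
    e11, e0, e1, meanCurv_eq_of_frame hX h]
  simp only [wedge_neg_left, wedge_neg_right, dir, tangentVec]
  constructor <;> module

/-- The Laplacian of the Gauss map. -/
theorem lap_gauss : ∃ θ : ℝ, lap X G u = (2 : ℝ) • (θ • G u
    + wedge (nor X u (dir₂ X u a a)) (nor X u (dir₂ X u b b))
    - wedge (dir (meanCurv X) u a) (tangentVec X u b)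
    - wedge (tangentVec X u a) (dir (meanCurv X) u b)) := by
  obtain ⟨g1, g2, g3⟩ := gauss_comp_adapted hX hGs hG h hGu
  have hN := isNullNormalAt_adapted hX.self_of_nhds h
  obtain ⟨e0, e1⟩ := pd_comp_adapted (X := X) (a := a) (b := b) hX.self_of_nhds.dAt
  obtain ⟨e00, e01, e11⟩ := pd_pd_comp_adapted (a := a) (b := b) hX.self_of_nhds
  obtain ⟨d0, d1⟩ := pd_comp_adapted (X := X) (a := a) (b := b)
    (contDiffAt_meanCurv hX.self_of_nhds (metric_det_ne_of_frame h)).dAt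
  obtain ⟨θ, hθ⟩ := hN.lap_gauss g1 g2 g3
  refine ⟨θ, ?_⟩
  rw [← lap_comp_adapted hX.self_of_nhds hGs h, hθ,
    pd_congr 0 (meanCurv_comp_adapted hX h), pd_congr 1 (meanCurv_comp_adapted hX h), d0, d1,
    e0, e1, e00, e11, Function.comp, adapted_zero]
  rfl

theorem bdot_gauss_lap (hH : ip (meanCurv X u) (meanCurv X u) = 0) :
    bdot (G u) (lap X G u) =
      -2 * ip (nor X u (dir₂ X u a a)) (nor X u (dir₂ X u b b)) := by
  obtain ⟨g1, g2, g3⟩ := gauss_comp_adapted hX hGs hG h hGu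
  have hN := isNullNormalAt_adapted hX.self_of_nhds h
  obtain ⟨e00, e01, e11⟩ := pd_pd_comp_adapted (a := a) (b := b) hX.self_of_nhds
  have h2 := (meanCurv_comp_adapted hX h).self_of_nhds
  rw [Function.comp, adapted_zero] at h2
  have := hN.bdot_gauss_lap g1 g2 g3 (by rw [h2, hH])
  rwa [lap_comp_adapted hX.self_of_nhds hGs h, e00, e11, Function.comp, adapted_zero] at this

end Gauss

end Adapted

/-! ### The Ricci equation -/

section Ricci

variable {X : Plane → E42} {u : Plane} {a b : Fin 2 → ℝ}

/-- In adapted coordinates the inverse metric is off-diagonal with entries -1; transporting it back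
with the Jacobian, whose columns are a and b, gives the formula. -/
theorem metric_inv_of_frame (hX : ContDiffAt ℝ ∞ X u)
    (h : IsPseudoOrthonormal (tangentVec X u a) (tangentVec X u b)) (k l : Fin 2) :
    (metric X u)⁻¹ k l = -(a k * b l + b k * a l) := by
  have hN := isNullNormalAt_adapted hX h
  have hX' := hX
  rw [← adapted_zero (X := X) (u := u) (a := a) (b := b)] at hX'
  have K := jac_mul_metric_comp_inv hX'.dAt contDiff_adapted.contDiffAt.dAt (by
    rw [jac_adapted_det]; exact (det_ne_of_frame h).1)
  rw [adapted_zero] at K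
  rw [← K]
  have hJ : jac (adapted X u a b) 0 = Matrix.of ![![a 0, b 0], ![a 1, b 1]] :=
    jac_quadMap_zero _ _ _ _ _ _
  rw [hJ]
  simp only [Matrix.mul_apply, Fin.sum_univ_two, hN.inv00, hN.inv01, hN.inv10, hN.inv11,
    Matrix.transpose_apply]
  fin_cases k <;> fin_cases l <;> simp

theorem ip_tanOp_normal {ν : E42} (hν : IsNormal X u ν) (w : E42) :
    ip (tanOp X X u w) ν = 0 := by
  have h (i) : ip (pd i X u) ν = 0 := by rw [ip_comm]; exact hν i
  simp only [tanOp, Fin.sum_univ_two, ip_add_left, ip_smul_left, h]; ring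

theorem ip_nor_normal {ν : E42} (hν : IsNormal X u ν) (w : E42) :
    ip (nor X u w) ν = ip w ν := by
  rw [nor_eq_tanOp, ip_sub_left, ip_tanOp_normal hν, sub_zero]

/-- The tangential components of `w` along a frame of normal vectors, paired with a normal vector
after differentiation. -/
theorem ip_pd_tanOp {m : E42} (hX : ContDiffAt ℝ ∞ X u) (hg : (metric X u).det ≠ 0)
    (hm : IsNormal X u m) {w : Plane → E42} (hw : ContDiffAt ℝ ∞ w u) (i : Fin 2) :
    ip (pd i (fun v => tanOp X X v (w v)) u) m =
      ∑ k, (∑ l, (metric X u)⁻¹ k l * ip (w u) (pd l X u)) * ip (pd i (pd k X) u) m := by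
  have hμ (k : Fin 2) : ContDiffAt ℝ ∞ (fun v => ∑ l, (metric X v)⁻¹ k l * ip (w v) (pd l X v)) u :=
    ContDiffAt.sum fun l _ => (contDiffAt_metric_inv hX hg k l).mul
      (contDiffAt_ip hw (contDiffAt_pd l hX))
  have e (k) := ((hμ k).hasPd i).smul ((contDiffAt_pd k hX).hasPd i)
  have h (i) : ip (pd i X u) m = 0 := by rw [ip_comm]; exact hm i
  have hsum : (fun v => tanOp X X v (w v)) = fun v =>
      (∑ l, (metric X v)⁻¹ 0 l * ip (w v) (pd l X v)) • pd 0 X v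
        + (∑ l, (metric X v)⁻¹ 1 l * ip (w v) (pd l X v)) • pd 1 X v :=
    funext fun v => Fin.sum_univ_two _
  rw [hsum, ((e 0).add (e 1)).2]
  simp only [Fin.sum_univ_two, ip_add_left, ip_smul_left, h]
  ring

/-- The normal extension of ν is ν minus its tangential part, which vanishes at `u`. In D₀D₁ - D₁D₀
the second derivatives of this part cancel by symmetry, and only products of second fundamental
forms survive. -/
theorem ip_normalR {ν m : E42} (hX : ∀ᶠ v in nhds u, ContDiffAt ℝ ∞ X v)
    (hg : (metric X u).det ≠ 0) (hν : IsNormal X u ν) (hm : IsNormal X u m) :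
    ip (normalR X u ν) m = ∑ k, ∑ l, (metric X u)⁻¹ k l *
      (ip ν (pd 1 (pd l X) u) * ip m (pd 0 (pd k X) u)
        - ip ν (pd 0 (pd l X) u) * ip m (pd 1 (pd k X) u)) := by
  have hXu := hX.self_of_nhds
  have hgv : ∀ᶠ v in nhds u, (metric X v).det ≠ 0 :=
    (contDiffAt_metric_det hXu).continuousAt.eventually_ne hg
  have hT : ContDiffAt ℝ ∞ (fun v => tanOp X X v ν) u :=
    contDiffAt_tanOp hXu hXu contDiffAt_const hg
  have hD (i : Fin 2) : normalD X i (fun v => nor X v ν) =ᶠ[nhds u]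
      fun v => tanOp X X v (pd i (fun v => tanOp X X v ν) v) - pd i (fun v => tanOp X X v ν) v := by
    filter_upwards [hX, hgv] with v h1 h2
    have hTv : ContDiffAt ℝ ∞ (fun v => tanOp X X v ν) v :=
      contDiffAt_tanOp h1 h1 contDiffAt_const h2
    have e : HasPd i (fun v => nor X v ν) (0 - pd i (fun v => tanOp X X v ν) v) v := by
      simp only [nor_eq_tanOp]; exact (hasPd_const ν).sub (hTv.hasPd i)
    rw [normalD, e.2, zero_sub, nor_eq_tanOp, ← neg_one_smul ℝ, tanOp_smul]
    module
  have hw (i l : Fin 2) : ip (pd i (fun v => tanOp X X v ν) u) (pd l X u)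
      = ip ν (pd i (pd l X) u) := by
    have hev : (fun v => ip (tanOp X X v ν) (pd l X v)) =ᶠ[nhds u] fun v => ip ν (pd l X v) := by
      filter_upwards [hgv] with v hv using ip_tanOp_pd hv ν l
    have hpl := (contDiffAt_pd l hXu).hasPd i
    have := ((hT.hasPd i).ip hpl).unique (((hasPd_const ν).ip hpl).congr hev)
    rwa [tanOp_of_normal X hν, ip_zero_left, ip_zero_left, zero_add, add_zero] at this
  have key (i j : Fin 2) : ip (normalD X i (normalD X j fun v => nor X v ν) u) m =
      ∑ k, (∑ l, (metric X u)⁻¹ k l * ip ν (pd j (pd l X) u)) * ip (pd i (pd k X) u) m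
        - ip (pd i (pd j fun v => tanOp X X v ν) u) m := by
    have hTj := contDiffAt_pd j hT
    have e := ((((contDiffAt_tanOp hXu hXu hTj hg).hasPd i).sub (hTj.hasPd i)).congr (hD j)).2
    rw [normalD, ip_nor_normal hm, e, ip_sub_left, ip_pd_tanOp hXu hg hm hTj]
    simp only [hw]
  rw [normalR, ip_sub_left, key, key, pd_comm hT 1 0]
  simp only [Fin.sum_univ_two, ip_comm m]
  ring

/-- The Ricci equation. -/
theorem normalCurv_eq {ν m : E42} (hX : ∀ᶠ v in nhds u, ContDiffAt ℝ ∞ X v)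
    (h : IsPseudoOrthonormal (tangentVec X u a) (tangentVec X u b))
    (hν : IsNormal X u ν) (hm : IsNormal X u m) :
    normalCurv X u a b ν m = -(ip ν (dir₂ X u a a) * ip m (dir₂ X u b b)
      - ip ν (dir₂ X u b b) * ip m (dir₂ X u a a)) := by
  rw [normalCurv, ip_normalR hX (metric_det_ne_of_frame h) hν hm]
  simp only [Fin.sum_univ_two, metric_inv_of_frame hX.self_of_nhds h, dir₂, ip_add_right,
    ip_smul_right, pd_comm hX.self_of_nhds 1 0]
  ring

theorem isNormal_meanCurv (h : (metric X u).det ≠ 0) : IsNormal X u (meanCurv X u) :=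
  ip_meanCurv_pd h

theorem IsNormal.ip_tangentVec {ν : E42} (hν : IsNormal X u ν) (a : Fin 2 → ℝ) :
    ip (tangentVec X u a) ν = 0 := by
  rw [ip_comm]
  simp only [tangentVec, Fin.sum_univ_two, ip_add_right, ip_smul_right, hν 0, hν 1]; ring

theorem isTetrad_of_frames {n₁ n₂ : E42}
    (h : IsPseudoOrthonormal (tangentVec X u a) (tangentVec X u b))
    (h₁ : IsNormal X u n₁) (h₂ : IsNormal X u n₂) (hn : IsPseudoOrthonormal n₁ n₂) :
    IsTetrad (tangentVec X u a) (tangentVec X u b) n₁ n₂ :=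
  ⟨h.1, h.2.1, h.2.2, hn.1, hn.2.1, hn.2.2, h₁.ip_tangentVec a, h₂.ip_tangentVec a,
    h₁.ip_tangentVec b, h₂.ip_tangentVec b⟩

/-- An oriented null frame whose first normal vector is the mean curvature vector. -/
theorem exists_adapted_tetrad {G : Plane → Bivec} (hX : ∀ᶠ v in nhds u, ContDiffAt ℝ ∞ X v)
    (hq : IsQuasiMinimalAt X u) (hc : NormalCurvNeZeroAt X u) (hG : IsLocalGaussMap X G u) :
    ∃ (a b : Fin 2 → ℝ) (n₂ : E42),
      IsPseudoOrthonormal (tangentVec X u a) (tangentVec X u b) ∧ IsNormal X u n₂ ∧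
      IsTetrad (tangentVec X u a) (tangentVec X u b) (meanCurv X u) n₂ ∧
      G u = wedge (tangentVec X u a) (tangentVec X u b) ∧
      ip (meanCurv X u) (dir₂ X u a a) * ip n₂ (dir₂ X u b b)
        - ip (meanCurv X u) (dir₂ X u b b) * ip n₂ (dir₂ X u a a) ≠ 0 := by
  obtain ⟨a, b, n₁, n₂, hab, hn₁, hn₂, hn, hcurv⟩ := hc
  obtain ⟨hL, hH0, hHH⟩ := hq
  have hg : (metric X u).det ≠ 0 := hL.ne
  have hHn := isNormal_meanCurv hg
  rw [normalCurv_eq hX hab hn₁ hn₂, neg_ne_zero] at hcurv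
  obtain ⟨m, hm, hHm, hcm⟩ : ∃ m, IsNormal X u m ∧ IsPseudoOrthonormal (meanCurv X u) m ∧
      ip (meanCurv X u) (dir₂ X u a a) * ip m (dir₂ X u b b)
        - ip (meanCurv X u) (dir₂ X u b b) * ip m (dir₂ X u a a) ≠ 0 := by
    have hexp := (isTetrad_of_frames hab hn₁ hn₂ hn).expand (meanCurv X u)
    rw [ip_comm _ (tangentVec X u a), ip_comm _ (tangentVec X u b), hHn.ip_tangentVec,
      hHn.ip_tangentVec] at hexp
    generalize ip (meanCurv X u) n₂ = p at hexp
    generalize ip (meanCurv X u) n₁ = q at hexp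
    replace hexp : meanCurv X u = (-p) • n₁ - q • n₂ := by rw [hexp]; module
    obtain ⟨c1, c2, c3⟩ := hn
    have c3' : ip n₂ n₁ = -1 := by rw [ip_comm, c3]
    rw [hexp] at hHH hH0 ⊢
    simp only [ip_sub_left, ip_sub_right, ip_smul_left, ip_smul_right, c1, c2, c3, c3'] at hHH
    -- A null vector of the normal plane is a multiple of n₁ or of n₂. The frame vector on the other
    -- null line is then rescaled to pair to -1 with H; in the first case this reverses the sign of
    -- the curvature expression.
    have hpq : p = 0 ∨ q = 0 := by
      rw [← mul_eq_zero]; linarith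
    rcases hpq with rfl | rfl
    · have hq : q ≠ 0 := by rintro rfl; simp at hH0
      refine ⟨(-q⁻¹) • n₁, fun i => by rw [ip_smul_left, hn₁ i, mul_zero], ⟨?_, ?_, ?_⟩, ?_⟩ <;>
        simp only [ip_sub_left, ip_sub_right, ip_smul_left, ip_smul_right, c1, c2, c3']
      · ring
      · ring
      · field_simp; ring
      · convert neg_ne_zero.2 hcurv using 1
        field_simp; ring
    · have hp : p ≠ 0 := by rintro rfl; simp at hH0
      refine ⟨(-p⁻¹) • n₂, fun i => by rw [ip_smul_left, hn₂ i, mul_zero], ⟨?_, ?_, ?_⟩, ?_⟩ <;>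
        simp only [ip_sub_left, ip_sub_right, ip_smul_left, ip_smul_right, c1, c2, c3]
      · ring
      · ring
      · field_simp; ring
      · convert hcurv using 1
        field_simp; ring
  obtain ⟨c, hGc⟩ := hG.exists_eq_smul
  have hw : wedge (tangentVec X u a) (tangentVec X u b) =
      (a 0 * b 1 - a 1 * b 0) • wedge (pd 0 X u) (pd 1 X u) := by
    simp only [tangentVec, Fin.sum_univ_two, wedge_add_left, wedge_add_right, wedge_smul_left,
      wedge_smul_right, wedge_self, wedge_comm (pd 1 X u) (pd 0 X u)]
    module
  have hc2 : c ^ 2 * (metric X u).det = -1 := by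
    have := hG.bdot_self
    rw [hGc, bdot_smul_left, bdot_smul_right, bdot_wedge_wedge,
      ip_comm (pd 1 X u) (pd 0 X u)] at this
    rw [metric_det, ← this]; ring
  have hsq : c ^ 2 = (a 0 * b 1 - a 1 * b 0) ^ 2 :=
    mul_right_cancel₀ hg (hc2.trans (det_ne_of_frame hab).2.symm)
  -- Both bivectors have square -1 on the same line, so they agree up to sign; the wrong sign is
  -- repaired by exchanging x and y.
  rcases sq_eq_sq_iff_eq_or_eq_neg.1 hsq with hc' | hc'
  · exact ⟨a, b, m, hab, hm, isTetrad_of_frames hab hHn hm hHm, by rw [hGc, hw, hc'], hcm⟩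
  · have hba : IsPseudoOrthonormal (tangentVec X u b) (tangentVec X u a) :=
      ⟨hab.2.1, hab.1, by rw [ip_comm, hab.2.2]⟩
    refine ⟨b, a, m, hba, hm, isTetrad_of_frames hba hHn hm hHm, ?_, ?_⟩
    · rw [wedge_comm, hGc, hw, hc', neg_smul]
    · rw [← neg_ne_zero, neg_sub]; exact hcm

end Ricci

/-! ### Surfaces with pointwise 1-type Gauss map -/

section OneType

/-- The contraction as a continuous bilinear map. -/
noncomputable def actB : Bivec →L[ℝ] E42 →L[ℝ] E42 :=
  (LinearMap.mk₂ ℝ act add_act smul_act act_add (fun c C v => act_smul C c v)).toContinuousBilinearMap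

@[simp] theorem actB_apply (C : Bivec) (v : E42) : actB C v = act C v := rfl

/-- The equation `ΔG = φ (G + C)` on an open set, for a quasi-minimal surface with non-vanishing
normal curvature. -/
structure OneTypeOn (X : Plane → E42) (G : Plane → Bivec) (φ : Plane → ℝ) (C : Bivec)
    (U : Set Plane) : Prop where
  isOpen : IsOpen U
  smooth_X : ∀ v ∈ U, ContDiffAt ℝ ∞ X v
  smooth_G : ∀ v ∈ U, ContDiffAt ℝ ∞ G v
  quasiMinimal : ∀ v ∈ U, IsQuasiMinimalAt X v
  curv : ∀ v ∈ U, NormalCurvNeZeroAt X v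
  gauss : ∀ v ∈ U, IsLocalGaussMap X G v
  phi_ne : ∀ v ∈ U, φ v ≠ 0
  antisymm : ∀ i j, C i j = -C j i
  lap_eq : ∀ v ∈ U, lap X G v = φ v • (G v + C)

theorem act_neg_neg (G : Bivec) (w : E42) : act (-G) (act (-G) w) = act G (act G w) := by
  simp only [neg_act, act_neg, neg_neg]

theorem IsLocalGaussMap.neg {X : Plane → E42} {G : Plane → Bivec} {u : Plane}
    (h : IsLocalGaussMap X G u) : IsLocalGaussMap X (fun v => -G v) u := by
  obtain ⟨a, b, ⟨h1, h2, h3⟩, hG⟩ := h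
  exact ⟨b, a, ⟨h2, h1, by rw [ip_comm, h3]⟩, by
    change -G u = _
    rw [hG, wedge_comm (tangentVec X u b)]⟩

theorem OneTypeOn.neg {X : Plane → E42} {G : Plane → Bivec} {φ : Plane → ℝ} {C : Bivec}
    {U : Set Plane} (h : OneTypeOn X G φ C U) : OneTypeOn X (fun v => -G v) φ (-C) U where
  isOpen := h.isOpen
  smooth_X := h.smooth_X
  smooth_G v hv := (h.smooth_G v hv).neg
  quasiMinimal := h.quasiMinimal
  curv := h.curv
  gauss v hv := (h.gauss v hv).neg
  phi_ne := h.phi_ne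
  antisymm i j := by rw [Pi.neg_apply, Pi.neg_apply, Pi.neg_apply, Pi.neg_apply, h.antisymm i j]
  lap_eq v hv := by
    have := lap_smul_const (X := X) (f := G) (u := v) (-1)
    simp only [neg_one_smul] at this
    rw [this, h.lap_eq v hv]; module

/-- The tangential part of the derivative of the mean curvature vector lies in the eigenspace of the
Gauss map with eigenvalue `1`. -/
def IsPositiveAt (X : Plane → E42) (G : Plane → Bivec) (v : Plane) : Prop :=
  ∀ i, act (G v) (pd i (meanCurv X) v) = act (G v) (act (G v) (pd i (meanCurv X) v))

/-- A null frame at `v` adapted to the Gauss map, together with the consequences of smoothness. -/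
structure IsAdaptedFrame (X : Plane → E42) (G : Plane → Bivec) (v : Plane) (a b : Fin 2 → ℝ)
    (n₂ : E42) : Prop where
  frame : IsPseudoOrthonormal (tangentVec X v a) (tangentVec X v b)
  normal : IsNormal X v n₂
  tetrad : IsTetrad (tangentVec X v a) (tangentVec X v b) (meanCurv X v) n₂
  gauss : G v = wedge (tangentVec X v a) (tangentVec X v b)
  curv : ip (meanCurv X v) (dir₂ X v a a) * ip n₂ (dir₂ X v b b)
        - ip (meanCurv X v) (dir₂ X v b b) * ip n₂ (dir₂ X v a a) ≠ 0
  dH_a : dir (meanCurv X) v a = ip (meanCurv X v) (dir₂ X v a a) • tangentVec X v b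
    - ip (dir (meanCurv X) v a) n₂ • meanCurv X v
  dH_b : dir (meanCurv X) v b = ip (meanCurv X v) (dir₂ X v b b) • tangentVec X v a
    - ip (dir (meanCurv X) v b) n₂ • meanCurv X v

theorem exists_frame_comb {X : Plane → E42} {v : Plane} {a b : Fin 2 → ℝ}
    (h : IsPseudoOrthonormal (tangentVec X v a) (tangentVec X v b)) (c : Fin 2 → ℝ) :
    ∃ p q : ℝ, c = p • a + q • b := by
  have hd := (det_ne_of_frame h).1
  have hi := mul_inv_cancel₀ hd
  refine ⟨(c 0 * b 1 - c 1 * b 0) * (a 0 * b 1 - a 1 * b 0)⁻¹,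
    (a 0 * c 1 - a 1 * c 0) * (a 0 * b 1 - a 1 * b 0)⁻¹, ?_⟩
  ext i
  fin_cases i <;> simp
  · linear_combination (-c 0) * hi
  · linear_combination (-c 1) * hi

theorem dir_comb {V : Type*} [NormedAddCommGroup V] [NormedSpace ℝ V] (f : Plane → V) (v : Plane)
    (a b : Fin 2 → ℝ) (p q : ℝ) : dir f v (p • a + q • b) = p • dir f v a + q • dir f v b := by
  simp only [dir, Fin.sum_univ_two, Pi.add_apply, Pi.smul_apply, smul_eq_mul]; module

theorem dir_single {V : Type*} [NormedAddCommGroup V] [NormedSpace ℝ V] (f : Plane → V)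
    (v : Plane) (i : Fin 2) : dir f v (Pi.single i 1) = pd i f v := by
  fin_cases i <;> simp [dir]

theorem nor_dir₂ {X : Plane → E42} {v : Plane} {a b : Fin 2 → ℝ} {n m : E42}
    (h : IsTetrad (tangentVec X v a) (tangentVec X v b) n m)
    (hn : IsNormal X v n) (hm : IsNormal X v m) (hg : (metric X v).det ≠ 0) (w : E42) :
    nor X v w = -ip m w • n - ip n w • m := by
  have hN : IsNormal X v (nor X v w) := ip_nor_pd hg w
  rw [h.expand (nor X v w), ip_comm _ (tangentVec X v a), ip_comm _ (tangentVec X v b),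
    hN.ip_tangentVec, hN.ip_tangentVec, ip_nor_normal hn, ip_nor_normal hm, ip_comm w, ip_comm w]
  module

namespace OneTypeOn

variable {X : Plane → E42} {G : Plane → Bivec} {φ : Plane → ℝ} {C : Bivec} {U : Set Plane}
  (h : OneTypeOn X G φ C U) {v : Plane} (hv : v ∈ U)

include h hv

theorem eventually_mem : ∀ᶠ w in nhds v, w ∈ U := h.isOpen.mem_nhds hv

theorem eventually_smooth : ∀ᶠ w in nhds v, ContDiffAt ℝ ∞ X w :=
  (h.eventually_mem hv).mono h.smooth_X

theorem det_ne : (metric X v).det ≠ 0 := (h.quasiMinimal v hv).1.ne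

theorem smooth_H : ContDiffAt ℝ ∞ (meanCurv X) v :=
  contDiffAt_meanCurv (h.smooth_X v hv) (h.det_ne hv)

theorem ip_pd_H (i j : Fin 2) :
    ip (pd j (meanCurv X) v) (pd i X v) = -ip (meanCurv X v) (pd j (pd i X) v) := by
  have hev : (fun w => ip (meanCurv X w) (pd i X w)) =ᶠ[nhds v] fun _ => 0 := by
    filter_upwards [h.eventually_mem hv] with w hw using ip_meanCurv_pd (h.det_ne hw) i
  have := (((h.smooth_H hv).hasPd j).ip
    ((contDiffAt_pd i (h.smooth_X v hv)).hasPd j)).unique ((hasPd_const 0).congr hev)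
  linarith

theorem ip_dir_H (a b : Fin 2 → ℝ) :
    ip (dir (meanCurv X) v a) (tangentVec X v b) = -ip (meanCurv X v) (dir₂ X v a b) := by
  simp only [dir, tangentVec, dir₂, Fin.sum_univ_two, ip_add_left, ip_add_right, ip_smul_left,
    ip_smul_right, h.ip_pd_H hv]
  ring

theorem ip_dir_H_H (a : Fin 2 → ℝ) : ip (dir (meanCurv X) v a) (meanCurv X v) = 0 := by
  have (i : Fin 2) : ip (pd i (meanCurv X) v) (meanCurv X v) = 0 := by
    have hev : (fun w => ip (meanCurv X w) (meanCurv X w)) =ᶠ[nhds v] fun _ => 0 := by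
      filter_upwards [h.eventually_mem hv] with w hw using (h.quasiMinimal w hw).2.2
    have hH := (h.smooth_H hv).hasPd i
    have := (hH.ip hH).unique ((hasPd_const 0).congr hev)
    rw [ip_comm (meanCurv X v)] at this
    linarith
  simp only [dir, Fin.sum_univ_two, ip_add_left, ip_smul_left, this]; ring

theorem exists_adaptedFrame : ∃ a b n₂, IsAdaptedFrame X G v a b n₂ := by
  have hX := h.eventually_smooth hv
  obtain ⟨a, b, n₂, hab, hn, ht, hG, hc⟩ := exists_adapted_tetrad hX (h.quasiMinimal v hv)
    (h.curv v hv) (h.gauss v hv)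
  have hHn := isNormal_meanCurv (h.det_ne hv)
  have hHab : ip (meanCurv X v) (dir₂ X v a b) = 0 := by
    rw [ip_comm, ← ip_nor_normal hHn, meanCurv_eq_of_frame hX hab, ip_neg_left, ht.pp, neg_zero]
  refine ⟨a, b, n₂, hab, hn, ht, hG, hc, ?_, ?_⟩
  · conv_lhs => rw [ht.expand (dir (meanCurv X) v a)]
    rw [h.ip_dir_H hv, h.ip_dir_H hv, h.ip_dir_H_H hv, hHab]
    module
  · conv_lhs => rw [ht.expand (dir (meanCurv X) v b)]
    rw [h.ip_dir_H hv, h.ip_dir_H hv, h.ip_dir_H_H hv, dir₂_comm (h.smooth_X v hv) b a, hHab]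
    module

variable {a b : Fin 2 → ℝ} {n₂ : E42} (hf : IsAdaptedFrame X G v a b n₂)

include hf

/-- The components of the equation `ΔG = φ (G + C)`. -/
theorem ev_components :
    ev C (tangentVec X v a) (meanCurv X v) = 0 ∧
    ev C (tangentVec X v b) (meanCurv X v) = 0 ∧
    φ v * ev C n₂ (meanCurv X v) = -2 *
      (ip (meanCurv X v) (dir₂ X v a a) * ip n₂ (dir₂ X v b b)
        - ip (meanCurv X v) (dir₂ X v b b) * ip n₂ (dir₂ X v a a)) ∧
    φ v * (ev C (tangentVec X v a) (tangentVec X v b) - 1) = 2 *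
      (ip (meanCurv X v) (dir₂ X v a a) * ip n₂ (dir₂ X v b b)
        + ip (meanCurv X v) (dir₂ X v b b) * ip n₂ (dir₂ X v a a)) ∧
    φ v * ev C (tangentVec X v b) n₂ = 2 * ip (dir (meanCurv X) v b) n₂ ∧
    φ v * ev C (tangentVec X v a) n₂ = -2 * ip (dir (meanCurv X) v a) n₂ := by
  have hX := h.eventually_smooth hv
  have hg := (h.eventually_mem hv).mono h.gauss
  have hHn := isNormal_meanCurv (h.det_ne hv)
  obtain ⟨θ, hθ⟩ := lap_gauss hX (h.smooth_G v hv) hg hf.frame hf.gauss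
  -- The component along G cannot be read from `hθ`, where θ is unknown; this second identity
  -- supplies it.
  have hb := bdot_gauss_lap hX (h.smooth_G v hv) hg hf.frame hf.gauss hf.tetrad.pp
  rw [h.lap_eq v hv] at hθ hb
  have hnor := nor_dir₂ hf.tetrad hHn hf.normal (h.det_ne hv)
  have hφ := h.phi_ne v hv
  have t := hf.tetrad
  have dA := hf.dH_a
  have dB := hf.dH_b
  rw [hnor, hnor] at hθ hb
  rw [bdot_smul_right, bdot_add_right, (h.gauss v hv).bdot_self, hf.gauss, bdot_comm,
    bdot_wedge h.antisymm] at hb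
  generalize ip (dir (meanCurv X) v a) n₂ = α at *
  generalize ip (dir (meanCurv X) v b) n₂ = β at *
  rw [dA, dB, hf.gauss] at hθ
  generalize ip (meanCurv X v) (dir₂ X v a a) = A at *
  generalize ip (meanCurv X v) (dir₂ X v b b) = B at *
  generalize ip n₂ (dir₂ X v a a) = m at *
  generalize ip n₂ (dir₂ X v b b) = k at *
  generalize tangentVec X v a = x at *
  generalize tangentVec X v b = y at *
  generalize meanCurv X v = n at *
  obtain ⟨xx, yy, xy, pp, qq, pq, xp, xq, yp, yq⟩ := t
  have yx : ip y x = -1 := by rw [ip_comm, xy]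
  have px : ip n x = 0 := by rw [ip_comm, xp]
  have qx : ip n₂ x = 0 := by rw [ip_comm, xq]
  have py : ip n y = 0 := by rw [ip_comm, yp]
  have qy : ip n₂ y = 0 := by rw [ip_comm, yq]
  have qp : ip n₂ n = -1 := by rw [ip_comm, pq]
  have E (s t) := congrArg (fun D => ev D s t) hθ
  simp only [smul_ev, add_ev, sub_ev, ev_wedge, ip_sub_left, ip_smul_left] at E
  have E1 := E x n
  have E2 := E y n
  have E3 := E n₂ n
  have E4 := E y n₂
  have E5 := E x n₂
  simp only [xx, yy, xy, pp, qq, pq, xp, xq, yp, yq, yx, px, qx, py, qy, qp, ip_sub_left,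
    ip_sub_right, ip_smul_left, ip_smul_right] at E1 E2 E3 E4 E5 hb
  refine ⟨?_, ?_, ?_, ?_, ?_, ?_⟩
  · apply mul_left_cancel₀ hφ; linarith
  · apply mul_left_cancel₀ hφ; linarith
  · linarith
  · linarith
  · linarith
  · linarith

/-- Exactly one of `⟨h(x,x), H⟩` and `⟨h(y,y), H⟩` vanishes. -/
theorem dichotomy :
    (ip (meanCurv X v) (dir₂ X v a a) ≠ 0 ∧ ip (meanCurv X v) (dir₂ X v b b) = 0 ∧
      ev C (tangentVec X v a) (tangentVec X v b) = ev C n₂ (meanCurv X v)) ∨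
    (ip (meanCurv X v) (dir₂ X v a a) = 0 ∧ ip (meanCurv X v) (dir₂ X v b b) ≠ 0) := by
  obtain ⟨e1, e2, e3, -⟩ := h.ev_components hv hf
  have hHn := isNormal_meanCurv (h.det_ne hv)
  have hq : ev C n₂ (meanCurv X v) ≠ 0 := by
    intro h0
    rw [h0, mul_zero] at e3
    exact hf.curv (by linarith)
  -- Expressed with ∂ᵢX in place of the pointwise frame, the vanishing of C(x,H) and C(y,H) becomes
  -- an identity of smooth functions on U and may be differentiated.
  have htan (w) (hw : w ∈ U) (i : Fin 2) : ev C (pd i X w) (meanCurv X w) = 0 := by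
    obtain ⟨a, b, n, hf⟩ := h.exists_adaptedFrame hw
    obtain ⟨e1, e2, -⟩ := h.ev_components hw hf
    obtain ⟨p, q, hpq⟩ := exists_frame_comb hf.frame (Pi.single i 1)
    rw [← dir_single, hpq, dir_comb, ev_add_left, ev_smul_left, ev_smul_left]
    have e1' : ev C (dir X w a) (meanCurv X w) = 0 := e1
    have e2' : ev C (dir X w b) (meanCurv X w) = 0 := e2
    rw [e1', e2']; ring
  have hder (i j : Fin 2) : ev C (pd j (pd i X) v) (meanCurv X v)
      + ev C (pd i X v) (pd j (meanCurv X) v) = 0 := by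
    have hev : (fun w => ip (pd i X w) (act C (meanCurv X w))) =ᶠ[nhds v] fun _ => 0 := by
      filter_upwards [h.eventually_mem hv] with w hw using htan w hw i
    exact (((contDiffAt_pd i (h.smooth_X v hv)).hasPd j).ip
      (((h.smooth_H hv).hasPd j).clm (actL C))).unique ((hasPd_const 0).congr hev)
  have hder' (c : Fin 2 → ℝ) : ev C (dir₂ X v c c) (meanCurv X v)
      + ev C (tangentVec X v c) (dir (meanCurv X) v c) = 0 := by
    simp only [dir₂, tangentVec, dir, Fin.sum_univ_two, ev_add_left, ev_add_right, ev_smul_left,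
      ev_smul_right]
    linear_combination c 0 * c 0 * hder 0 0 + c 0 * c 1 * hder 1 0 + c 1 * c 0 * hder 0 1
      + c 1 * c 1 * hder 1 1
  have hdir (c : Fin 2 → ℝ) : ev C (dir₂ X v c c) (meanCurv X v) =
      -ip (meanCurv X v) (dir₂ X v c c) * ev C n₂ (meanCurv X v) := by
    have hd : dir₂ X v c c = nor X v (dir₂ X v c c) + tanOp X X v (dir₂ X v c c) := by
      rw [nor_eq_tanOp]; abel
    have htn : ev C (tanOp X X v (dir₂ X v c c)) (meanCurv X v) = 0 := by
      simp only [tanOp, Fin.sum_univ_two, ev_add_left, ev_smul_left, htan v hv]; ring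
    conv_lhs => rw [hd, ev_add_left, htn, nor_dir₂ hf.tetrad hHn hf.normal (h.det_ne hv)]
    rw [ev_sub_left, ev_smul_left, ev_smul_left, ev_self h.antisymm]; ring
  -- With P = C(x,y) and q = C(n₂,H), these two relations become A(P - q) = 0 and B(P + q) = 0.
  -- Since q ≠ 0, A and B cannot both be nonzero, while nonzero curvature forbids that both vanish.
  have ha := hder' a
  have hb := hder' b
  rw [hdir, hf.dH_a, ev_sub_right, ev_smul_right, ev_smul_right, e1] at ha
  rw [hdir, hf.dH_b, ev_sub_right, ev_smul_right, ev_smul_right, e2,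
    ev_antisymm h.antisymm (tangentVec X v b)] at hb
  have hcurv := hf.curv
  generalize ip (meanCurv X v) (dir₂ X v a a) = A at *
  generalize ip (meanCurv X v) (dir₂ X v b b) = B at *
  by_cases hA : A = 0
  · refine Or.inr ⟨hA, fun hB => hcurv ?_⟩
    rw [hA, hB]; ring
  · have hxy : ev C (tangentVec X v a) (tangentVec X v b) = ev C n₂ (meanCurv X v) := by
      apply mul_left_cancel₀ hA; linarith
    refine Or.inl ⟨hA, ?_, hxy⟩
    rw [hxy] at hb
    have : B * ev C n₂ (meanCurv X v) = 0 := by linarith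
    exact (mul_eq_zero.1 this).resolve_right hq

omit h hv in
-- As an endomorphism G is -1 on x, 1 on y and 0 on normal vectors. Hence G(∂H) = G²(∂H) in all
-- directions exactly when B = 0, which expresses the choice between A and B without choosing a
-- frame.
theorem act_gauss_dir :
    act (G v) (dir (meanCurv X) v a) =
      ip (meanCurv X v) (dir₂ X v a a) • tangentVec X v b ∧
    act (G v) (dir (meanCurv X) v b) =
      -(ip (meanCurv X v) (dir₂ X v b b) • tangentVec X v a) ∧
    act (G v) (act (G v) (dir (meanCurv X) v a)) =
      ip (meanCurv X v) (dir₂ X v a a) • tangentVec X v b ∧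
    act (G v) (act (G v) (dir (meanCurv X) v b)) =
      ip (meanCurv X v) (dir₂ X v b b) • tangentVec X v a := by
  have hx : act (G v) (tangentVec X v a) = -tangentVec X v a := by
    rw [hf.gauss, act_wedge, ip_comm (tangentVec X v b), hf.tetrad.xy, hf.tetrad.xx]; module
  have hy : act (G v) (tangentVec X v b) = tangentVec X v b := by
    rw [hf.gauss, act_wedge, hf.tetrad.xy, hf.tetrad.yy]; module
  have hn : act (G v) (meanCurv X v) = 0 := by
    rw [hf.gauss, act_wedge, hf.tetrad.xp, hf.tetrad.yp]; module
  have h1 : act (G v) (dir (meanCurv X) v a) =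
      ip (meanCurv X v) (dir₂ X v a a) • tangentVec X v b := by
    rw [hf.dH_a, act_sub, act_smul, act_smul, hy, hn]; module
  have h2 : act (G v) (dir (meanCurv X) v b) =
      -(ip (meanCurv X v) (dir₂ X v b b) • tangentVec X v a) := by
    rw [hf.dH_b, act_sub, act_smul, act_smul, hx, hn]; module
  refine ⟨h1, h2, ?_, ?_⟩
  · rw [h1, act_smul, hy]
  · rw [h2, act_neg, act_smul, hx]; module

omit h hv in
theorem exists_act_gauss_ne (hA : ip (meanCurv X v) (dir₂ X v a a) ≠ 0) :
    ∃ i, act (G v) (pd i (meanCurv X) v) + act (G v) (act (G v) (pd i (meanCurv X) v)) ≠ 0 := by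
  obtain ⟨h1, -, h3, -⟩ := act_gauss_dir hf
  by_contra! hc
  have h' (i) := eq_neg_of_add_eq_zero_right (hc i)
  have : act (G v) (act (G v) (dir (meanCurv X) v a)) = -act (G v) (dir (meanCurv X) v a) := by
    simp only [dir, Fin.sum_univ_two, act_add, act_smul, h']
    module
  rw [h3, h1] at this
  have e := congrArg (fun w => ip w (tangentVec X v a)) this
  simp only [ip_neg_left, ip_smul_left, ip_comm (tangentVec X v b), hf.tetrad.xy] at e
  exact hA (by linarith)

omit h hv in
theorem isPositiveAt_iff :
    IsPositiveAt X G v ↔ ip (meanCurv X v) (dir₂ X v b b) = 0 := by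
  obtain ⟨h1, h2, h3, h4⟩ := act_gauss_dir hf
  constructor
  · intro hp
    have : act (G v) (dir (meanCurv X) v b) = act (G v) (act (G v) (dir (meanCurv X) v b)) := by
      simp only [dir, Fin.sum_univ_two, act_add, act_smul, ← hp _]
    rw [h4, h2] at this
    have e := congrArg (fun w => ip w (tangentVec X v b)) this
    simp only [ip_neg_left, ip_smul_left, hf.tetrad.xy] at e
    linarith
  · intro hB i
    obtain ⟨p, q, hpq⟩ := exists_frame_comb hf.frame (Pi.single i 1)
    rw [← dir_single, hpq, dir_comb]
    simp only [act_add, act_smul, h3, h4]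
    simp only [h1, h2, hB]
    module

omit hf in
-- Apart from naming the case, each alternative records whether G(∂H) + G²(∂H) vanishes.
-- Nonvanishing is an open condition, so the case cannot change nearby.
theorem isPositiveAt_or_neg :
    (IsPositiveAt X G v ∧ ∃ i, act (G v) (pd i (meanCurv X) v)
      + act (G v) (act (G v) (pd i (meanCurv X) v)) ≠ 0) ∨
    (IsPositiveAt X (fun w => -G w) v ∧ ∀ i, act (G v) (pd i (meanCurv X) v)
      + act (G v) (act (G v) (pd i (meanCurv X) v)) = 0) := by
  obtain ⟨a, b, n, hf⟩ := h.exists_adaptedFrame hv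
  obtain ⟨h1, h2, h3, h4⟩ := act_gauss_dir hf
  rcases h.dichotomy hv hf with ⟨hA, hB, -⟩ | ⟨hA, hB⟩
  · exact Or.inl ⟨(isPositiveAt_iff hf).2 hB, exists_act_gauss_ne hf hA⟩
  · have key (i) : act (G v) (pd i (meanCurv X) v)
        + act (G v) (act (G v) (pd i (meanCurv X) v)) = 0 := by
      obtain ⟨p, q, hpq⟩ := exists_frame_comb hf.frame (Pi.single i 1)
      rw [← dir_single, hpq, dir_comb]
      simp only [act_add, act_smul, h3, h4]
      simp only [h1, h2, hA]
      module
    refine Or.inr ⟨fun i => ?_, key⟩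
    rw [act_neg_neg, neg_act, neg_eq_iff_add_eq_zero, key i]

omit hf in
/-- Near a positive point all points are positive. -/
theorem eventually_isPositiveAt (hp : IsPositiveAt X G v) :
    ∀ᶠ w in nhds v, IsPositiveAt X G w := by
  have hex : ∃ i, act (G v) (pd i (meanCurv X) v)
      + act (G v) (act (G v) (pd i (meanCurv X) v)) ≠ 0 := by
    obtain ⟨a, b, n, hf⟩ := h.exists_adaptedFrame hv
    rcases h.dichotomy hv hf with ⟨hA, -, -⟩ | ⟨-, hB⟩
    · exact exists_act_gauss_ne hf hA
    · exact absurd ((isPositiveAt_iff hf).1 hp) hB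
  obtain ⟨i, hi⟩ := hex
  have hcont : ContinuousAt (fun w => act (G w) (pd i (meanCurv X) w)
      + act (G w) (act (G w) (pd i (meanCurv X) w))) v := by
    have hG := (h.smooth_G v hv).continuousAt
    have hH := (contDiffAt_pd i (h.smooth_H hv)).continuousAt
    have h1 : ContinuousAt (fun w => actB (G w) (pd i (meanCurv X) w)) v :=
      (actB.continuous.continuousAt.comp hG).clm_apply hH
    exact h1.add ((actB.continuous.continuousAt.comp hG).clm_apply h1)
  filter_upwards [hcont.eventually_ne hi, h.eventually_mem hv] with w hw hwU
  rcases h.isPositiveAt_or_neg hwU with ⟨hp, -⟩ | ⟨-, hall⟩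
  · exact hp
  · exact absurd (hall i) hw

end OneTypeOn

/-- The pointwise consequences of the equation `ΔG = φ (G + C)` at positive points. -/
structure IsSplitFrame (X : Plane → E42) (φ : Plane → ℝ) (C : Bivec) (v : Plane)
    (a b : Fin 2 → ℝ) (n₂ : E42) (R A k α : ℝ) : Prop where
  frame : IsPseudoOrthonormal (tangentVec X v a) (tangentVec X v b)
  tetrad : IsTetrad (tangentVec X v a) (tangentVec X v b) (meanCurv X v) n₂
  act_x : act C (tangentVec X v a) = (1 / 2 : ℝ) • tangentVec X v a - R • meanCurv X v
  act_y : act C (tangentVec X v b) = -(1 / 2 : ℝ) • tangentVec X v b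
  act_H : act C (meanCurv X v) = -(1 / 2 : ℝ) • meanCurv X v
  act_n : act C n₂ = (1 / 2 : ℝ) • n₂ + R • tangentVec X v b
  A_ne : A ≠ 0
  dH_a : dir (meanCurv X) v a = A • tangentVec X v b + α • meanCurv X v
  dH_b : dir (meanCurv X) v b = 0
  h_ab : nor X v (dir₂ X v a b) = -meanCurv X v
  h_bb : nor X v (dir₂ X v b b) = -k • meanCurv X v
  phi_eq : φ v = -4 * (A * k)
  phi_R : φ v * R = -2 * α

/-- With B = 0 and C(x,y) = C(n₂,H), the two scalar equations φC(n₂,H) = -2Ak and φ(C(x,y) - 1) =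
2Ak add up to C(x,y) = 1/2. The only entries of C not yet fixed are C(y,n₂), which turns out to
vanish, and C(x,n₂) = -R. -/
theorem OneTypeOn.exists_splitFrame {X : Plane → E42} {G : Plane → Bivec} {φ : Plane → ℝ}
    {C : Bivec} {U : Set Plane} (h : OneTypeOn X G φ C U) {v : Plane} (hv : v ∈ U)
    (hp : IsPositiveAt X G v) : ∃ a b n₂ R A k α, IsSplitFrame X φ C v a b n₂ R A k α := by
  have hpos := h.eventually_isPositiveAt hv hp
  have hxy : ∀ᶠ w in nhds v, bdot C (G w) = 1 / 2 := by
    filter_upwards [hpos, h.eventually_mem hv] with w hw hwU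
    obtain ⟨a, b, n, hf⟩ := h.exists_adaptedFrame hwU
    have hB := (OneTypeOn.isPositiveAt_iff hf).1 hw
    obtain ⟨-, -, e3, e4, -⟩ := h.ev_components hwU hf
    rcases h.dichotomy hwU hf with ⟨hA, -, hxy⟩ | ⟨-, hB'⟩
    · rw [hf.gauss, bdot_wedge h.antisymm]
      rw [hB] at e3 e4
      rw [← hxy] at e3
      have := mul_left_cancel₀ (h.phi_ne w hwU)
        (show φ w * (2 * ev C (tangentVec X w a) (tangentVec X w b)) = φ w * 1 by linarith)
      linarith
    · exact absurd hB hB'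
  obtain ⟨a, b, n, hf⟩ := h.exists_adaptedFrame hv
  have hB := (OneTypeOn.isPositiveAt_iff hf).1 hp
  obtain ⟨e1, e2, e3, e4, e5, e6⟩ := h.ev_components hv hf
  have hHn := isNormal_meanCurv (h.det_ne hv)
  have hXs := h.eventually_smooth hv
  have hnor := nor_dir₂ hf.tetrad hHn hf.normal (h.det_ne hv)
  rcases h.dichotomy hv hf with ⟨hA, -, hq⟩ | ⟨-, hB'⟩
  swap
  · exact absurd hB hB'
  have hP := hxy.self_of_nhds
  rw [hf.gauss, bdot_wedge h.antisymm] at hP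
  rw [hP] at hq
  -- ⟨C,G⟩ = 1/2 holds near `v`; its derivative along x is A·C(y,n₂), and A ≠ 0.
  have hS : ev C (tangentVec X v b) n = 0 := by
    have hd : bdot C (dir G v a) = 0 := by
      have hi (i : Fin 2) : bdot C (pd i G v) = 0 := by
        have := ((hasPd_const C).bdot ((h.smooth_G v hv).hasPd i)).unique
          ((hasPd_const (1 / 2)).congr hxy)
        simpa [bdot] using this
      simp only [dir, Fin.sum_univ_two, bdot_add_right, bdot_smul_right, hi]; ring
    have hg := (h.eventually_mem hv).mono h.gauss
    rw [(dir_gauss hXs (h.smooth_G v hv) hg hf.frame hf.gauss).1, bdot_sub_right,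
      bdot_wedge h.antisymm, bdot_wedge h.antisymm, hnor, e1, ev_sub_left, ev_smul_left,
      ev_smul_left, ev_antisymm h.antisymm (meanCurv X v), e2,
      ev_antisymm h.antisymm n] at hd
    have : ip (meanCurv X v) (dir₂ X v a a) * ev C (tangentVec X v b) n = 0 := by linarith
    exact (mul_eq_zero.1 this).resolve_left hA
  have hβ : ip (dir (meanCurv X) v b) n = 0 := by rw [hS] at e5; linarith
  have t := hf.tetrad
  have yx : ip (tangentVec X v b) (tangentVec X v a) = -1 := by rw [ip_comm, t.xy]
  have qp : ip n (meanCurv X v) = -1 := by rw [ip_comm, t.pq]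
  have px : ip (meanCurv X v) (tangentVec X v a) = 0 := by rw [ip_comm, t.xp]
  have py : ip (meanCurv X v) (tangentVec X v b) = 0 := by rw [ip_comm, t.yp]
  have qx : ip n (tangentVec X v a) = 0 := by rw [ip_comm, t.xq]
  have qy : ip n (tangentVec X v b) = 0 := by rw [ip_comm, t.yq]
  have ea (s w : E42) : ip (act C s) w = ev C w s := ip_comm _ _
  have anti := ev_antisymm h.antisymm
  have self := ev_self h.antisymm
  refine ⟨a, b, n, -ev C (tangentVec X v a) n, ip (meanCurv X v) (dir₂ X v a a),
    ip n (dir₂ X v b b), -ip (dir (meanCurv X) v a) n, hf.frame, t, ?_, ?_, ?_, ?_, hA, ?_, ?_,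
    meanCurv_eq_of_frame hXs hf.frame, ?_, ?_, ?_⟩
  · apply t.eq_of_ip <;> simp only [ea, ip_sub_left, ip_smul_left, t.xx, t.xy, t.xp, t.xq, px, py,
      t.pp, t.pq, self, anti (tangentVec X v b) (tangentVec X v a), hP,
      anti (meanCurv X v) (tangentVec X v a), e1, anti n (tangentVec X v a)] <;> ring
  · apply t.eq_of_ip <;> simp only [ea, ip_smul_left, yx, t.yy, t.yp, t.yq, hP, self,
      anti (meanCurv X v) (tangentVec X v b), e2, anti n (tangentVec X v b), hS] <;> ring
  · apply t.eq_of_ip <;> simp only [ea, ip_smul_left, px, py, t.pp, t.pq, e1, e2, self, ← hq] <;>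
      ring
  · apply t.eq_of_ip <;> simp only [ea, ip_add_left, ip_smul_left, qx, qy, qp, t.qq, yx, t.yy, t.yp,
      t.yq, hS, self, anti (meanCurv X v) n, ← hq] <;> ring
  · conv_lhs => rw [hf.dH_a]
    module
  · rw [hf.dH_b, hB, hβ]; module
  · rw [hnor, hB]; module
  · rw [← hq, hB] at e3; linarith
  · linarith

end OneType

/-! ### Changes of charts -/

section Charts

theorem exists_fderiv_equiv {θ : Plane → Plane} {v : Plane} (hθ : DifferentiableAt ℝ θ v)
    (hJ : (jac θ v).det ≠ 0) :
    ∃ f' : Plane ≃L[ℝ] Plane, HasFDerivAt θ (f' : Plane →L[ℝ] Plane) v := by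
  have hinj : Function.Injective (fderiv ℝ θ v : Plane →ₗ[ℝ] Plane) := by
    rw [injective_iff_map_eq_zero]
    intro w hw
    have hw' : (jac θ v).mulVec w.ofLp = 0 := by
      have : ∑ i, w i • pd i θ v = 0 := by rw [← fderiv_eq_sum_pd]; exact hw
      ext a
      have ha := congrArg (fun z : Plane => z a) this
      simp only [Fin.sum_univ_two, PiLp.add_apply, PiLp.smul_apply, smul_eq_mul,
        PiLp.zero_apply] at ha
      simp only [Matrix.mulVec, dotProduct, Fin.sum_univ_two, jac, Matrix.of_apply, Pi.zero_apply]
      linarith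
    have := Matrix.eq_zero_of_mulVec_eq_zero hJ hw'
    ext a
    exact congrFun this a
  refine ⟨(LinearEquiv.ofInjectiveEndo _ hinj).toContinuousLinearEquiv, ?_⟩
  have e : (((LinearEquiv.ofInjectiveEndo _ hinj).toContinuousLinearEquiv : Plane ≃L[ℝ] Plane) :
      Plane →L[ℝ] Plane) = fderiv ℝ θ v := by
    ext1 w; rfl
  rw [e]
  exact hθ.hasFDerivAt

variable {M : Type*} [TopologicalSpace M] [ChartedSpace Plane M]

/-- The open square with centre `c` and half side `δ`. -/
def box (c : Plane) (δ : ℝ) : Set Plane := {u | |u 0 - c 0| < δ ∧ |u 1 - c 1| < δ}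

theorem isOpen_box (c : Plane) (δ : ℝ) : IsOpen (box c δ) := by
  have h (i : Fin 2) : IsOpen {u : Plane | |u i - c i| < δ} :=
    isOpen_lt (by fun_prop) continuous_const
  exact (h 0).inter (h 1)

theorem exists_box_subset {c : Plane} {S : Set Plane} (hS : S ∈ nhds c) :
    ∃ δ > 0, box c δ ⊆ S := by
  obtain ⟨r, hr, hrS⟩ := Metric.mem_nhds_iff.1 hS
  refine ⟨r / 2, by positivity, fun u hu => hrS ?_⟩
  rw [Metric.mem_ball, EuclideanSpace.dist_eq, Real.sqrt_lt' hr, Fin.sum_univ_two,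
    Real.dist_eq, Real.dist_eq]
  have h0 := hu.1
  have h1 := hu.2
  nlinarith [abs_nonneg (u 0 - c 0), abs_nonneg (u 1 - c 1)]

/-- A smooth map with invertible derivative at a point can be used as a chart near this point. -/
theorem exists_chart [IsManifold (𝓡 2) ∞ M] {e : OpenPartialHomeomorph M Plane} (he : IsChart e) {p : M}
    (hp : p ∈ e.source) {N : Set M} (hN : N ∈ nhds p) {θ : Plane → Plane} {V : Set Plane}
    (hV : IsOpen V) (hpV : e p ∈ V) (hθ : ∀ v ∈ V, ContDiffAt ℝ ∞ θ v)
    (hJ : (jac θ (e p)).det ≠ 0) :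
    ∃ e' : OpenPartialHomeomorph M Plane, IsChart e' ∧ p ∈ e'.source ∧ e'.source ⊆ e.source ∩ N ∧
      (∀ x ∈ e'.source, e' x = θ (e x)) ∧ (∀ x ∈ e'.source, e x ∈ V) ∧
      ∃ δ > 0, e'.target = box (e' p) δ := by
  obtain ⟨f', hf'⟩ := exists_fderiv_equiv (hθ _ hpV).dAt hJ
  let Φ := (hθ _ hpV).toOpenPartialHomeomorph θ hf' (by simp)
  have hΦ : ∀ v, Φ v = θ v := fun _ => rfl
  -- The inverse function theorem gives a homeomorphism near one point. Its inverse is smooth at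
  -- every point of the target only after restricting to where the Jacobian stays invertible.
  let W : Set Plane := V ∩ (fun v => (jac θ v).det) ⁻¹' {0}ᶜ
  have hW : IsOpen W := by
    refine ContinuousOn.isOpen_inter_preimage (fun v hv => ?_) hV isOpen_compl_singleton
    exact (contDiffAt_jac_det (hθ v hv)).continuousAt.continuousWithinAt
  let E := (e.restrOpen (interior N) isOpen_interior).trans (Φ.restrOpen W hW)
  have hE (x) : E x = θ (e x) := rfl
  have hEs (x) (hx : x ∈ E.source) : x ∈ e.source ∧ x ∈ interior N ∧ e x ∈ Φ.source ∧ e x ∈ W := by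
    simpa [E, and_assoc] using hx
  have hpE : p ∈ E.source := by
    have h1 : e p ∈ Φ.source := (hθ _ hpV).mem_toOpenPartialHomeomorph_source hf' (by simp)
    have h2 : p ∈ interior N := mem_interior_iff_mem_nhds.2 hN
    have h3 : e p ∈ W := ⟨hpV, hJ⟩
    simp [E, hp, h1, h2, h3]
  obtain ⟨δ, hδ, hδE⟩ := exists_box_subset (E.open_target.mem_nhds (E.map_source hpE))
  let e' := (E.symm.restrOpen (box (E p) δ) (isOpen_box _ _)).symm
  have he'x (x) : e' x = E x := rfl
  have hsub : e'.source ⊆ E.source := by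
    intro x hx
    have hx' := e'.map_source hx
    have := e'.left_inv hx
    rw [← this]
    have ht : e' x ∈ E.target := by
      have : e' x ∈ E.symm.source ∩ box (E p) δ := by
        simpa [e'] using hx'
      exact this.1
    exact E.map_target ht
  have htar : e'.target = box (E p) δ := by
    have : e'.target = E.target ∩ box (E p) δ := rfl
    rw [this, Set.inter_eq_right]; exact hδE
  have hpe' : p ∈ e'.source := by
    have h0 : E p ∈ e'.target := by rw [htar]; exact ⟨by simpa using hδ, by simpa using hδ⟩
    have := e'.map_target h0
    rwa [show e'.symm (E p) = p from E.left_inv hpE] at this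
  have hsm : ContMDiffOn (𝓡 2) (𝓡 2) ∞ e' e'.source := by
    intro x hx
    obtain ⟨h1, -, -, h4⟩ := hEs x (hsub hx)
    have hθx : ContMDiffAt (𝓡 2) (𝓡 2) ∞ θ (e x) := (hθ _ h4.1).contMDiffAt
    exact (hθx.comp x (contMDiffAt_of_mem_maximalAtlas he h1)).contMDiffWithinAt
  have hsm' : ContMDiffOn (𝓡 2) (𝓡 2) ∞ e'.symm e'.target := by
    intro u hu
    have hx := e'.map_target hu
    obtain ⟨h1, -, h3, h4⟩ := hEs _ (hsub hx)
    have hu' : u ∈ E.target := by rw [htar] at hu; exact hδE hu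
    have e1 : e'.symm u = e.symm (Φ.symm u) := rfl
    have e2 : Φ.symm u = e (e'.symm u) := by
      have huΦ : u ∈ Φ.target := by
        have : e' (e'.symm u) = u := e'.right_inv hu
        rw [← this]
        exact Φ.map_source h3
      apply Φ.injOn (Φ.map_target huΦ) h3
      rw [Φ.right_inv huΦ]
      exact (e'.right_inv hu).symm
    have hmem : Φ.symm u ∈ Φ.source ∧ Φ.symm u ∈ W := by rw [e2]; exact ⟨h3, h4⟩
    have huΦ : u ∈ Φ.target := by
      have : e' (e'.symm u) = u := e'.right_inv hu
      rw [← this]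
      exact Φ.map_source h3
    obtain ⟨g', hg'⟩ := exists_fderiv_equiv (hθ _ hmem.2.1).dAt hmem.2.2
    have hΦs : ContDiffAt ℝ ∞ Φ.symm u := Φ.contDiffAt_symm huΦ hg' (hθ _ hmem.2.1)
    have hes : ContMDiffAt (𝓡 2) (𝓡 2) ∞ e.symm (Φ.symm u) :=
      contMDiffAt_symm_of_mem_maximalAtlas he (by rw [e2]; exact e.map_source h1)
    exact (hes.comp u hΦs.contMDiffAt).contMDiffWithinAt
  refine ⟨e', e'.mem_maximalAtlas_of_contMDiffOn hsm hsm', hpe', fun x hx => ?_, fun x hx => rfl,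
    fun x hx => ?_, δ, hδ, htar⟩
  · obtain ⟨h1, h2, -⟩ := hEs x (hsub hx)
    exact ⟨h1, interior_subset h2⟩
  · exact (hEs x (hsub hx)).2.2.2.1

/-- The transition between two charts is smooth with invertible derivative. -/
theorem transition_smooth {e e' : OpenPartialHomeomorph M Plane} (he : IsChart e)
    (he' : IsChart e') {u : Plane} (hu : u ∈ e'.target) (hu' : e'.symm u ∈ e.source) :
    ContDiffAt ℝ ∞ (e ∘ e'.symm) u ∧ (jac (e ∘ e'.symm) u).det ≠ 0 := by
  have key {e e' : OpenPartialHomeomorph M Plane} (he : IsChart e)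
      (he' : IsChart e') {u : Plane} (hu : u ∈ e'.target) (hu' : e'.symm u ∈ e.source) :
      ContDiffAt ℝ ∞ (e ∘ e'.symm) u := by
    rw [← contMDiffAt_iff_contDiffAt]
    exact (contMDiffAt_of_mem_maximalAtlas he hu').comp u
      (contMDiffAt_symm_of_mem_maximalAtlas he' hu)
  have h1 := key he he' hu hu'
  refine ⟨h1, fun hdet => ?_⟩
  have h2 : ContDiffAt ℝ ∞ (e' ∘ e.symm) (e (e'.symm u)) :=
    key he' he (e.map_source hu') (by rw [e.left_inv hu']; exact e'.map_target hu)
  have hid : (e' ∘ e.symm) ∘ (e ∘ e'.symm) =ᶠ[nhds u] id := by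
    have hc : ContinuousAt e'.symm u := e'.continuousAt_symm hu
    filter_upwards [e'.open_target.mem_nhds hu,
      hc.preimage_mem_nhds (e.open_source.mem_nhds hu')] with w hw hw'
    simp only [Function.comp, id]
    rw [e.left_inv hw', e'.right_inv hw]
  obtain ⟨w, hw0, hw⟩ := Matrix.exists_mulVec_eq_zero_iff.2 hdet
  have hf : fderiv ℝ (e ∘ e'.symm) u (WithLp.toLp 2 w) = 0 := by
    rw [fderiv_eq_sum_pd]
    ext a
    have := congrFun hw a
    simp only [Matrix.mulVec, dotProduct, Fin.sum_univ_two, jac, Matrix.of_apply,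
      Pi.zero_apply] at this
    simp only [Fin.sum_univ_two, PiLp.add_apply, PiLp.smul_apply, smul_eq_mul, PiLp.zero_apply]
    linarith
  have hc := hid.fderiv_eq (𝕜 := ℝ)
  rw [fderiv_comp u h2.dAt h1.dAt, fderiv_id] at hc
  have := congrArg (fun T : Plane →L[ℝ] Plane => T (WithLp.toLp 2 w)) hc
  simp only [ContinuousLinearMap.comp_apply, hf, map_zero, ContinuousLinearMap.id_apply] at this
  exact hw0 (by simpa using congrArg (fun z : Plane => z.ofLp) this.symm)

theorem contDiffAt_comp_chart_symm {V : Type*} [NormedAddCommGroup V] [NormedSpace ℝ V]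
    {F : M → V} (hF : ContMDiff (𝓡 2) 𝓘(ℝ, V) ∞ F) {e : OpenPartialHomeomorph M Plane}
    (he : IsChart e) {u : Plane} (hu : u ∈ e.target) : ContDiffAt ℝ ∞ (F ∘ e.symm) u := by
  rw [← contMDiffAt_iff_contDiffAt]
  exact (hF (e.symm u)).comp u (contMDiffAt_symm_of_mem_maximalAtlas he hu)

omit [ChartedSpace Plane M] in
theorem comp_chart_eventuallyEq {V : Type*} (F : M → V)
    {e e' : OpenPartialHomeomorph M Plane} {u : Plane} (hu : u ∈ e'.target)
    (hu' : e'.symm u ∈ e.source) :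
    F ∘ e'.symm =ᶠ[nhds u] (F ∘ e.symm) ∘ (e ∘ e'.symm) := by
  have hc : ContinuousAt e'.symm u := e'.continuousAt_symm hu
  filter_upwards [hc.preimage_mem_nhds (e.open_source.mem_nhds hu')] with w hw
  simp only [Function.comp]
  rw [e.left_inv hw]

end Charts

/-! ### Coordinates adapted to the null curves `y` -/

section Ruled

variable {V : Type*} [NormedAddCommGroup V] [NormedSpace ℝ V]

/-- Positivity is linear in the direction of differentiation and involves only the invariant objects
H and G, so the chain rule transports it. -/
theorem IsPositiveAt.comp {X : Plane → E42} {G : Plane → Bivec} {ψ : Plane → Plane} {u : Plane}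
    (hX : ∀ᶠ v in nhds (ψ u), ContDiffAt ℝ ∞ X v) (hψ : ∀ᶠ w in nhds u, ContDiffAt ℝ ∞ ψ w)
    (hJ : (jac ψ u).det ≠ 0) (hg : (metric X (ψ u)).det ≠ 0) (h : IsPositiveAt X G (ψ u)) :
    IsPositiveAt (X ∘ ψ) (G ∘ ψ) u := by
  have hψu := hψ.self_of_nhds
  have hH : meanCurv (X ∘ ψ) =ᶠ[nhds u] meanCurv X ∘ ψ := by
    have ht := hψu.continuousAt.tendsto
    have h1 : ∀ᶠ v in nhds (ψ u), (metric X v).det ≠ 0 :=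
      (contDiffAt_metric_det hX.self_of_nhds).continuousAt.eventually_ne hg
    have h2 := (contDiffAt_jac_det hψu).continuousAt.eventually_ne hJ
    filter_upwards [ht.eventually hX, ht.eventually h1, h2, hψ] with w a1 a2 a3 a4
    exact meanCurv_comp a1 a4 a3 a2
  intro i
  rw [pd_congr i hH, pd_comp i (contDiffAt_meanCurv hX.self_of_nhds hg).dAt hψu.dAt]
  simp only [Function.comp, Fin.sum_univ_two, act_add, act_smul, ← h _]

theorem IsPositiveAt.congr {X Y : Plane → E42} {G K : Plane → Bivec} {u : Plane}
    (h : IsPositiveAt X G u) (hX : Y =ᶠ[nhds u] X) (hG : K u = G u) : IsPositiveAt Y K u := by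
  have hH : meanCurv Y =ᶠ[nhds u] meanCurv X := by
    filter_upwards [hX.eventually_nhds] with w hw
    rw [meanCurv_eq_lap, meanCurv_eq_lap, lap_congr hw hw]
  intro i
  rw [pd_congr i hH, hG]; exact h i

theorem hasPd_comp_snd {g : ℝ → V} {g' : V} {u : Plane} (i : Fin 2)
    (hg : HasDerivAt g g' (u 1)) :
    HasPd i (fun v => g (v 1)) ((if (1 : Fin 2) = i then (1 : ℝ) else 0) • g') u := by
  have hc := hasPd_coord i 1 u
  have h := hg.hasFDerivAt.comp u hc.1.hasFDerivAt
  refine ⟨h.differentiableAt, ?_⟩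
  have e : pd i (fun v => g (v 1)) u = (ContinuousLinearMap.toSpanSingleton ℝ g')
      (pd i (fun v : Plane => v 1) u) := by
    simp only [pd]
    rw [show (fun v : Plane => g (v 1)) = g ∘ fun v => v 1 from rfl, h.fderiv]
    rfl
  rw [e, hc.2]
  simp

/-- The boost x ↦ dx, y ↦ d⁻¹y preserves x∧y, H and n₂. It is the remaining freedom of the frame,
used to make the coefficient of ∂₁ in x equal to 1. -/
theorem IsSplitFrame.rescale {X : Plane → E42} {φ : Plane → ℝ} {C : Bivec} {v : Plane}
    {a b : Fin 2 → ℝ} {n₂ : E42} {R A k α : ℝ} (h : IsSplitFrame X φ C v a b n₂ R A k α)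
    {d : ℝ} (hd : d ≠ 0) :
    IsSplitFrame X φ C v (d • a) (d⁻¹ • b) n₂ (d * R) (d ^ 2 * A) (k * (d⁻¹) ^ 2) (d * α) := by
  have ha {W : Type} [NormedAddCommGroup W] [NormedSpace ℝ W] (f : Plane → W) (c : ℝ)
      (a : Fin 2 → ℝ) : dir f v (c • a) = c • dir f v a := by
    simp only [dir, Fin.sum_univ_two, Pi.smul_apply, smul_eq_mul]; module
  have ht (c : ℝ) (a : Fin 2 → ℝ) : tangentVec X v (c • a) = c • tangentVec X v a := ha X c a
  have h2 (c e : ℝ) (a b : Fin 2 → ℝ) : dir₂ X v (c • a) (e • b) = (c * e) • dir₂ X v a b := by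
    simp only [dir₂, Fin.sum_univ_two, Pi.smul_apply, smul_eq_mul]; module
  have hn (c : ℝ) (w : E42) : nor X v (c • w) = c • nor X v w := by
    rw [nor_eq_tanOp, nor_eq_tanOp, tanOp_smul]; module
  have hi : d * d⁻¹ = 1 := mul_inv_cancel₀ hd
  obtain ⟨xx, yy, xy, pp, qq, pq, xp, xq, yp, yq⟩ := h.tetrad
  have t : IsTetrad (d • tangentVec X v a) (d⁻¹ • tangentVec X v b) (meanCurv X v) n₂ := by
    constructor <;> simp only [ip_smul_left, ip_smul_right, xx, yy, xy, pp, qq, pq, xp, xq, yp, yq]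
    all_goals first | ring1 | linear_combination -hi
  refine ⟨?_, ?_, ?_, ?_, h.act_H, ?_, ?_, ?_, ?_, ?_, ?_, ?_, ?_⟩
  · rw [ht, ht]; exact ⟨t.xx, t.yy, t.xy⟩
  · rw [ht, ht]; exact t
  · rw [ht, act_smul, h.act_x]; module
  · rw [ht, act_smul, h.act_y]; module
  · rw [ht, h.act_n, smul_smul, show d * R * d⁻¹ = R by linear_combination R * hi]
  · exact mul_ne_zero (pow_ne_zero _ hd) h.A_ne
  · rw [ha, ht, h.dH_a]
    have : d ^ 2 * A * d⁻¹ = d * A := by linear_combination d * A * hi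
    rw [smul_smul, this]; module
  · rw [ha, h.dH_b, smul_zero]
  · rw [h2, hi, one_smul, h.h_ab]
  · rw [h2, hn, h.h_bb]; module
  · rw [h.phi_eq]; linear_combination (4 * A * k * (d * d⁻¹ + 1)) * hi
  · linear_combination d * h.phi_R

/-- Coordinates whose first coordinate lines are the null curves tangent to `y`. -/
structure IsRuledOn (X : Plane → E42) (G : Plane → Bivec) (φ : Plane → ℝ) (C : Bivec)
    (U : Set Plane) (q n : ℝ → E42) : Prop where
  oneType : OneTypeOn X G φ C U
  pos : ∀ u ∈ U, IsPositiveAt X G u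
  smooth_q : ∀ u ∈ U, ContDiffAt ℝ ∞ q (u 1)
  smooth_n : ∀ u ∈ U, ContDiffAt ℝ ∞ n (u 1)
  q_eq : ∀ u ∈ U, (1 / 2 : ℝ) • X u + act C (X u) = q (u 1)
  H_eq : ∀ u ∈ U, meanCurv X u = -n (u 1)

/-- The equations satisfied at a point in coordinates adapted to the null curves. -/
structure RuledEqs (X : Plane → E42) (φ : Plane → ℝ) (C : Bivec) (q n : ℝ → E42) (u : Plane)
    (g ρ R A k α : ℝ) : Prop where
  rho_ne : ρ ≠ 0
  A_ne : A ≠ 0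
  n_ne : n (u 1) ≠ 0
  dq : deriv q (u 1) = pd 1 X u + g • pd 0 X u + R • n (u 1)
  dn : deriv n (u 1) = -(A * ρ⁻¹) • pd 0 X u + α • n (u 1)
  nor_dq : nor X u (deriv q (u 1)) = R • n (u 1)
  g00 : ip (pd 0 X u) (pd 0 X u) = 0
  X0_dq : ip (pd 0 X u) (deriv q (u 1)) = -ρ
  n_pd : ∀ i, ip (n (u 1)) (pd i X u) = 0
  null : ip (pd 1 X u + g • pd 0 X u) (pd 1 X u + g • pd 0 X u) = 0
  nor_00 : nor X u (pd 0 (pd 0 X) u) = (ρ ^ 2 * k) • n (u 1)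
  nor_01 : nor X u (pd 1 (pd 0 X) u + g • pd 0 (pd 0 X) u) = ρ • n (u 1)
  phi_eq : φ u = -4 * (A * k)
  phi_R : φ u * R = -2 * α
  dn_dq : ip (deriv n (u 1)) (deriv q (u 1)) = A
  act_n : act C (n (u 1)) = -(1 / 2 : ℝ) • n (u 1)
  act_X0 : act C (pd 0 X u) = -(1 / 2 : ℝ) • pd 0 X u
  act_dq : act C (deriv q (u 1)) = (1 / 2 : ℝ) • deriv q (u 1)
  n_n : ip (n (u 1)) (n (u 1)) = 0
  antisymm : ∀ i j, C i j = -C j i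

/-- Since (1/2 + C)X depends on t alone, ∂₀X lies in the kernel of 1/2 + C. Pairing (1/2 + C)x = x -
RH with y gives -1, so ∂₀X has no x-component and is a multiple of y. The split frame equations are
then rewritten in these coordinates. -/
theorem IsRuledOn.exists_ruledEqs {X : Plane → E42} {G : Plane → Bivec} {φ : Plane → ℝ}
    {C : Bivec} {U : Set Plane} {q n : ℝ → E42} (h : IsRuledOn X G φ C U q n) {u : Plane}
    (hu : u ∈ U) : ∃ g ρ R A k α, RuledEqs X φ C q n u g ρ R A k α := by
  have h1 := h.oneType
  have hXu := h1.smooth_X u hu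
  have hg := h1.det_ne hu
  obtain ⟨a, b, n₂, R, A, k, α, hf⟩ := h1.exists_splitFrame hu (h.pos u hu)
  have hqd : HasDerivAt q (deriv q (u 1)) (u 1) :=
    ((h.smooth_q u hu).differentiableAt (by simp)).hasDerivAt
  have hnd : HasDerivAt n (deriv n (u 1)) (u 1) :=
    ((h.smooth_n u hu).differentiableAt (by simp)).hasDerivAt
  have hq (i : Fin 2) : (1 / 2 : ℝ) • pd i X u + act C (pd i X u)
      = (if (1 : Fin 2) = i then (1 : ℝ) else 0) • deriv q (u 1) := by
    have hev : (fun w => (1 / 2 : ℝ) • X w + act C (X w)) =ᶠ[nhds u] fun w => q (w 1) := by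
      filter_upwards [h1.eventually_mem hu] with w hw using h.q_eq w hw
    exact (((hXu.hasPd i).const_smul (1 / 2)).add ((hXu.hasPd i).clm (actL C))).unique
      ((hasPd_comp_snd i hqd).congr hev)
  have hn (i : Fin 2) : pd i (meanCurv X) u
      = -((if (1 : Fin 2) = i then (1 : ℝ) else 0) • deriv n (u 1)) := by
    have hev : meanCurv X =ᶠ[nhds u] fun w => -n (w 1) := by
      filter_upwards [h1.eventually_mem hu] with w hw using h.H_eq w hw
    exact ((hasPd_comp_snd i hnd).neg.congr hev).2
  have hq0 := hq 0
  have hq1 := hq 1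
  have hn0 := hn 0
  have hn1 := hn 1
  simp at hq0 hq1 hn0 hn1
  -- the second vector of the frame is tangent to the first coordinate lines
  obtain ⟨c, d, hcd⟩ := exists_frame_comb hf.frame (Pi.single 0 1)
  have hX0 : pd 0 X u = c • tangentVec X u a + d • tangentVec X u b := by
    rw [← dir_single, hcd, dir_comb]; rfl
  have hc : c = 0 := by
    have := congrArg (fun w => ip w (tangentVec X u b)) hq0
    simp only [hX0, act_add, act_smul, hf.act_x, hf.act_y, ip_add_left, ip_sub_left, ip_smul_left,
      hf.tetrad.xy, hf.tetrad.yy, ip_comm (meanCurv X u), hf.tetrad.yp, ip_zero_left] at this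
    linarith
  subst hc
  have hb0 : d * b 0 = 1 := by simpa using (congrFun hcd 0).symm
  have hb1 : d * b 1 = 0 := by simpa using (congrFun hcd 1).symm
  have hd : d ≠ 0 := by rintro rfl; simp at hb0
  have hb1' : b 1 = 0 := (mul_eq_zero.1 hb1).resolve_left hd
  have hb0' : b 0 ≠ 0 := by intro h0; rw [h0] at hb0; simp at hb0
  have ha1 : a 1 ≠ 0 := by
    intro h0
    apply (det_ne_of_frame hf.frame).1
    rw [h0, hb1']; ring
  -- After this boost x = ∂₁X + g ∂₀X and y = ρ⁻¹ ∂₀X.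
  have hf' := hf.rescale (inv_ne_zero ha1)
  have ea : (a 1)⁻¹ • a = ![(a 1)⁻¹ * a 0, 1] := by
    ext i; fin_cases i <;> simp [ha1]
  have eb : (a 1)⁻¹⁻¹ • b = ![((a 1)⁻¹ * d)⁻¹, 0] := by
    ext i
    fin_cases i
    · simp only [Fin.zero_eta, Pi.smul_apply, smul_eq_mul, mul_inv, Matrix.cons_val_zero]
      rw [← eq_inv_of_mul_eq_one_right hb0]
    · simp [hb1']
  have hρ : (a 1)⁻¹ * d ≠ 0 := mul_ne_zero (inv_ne_zero ha1) hd
  rw [ea, eb] at hf'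
  generalize (a 1)⁻¹ * a 0 = g at hf'
  generalize (a 1)⁻¹ * d = ρ at hf' hρ
  generalize (a 1)⁻¹ * R = R' at hf'
  generalize (a 1)⁻¹ ^ 2 * A = A' at hf'
  generalize k * (a 1)⁻¹⁻¹ ^ 2 = k' at hf'
  generalize (a 1)⁻¹ * α = α' at hf'
  clear hf hcd hX0 ea eb
  have hH := h.H_eq u hu
  have ex : tangentVec X u ![g, 1] = pd 1 X u + g • pd 0 X u := by
    simp [tangentVec]; abel
  have ey : tangentVec X u ![ρ⁻¹, 0] = ρ⁻¹ • pd 0 X u := by simp [tangentVec]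
  have eX0 : pd 0 X u = ρ • tangentVec X u ![ρ⁻¹, 0] := by
    rw [ey, smul_smul, mul_inv_cancel₀ hρ, one_smul]
  have t := hf'.tetrad
  have hdq : deriv q (u 1) = pd 1 X u + g • pd 0 X u + R' • n (u 1) := by
    have e1 : deriv q (u 1) = (1 / 2 : ℝ) • tangentVec X u ![g, 1]
        + act C (tangentVec X u ![g, 1]) := by
      rw [ex, act_add, act_smul, ← hq1]
      have : act C (pd 0 X u) = -((1 / 2 : ℝ) • pd 0 X u) := by
        rw [eq_neg_iff_add_eq_zero, add_comm, one_div]; exact hq0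
      rw [this]; simp only [one_div]; module
    rw [e1, hf'.act_x, hH, ex]; module
  have hnp : IsNormal X u (meanCurv X u) := isNormal_meanCurv hg
  have hnn : ∀ i, ip (n (u 1)) (pd i X u) = 0 := by
    intro i
    have := hnp i
    rw [hH, ip_neg_left] at this
    linarith
  have hdn : deriv n (u 1) = -(A' * ρ⁻¹) • pd 0 X u + α' • n (u 1) := by
    have := hf'.dH_a
    rw [hH, ey] at this
    simp only [dir, Fin.sum_univ_two, hn0, hn1, Matrix.cons_val_zero, Matrix.cons_val_one] at this
    have e : deriv n (u 1) = -(g • (0 : E42) + (1 : ℝ) • -deriv n (u 1)) := by module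
    rw [e, this]; module
  have hn_n : ip (n (u 1)) (n (u 1)) = 0 := by
    have := t.pp
    rwa [hH, ip_neg_left, ip_neg_right, neg_neg] at this
  have hnort (w : E42) (hw : ∀ l, ip w (pd l X u) = 0) : nor X u w = w := by
    rw [nor_eq_tanOp, tanOp_of_normal X hw, sub_zero]
  have hadd (v w : E42) : nor X u (v + w) = nor X u v + nor X u w := by
    simp only [nor_eq_tanOp, tanOp_add]; abel
  have hsm (c : ℝ) (w : E42) : nor X u (c • w) = c • nor X u w := by
    simp only [nor_eq_tanOp, tanOp_smul]; module
  have hpd (i) : nor X u (pd i X u) = 0 := by rw [nor_eq_tanOp, tanOp_pd X hg, sub_self]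
  have hxn : ip (pd 1 X u + g • pd 0 X u) (n (u 1)) = 0 := by
    rw [ip_comm, ip_add_right, ip_smul_right, hnn, hnn]; ring
  have hnull := t.xx
  rw [ex] at hnull
  have hxy := t.xy
  rw [ex, ip_comm] at hxy
  have hX0x : ip (pd 0 X u) (pd 1 X u + g • pd 0 X u) = -ρ := by
    rw [ey, ip_smul_left] at hxy
    linear_combination ρ * hxy - ip (pd 0 X u) (pd 1 X u + g • pd 0 X u) * mul_inv_cancel₀ hρ
  have h00 : ip (pd 0 X u) (pd 0 X u) = 0 := by
    have hyy := t.yy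
    rw [ey, ip_smul_left, ip_smul_right] at hyy
    have hρi : ρ⁻¹ ≠ 0 := inv_ne_zero hρ
    simpa [hρi] using hyy
  have hX0dq : ip (pd 0 X u) (deriv q (u 1)) = -ρ := by
    rw [hdq, ip_add_right, hX0x, ip_smul_right, ip_comm, hnn]; ring
  have hactn : act C (n (u 1)) = -(1 / 2 : ℝ) • n (u 1) := by
    have := hf'.act_H
    rw [hH, act_neg] at this
    rw [← neg_neg (act C (n (u 1))), this]; module
  refine ⟨g, ρ, R', A', k', α', hρ, hf'.A_ne, ?_, hdq, hdn, ?_, h00, hX0dq, hnn, hnull, ?_, ?_,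
    hf'.phi_eq, hf'.phi_R, ?_, hactn, ?_, ?_, hn_n, h1.antisymm⟩
  · intro h0
    have := t.pq
    rw [hH, h0, neg_zero, ip_zero_left] at this
    norm_num at this
  · rw [hdq, hadd, hadd, hsm, hsm, hpd, hpd, hnort _ hnn]; module
  · have := hf'.h_bb
    simp only [dir₂, Fin.sum_univ_two, Matrix.cons_val_zero, Matrix.cons_val_one, mul_zero,
      zero_mul, zero_smul, add_zero, hsm, hH] at this
    have e := congrArg (fun w => (ρ ^ 2) • w) this
    simp only [smul_smul] at e
    rw [show ρ ^ 2 * (ρ⁻¹ * ρ⁻¹) = 1 by field_simp, one_smul] at e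
    rw [e]; module
  · have := hf'.h_ab
    simp only [dir₂, Fin.sum_univ_two, Matrix.cons_val_zero, Matrix.cons_val_one, mul_zero,
      zero_smul, add_zero, one_mul, hH, hadd, hsm, neg_neg] at this
    rw [hadd, hsm]
    have e := congrArg (fun w => ρ • w) this
    simp only [smul_add, smul_smul] at e
    rw [show ρ * (g * ρ⁻¹) = g by field_simp, mul_inv_cancel₀ hρ, one_smul] at e
    rw [← e]; abel
  · rw [hdn, ip_add_left, ip_smul_left, ip_smul_left, hX0dq, hdq, ip_add_right, ip_comm (n _), hxn,
      ip_smul_right, hn_n]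
    field_simp; ring
  · rw [eX0, act_smul, hf'.act_y]; module
  · have e1 := hf'.act_x
    rw [ex] at e1
    rw [hdq, act_add, e1, act_smul, hactn, hH]; module

end Ruled

/-! ### Existence of adapted charts -/

section LocalFormulas

theorem hasDerivAt_first {V : Type*} [NormedAddCommGroup V] [NormedSpace ℝ V] {f : Plane → V}
    {s t : ℝ} (hf : DifferentiableAt ℝ f !₂[s, t]) :
    HasDerivAt (fun r : ℝ => f !₂[r, t]) (pd 0 f !₂[s, t]) s := by
  have h : HasDerivAt (fun r : ℝ => (!₂[r, t] : Plane)) (EuclideanSpace.single 0 1) s := by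
    have e : (fun r : ℝ => (!₂[r, t] : Plane)) = fun r : ℝ =>
        r • (EuclideanSpace.single 0 1 : Plane) + t • (EuclideanSpace.single 1 1 : Plane) := by
      ext r i; fin_cases i <;> simp
    rw [e]
    simpa using ((hasDerivAt_id s).smul_const (EuclideanSpace.single 0 1 : Plane)).add_const
      (t • (EuclideanSpace.single 1 1 : Plane))
  exact hf.hasFDerivAt.comp_hasDerivAt s h

theorem pair_eta (u : Plane) : (!₂[u 0, u 1] : Plane) = u := by
  ext i; fin_cases i <;> rfl

theorem contDiff_pair (c : ℝ) : ContDiff ℝ ∞ fun t : ℝ => (!₂[c, t] : Plane) := by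
  have e : (fun t : ℝ => (!₂[c, t] : Plane)) = fun t : ℝ =>
      c • (EuclideanSpace.single 0 1 : Plane) + t • (EuclideanSpace.single 1 1 : Plane) := by
    ext r i; fin_cases i <;> simp
  rw [e]
  exact contDiff_const.add (contDiff_id.smul contDiff_const)

theorem mem_box_pair {c u : Plane} {δ : ℝ} (hδ : 0 < δ) (hu : u ∈ box c δ) :
    (!₂[c 0, u 1] : Plane) ∈ box c δ := ⟨by simpa using hδ, hu.2⟩

theorem eq_of_pd_zero {V : Type*} [NormedAddCommGroup V] [NormedSpace ℝ V] {f : Plane → V}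
    {c : Plane} {δ : ℝ} (hf : ∀ u ∈ box c δ, HasPd 0 f 0 u) {u v : Plane} (hu : u ∈ box c δ)
    (hv : v ∈ box c δ) (huv : u 1 = v 1) : f u = f v := by
  have hmem (r : ℝ) (hr : r ∈ Metric.ball (c 0) δ) : (!₂[r, u 1] : Plane) ∈ box c δ :=
    ⟨by simpa [Real.dist_eq] using hr, hu.2⟩
  have hd (r : ℝ) (hr : r ∈ Metric.ball (c 0) δ) :
      HasDerivAt (fun r : ℝ => f !₂[r, u 1]) 0 r := by
    have h := hf _ (hmem r hr)
    have := hasDerivAt_first h.1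
    rwa [h.2] at this
  have := (Metric.isOpen_ball (x := c 0) (ε := δ)).is_const_of_deriv_eq_zero
    ((convex_ball (c 0) δ).isPreconnected)
    (fun r hr => (hd r hr).differentiableAt.differentiableWithinAt) (fun r hr => (hd r hr).deriv)
    (show u 0 ∈ Metric.ball (c 0) δ by simpa [Real.dist_eq] using hu.1)
    (show v 0 ∈ Metric.ball (c 0) δ by simpa [Real.dist_eq] using hv.1)
  simp only at this
  rw [pair_eta, huv, pair_eta] at this
  exact this

/-- The coefficient `g` of the null vector field `∂₁ + g ∂₀`. -/
noncomputable def gCoef (X : Plane → E42) (q : ℝ → E42) (w : Plane) : ℝ :=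
  -(ip (pd 1 X w) (pd 1 X w) * (2 * ip (pd 0 X w) (deriv q (w 1)))⁻¹)

/-- The component `R` of the derivative of `q` along the mean curvature vector. -/
noncomputable def rCoef (X : Plane → E42) (q n : ℝ → E42) (w : Plane) : ℝ :=
  (ip (deriv n (w 1)) (deriv q (w 1)))⁻¹ *
    ip (pd 1 X w + gCoef X q w • pd 0 X w) (deriv (deriv q) (w 1))

variable {X : Plane → E42} {G : Plane → Bivec} {φ : Plane → ℝ} {C : Bivec} {U : Set Plane}
  {q n : ℝ → E42}

theorem contDiffAt_deriv {V : Type*} [NormedAddCommGroup V] [NormedSpace ℝ V] {f : ℝ → V} {t : ℝ}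
    (hf : ContDiffAt ℝ ∞ f t) : ContDiffAt ℝ ∞ (deriv f) t := by
  have : deriv f = fun s => fderiv ℝ f s 1 := by ext s; simp
  rw [this]
  exact (hf.fderiv_right (m := ∞) le_rfl).clm_apply contDiffAt_const

theorem contDiffAt_comp_snd {V : Type*} [NormedAddCommGroup V] [NormedSpace ℝ V] {f : ℝ → V}
    {u : Plane} (hf : ContDiffAt ℝ ∞ f (u 1)) : ContDiffAt ℝ ∞ (fun v : Plane => f (v 1)) u :=
  hf.comp u (EuclideanSpace.proj (1 : Fin 2) : Plane →L[ℝ] ℝ).contDiff.contDiffAt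

theorem hasDerivAt_of_contDiffAt {V : Type*} [NormedAddCommGroup V] [NormedSpace ℝ V]
    {f : ℝ → V} {t : ℝ} (hf : ContDiffAt ℝ ∞ f t) : HasDerivAt f (deriv f t) t :=
  (hf.differentiableAt (by simp)).hasDerivAt

theorem RuledEqs.ip_dq_dq {u : Plane} {g ρ R A k α : ℝ} (h : RuledEqs X φ C q n u g ρ R A k α) :
    ip (deriv q (u 1)) (deriv q (u 1)) = 0 := by
  have h0 := h.n_pd 0
  have h1 := h.n_pd 1
  have h2 := h.null
  rw [h.dq]
  simp only [ip_add_left, ip_add_right, ip_smul_left, ip_smul_right, ip_comm (pd 0 X u) (n _),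
    ip_comm (pd 1 X u) (n _), h0, h1, h.n_n, mul_zero, add_zero] at h2 ⊢
  linarith

theorem RuledEqs.ip_n_dq {u : Plane} {g ρ R A k α : ℝ} (h : RuledEqs X φ C q n u g ρ R A k α) :
    ip (n (u 1)) (deriv q (u 1)) = 0 := by
  rw [h.dq]
  simp only [ip_add_right, ip_smul_right, h.n_pd, h.n_n, mul_zero, add_zero]

/-- The frames were chosen pointwise without any smoothness. Nullity of ∂₁X + g∂₀X determines g by
an explicit formula, which shows that it is smooth; `rCoef` plays the same role for R. -/
theorem RuledEqs.gCoef_eq {u : Plane} {g ρ R A k α : ℝ} (h : RuledEqs X φ C q n u g ρ R A k α) :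
    gCoef X q u = g := by
  have h2 := h.null
  have hρ := h.rho_ne
  have h3 := h.X0_dq
  rw [gCoef, h3]
  rw [h.dq] at h3
  simp only [ip_add_left, ip_add_right, ip_smul_left, ip_smul_right, ip_comm (pd 1 X u) (pd 0 X u),
    ip_comm (pd 0 X u) (n _), h.n_pd, h.g00, mul_zero, add_zero] at h2 h3
  rw [h3] at h2
  field_simp
  linarith

theorem IsRuledOn.hasPd_dq (h : IsRuledOn X G φ C U q n) {u : Plane} (hu : u ∈ U) (i : Fin 2) :
    HasPd i (fun v => deriv q (v 1))
      ((if (1 : Fin 2) = i then (1 : ℝ) else 0) • deriv (deriv q) (u 1)) u :=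
  hasPd_comp_snd i (hasDerivAt_of_contDiffAt (contDiffAt_deriv (h.smooth_q u hu)))

theorem IsRuledOn.hasPd_dn (h : IsRuledOn X G φ C U q n) {u : Plane} (hu : u ∈ U) (i : Fin 2) :
    HasPd i (fun v => deriv n (v 1))
      ((if (1 : Fin 2) = i then (1 : ℝ) else 0) • deriv (deriv n) (u 1)) u :=
  hasPd_comp_snd i (hasDerivAt_of_contDiffAt (contDiffAt_deriv (h.smooth_n u hu)))

theorem IsRuledOn.hasPd_n (h : IsRuledOn X G φ C U q n) {u : Plane} (hu : u ∈ U) (i : Fin 2) :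
    HasPd i (fun v => n (v 1))
      ((if (1 : Fin 2) = i then (1 : ℝ) else 0) • deriv n (u 1)) u :=
  hasPd_comp_snd i (hasDerivAt_of_contDiffAt (h.smooth_n u hu))

theorem IsRuledOn.ip_dq_ddq (h : IsRuledOn X G φ C U q n) {u : Plane} (hu : u ∈ U) :
    ip (deriv q (u 1)) (deriv (deriv q) (u 1)) = 0 := by
  have hev : (fun w => ip (deriv q (w 1)) (deriv q (w 1))) =ᶠ[nhds u] fun _ => 0 := by
    filter_upwards [h.oneType.eventually_mem hu] with w hw
    obtain ⟨g, ρ, R, A, k, α, e⟩ := h.exists_ruledEqs hw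
    exact e.ip_dq_dq
  have := ((h.hasPd_dq hu 1).ip (h.hasPd_dq hu 1)).unique ((hasPd_const 0).congr hev)
  simp only [if_true, one_smul] at this
  rw [ip_comm (deriv (deriv q) _)] at this
  linarith

theorem IsRuledOn.ip_n_ddq (h : IsRuledOn X G φ C U q n) {u : Plane} (hu : u ∈ U) :
    ip (n (u 1)) (deriv (deriv q) (u 1)) = -ip (deriv n (u 1)) (deriv q (u 1)) := by
  have hev : (fun w => ip (n (w 1)) (deriv q (w 1))) =ᶠ[nhds u] fun _ => 0 := by
    filter_upwards [h.oneType.eventually_mem hu] with w hw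
    obtain ⟨g, ρ, R, A, k, α, e⟩ := h.exists_ruledEqs hw
    exact e.ip_n_dq
  have := ((h.hasPd_n hu 1).ip (h.hasPd_dq hu 1)).unique ((hasPd_const 0).congr hev)
  simp only [if_true, one_smul] at this
  linarith

/-- Differentiating ⟨q',q'⟩ = 0 and ⟨n,q'⟩ = 0 gives ⟨q',q''⟩ = 0 and ⟨n,q''⟩ = -⟨n',q'⟩ = -A.
Inserting q' = x + Rn into the first yields ⟨x,q''⟩ = RA. -/
theorem IsRuledOn.rCoef_eq (h : IsRuledOn X G φ C U q n) {u : Plane} (hu : u ∈ U)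
    {g ρ R A k α : ℝ} (e : RuledEqs X φ C q n u g ρ R A k α) : rCoef X q n u = R := by
  have h1 := h.ip_dq_ddq hu
  have h2 := h.ip_n_ddq hu
  have hA := e.A_ne
  rw [e.dq, ip_add_left, ip_smul_left, h2, e.dn_dq] at h1
  rw [rCoef, e.gCoef_eq, e.dn_dq, inv_mul_eq_iff_eq_mul₀ hA]
  linarith

theorem IsRuledOn.contDiffAt_gCoef (h : IsRuledOn X G φ C U q n) {u : Plane} (hu : u ∈ U) :
    ContDiffAt ℝ ∞ (gCoef X q) u := by
  obtain ⟨g, ρ, R, A, k, α, e⟩ := h.exists_ruledEqs hu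
  have hX := h.oneType.smooth_X u hu
  have h0 := contDiffAt_pd 0 hX
  have h1 := contDiffAt_pd 1 hX
  have hq := contDiffAt_comp_snd (contDiffAt_deriv (h.smooth_q u hu))
  refine ((contDiffAt_ip h1 h1).mul ((contDiffAt_const.mul (contDiffAt_ip h0 hq)).inv ?_)).neg
  rw [e.X0_dq]
  exact mul_ne_zero two_ne_zero (neg_ne_zero.2 e.rho_ne)

theorem IsRuledOn.contDiffAt_rCoef (h : IsRuledOn X G φ C U q n) {u : Plane} (hu : u ∈ U) :
    ContDiffAt ℝ ∞ (rCoef X q n) u := by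
  obtain ⟨g, ρ, R, A, k, α, e⟩ := h.exists_ruledEqs hu
  have hX := h.oneType.smooth_X u hu
  have h0 := contDiffAt_pd 0 hX
  have h1 := contDiffAt_pd 1 hX
  have hq := contDiffAt_deriv (h.smooth_q u hu)
  have hn := contDiffAt_comp_snd (contDiffAt_deriv (h.smooth_n u hu))
  refine ((contDiffAt_ip hn (contDiffAt_comp_snd hq)).inv ?_).mul
    (contDiffAt_ip (h1.add ((h.contDiffAt_gCoef hu).smul h0))
      (contDiffAt_comp_snd (contDiffAt_deriv hq)))
  rw [e.dn_dq]; exact e.A_ne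

/-- Differentiate q' = ∂₁X + g∂₀X + Rn along ∂₀, where q' and n are constant, and take normal parts:
0 = ρn + (∂₀R)n. As ρ ≠ 0, R can replace the first coordinate. -/
theorem IsRuledOn.pd_rCoef (h : IsRuledOn X G φ C U q n) {u : Plane} (hu : u ∈ U)
    {g ρ R A k α : ℝ} (e : RuledEqs X φ C q n u g ρ R A k α) : pd 0 (rCoef X q n) u = -ρ := by
  have hX := h.oneType.smooth_X u hu
  have hg := h.oneType.det_ne hu
  have hev : (fun w => deriv q (w 1)) =ᶠ[nhds u] fun w =>
      pd 1 X w + gCoef X q w • pd 0 X w + rCoef X q n w • n (w 1) := by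
    filter_upwards [h.oneType.eventually_mem hu] with w hw
    obtain ⟨g, ρ, R, A, k, α, e⟩ := h.exists_ruledEqs hw
    rw [e.gCoef_eq, h.rCoef_eq hw e, e.dq]
  have hd := ((((contDiffAt_pd 1 hX).hasPd 0).add (((h.contDiffAt_gCoef hu).hasPd 0).smul
    ((contDiffAt_pd 0 hX).hasPd 0))).add
    (((h.contDiffAt_rCoef hu).hasPd 0).smul (h.hasPd_n hu 0))).congr hev |>.unique
      (h.hasPd_dq hu 0)
  have hadd (v w : E42) : nor X u (v + w) = nor X u v + nor X u w := by
    simp only [nor_eq_tanOp, tanOp_add]; abel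
  have hsm (c : ℝ) (w : E42) : nor X u (c • w) = c • nor X u w := by
    simp only [nor_eq_tanOp, tanOp_smul]; module
  have hpd (i) : nor X u (pd i X u) = 0 := by rw [nor_eq_tanOp, tanOp_pd X hg, sub_self]
  have hnn : nor X u (n (u 1)) = n (u 1) := by
    rw [nor_eq_tanOp, tanOp_of_normal X e.n_pd, sub_zero]
  have h01 := e.nor_01
  have := congrArg (nor X u) hd
  simp only [one_ne_zero, if_false, zero_smul, smul_zero, add_zero, hadd, hsm, hpd, hnn,
    e.gCoef_eq, zero_add] at this h01
  rw [pd_comm hX 0 1, h01, show nor X u 0 = 0 by simpa using hsm 0 0, ← add_smul] at this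
  have := (smul_eq_zero.1 this).resolve_right e.n_ne
  linarith

end LocalFormulas

/-! ### Construction of the ruled and normalized charts on the manifold -/

section Charts

variable {M : Type*} [TopologicalSpace M] [ChartedSpace Plane M]

/-- The equation `ΔG = φ (G + C)` in all charts. -/
structure IsOneType (F : M → E42) (G : M → Bivec) (φ : M → ℝ) (C : Bivec) : Prop where
  smooth : ContMDiff (𝓡 2) 𝓘(ℝ, E42) ∞ F
  chart : ∀ e : OpenPartialHomeomorph M Plane, IsChart e →
    OneTypeOn (F ∘ e.symm) (G ∘ e.symm) (φ ∘ e.symm) C e.target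

theorem IsOneType.neg {F : M → E42} {G : M → Bivec} {φ : M → ℝ} {C : Bivec}
    (h : IsOneType F G φ C) : IsOneType F (fun p => -G p) φ (-C) :=
  ⟨h.smooth, fun e he => (h.chart e he).neg⟩

/-- The surface is positive at all points of `N`, in all charts. -/
def IsPositiveOn (F : M → E42) (G : M → Bivec) (N : Set M) : Prop :=
  ∀ e : OpenPartialHomeomorph M Plane, IsChart e → ∀ u ∈ e.target, e.symm u ∈ N →
    IsPositiveAt (F ∘ e.symm) (G ∘ e.symm) u

/-- The dichotomy at p selects the sign of G; openness extends the choice to a neighbourhood and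
invariance extends it to all charts. -/
theorem IsOneType.exists_positive [IsManifold (𝓡 2) ∞ M] {F : M → E42} {G : M → Bivec}
    {φ : M → ℝ} {C : Bivec} (h : IsOneType F G φ C) (p : M) :
    ∃ (G' : M → Bivec) (C' : Bivec) (N : Set M), IsOneType F G' φ C' ∧ N ∈ nhds p ∧
      IsPositiveOn F G' N := by
  have he : IsChart (chartAt Plane p) := IsManifold.chart_mem_maximalAtlas p
  have hp := mem_chart_source Plane p
  have hu := (chartAt Plane p).map_source hp
  have key {G : M → Bivec} {C : Bivec} (h : IsOneType F G φ C)
      (hpos : IsPositiveAt (F ∘ (chartAt Plane p).symm) (G ∘ (chartAt Plane p).symm)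
        (chartAt Plane p p)) : ∃ N ∈ nhds p, IsPositiveOn F G N := by
    have hev := (h.chart _ he).eventually_isPositiveAt hu hpos
    have hev' := ((chartAt Plane p).continuousAt hp).eventually hev
    refine ⟨_, Filter.inter_mem ((chartAt Plane p).open_source.mem_nhds hp) hev', ?_⟩
    intro e he' u hu' hN
    obtain ⟨h1, h2⟩ := hN
    have hv := (chartAt Plane p).map_source h1
    obtain ⟨t1, t2⟩ := transition_smooth he he' hu' h1
    have hψ : ∀ᶠ w in nhds u, ContDiffAt ℝ ∞ (chartAt Plane p ∘ e.symm) w := by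
      have hc : ContinuousAt e.symm u := e.continuousAt_symm hu'
      filter_upwards [e.open_target.mem_nhds hu',
        hc.preimage_mem_nhds ((chartAt Plane p).open_source.mem_nhds h1)] with w hw hw'
      exact (transition_smooth he he' hw hw').1
    refine (IsPositiveAt.comp (X := F ∘ (chartAt Plane p).symm)
      ((h.chart _ he).eventually_smooth hv) hψ t2 ((h.chart _ he).det_ne hv) h2).congr
      (comp_chart_eventuallyEq F hu' h1) ?_
    simp only [Function.comp]
    rw [(chartAt Plane p).left_inv h1]
  rcases (h.chart _ he).isPositiveAt_or_neg hu with ⟨hp, -⟩ | ⟨hp, -⟩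
  · obtain ⟨N, hN, hpos⟩ := key h hp
    exact ⟨G, C, N, h, hN, hpos⟩
  · obtain ⟨N, hN, hpos⟩ := key h.neg hp
    exact ⟨_, _, N, h.neg, hN, hpos⟩

variable [IsManifold (𝓡 2) ∞ M] {F : M → E42} {G : M → Bivec} {φ : M → ℝ} {C : Bivec} {N : Set M}

theorem jac_det_of_dir {θ : Plane → Plane} {u : Plane} {a b : Fin 2 → ℝ} {r : ℝ}
    (h : (dir θ u a 0 = 0 ∧ dir θ u a 1 = -1) ∧ dir θ u b 0 = -1 ∧ dir θ u b 1 = r)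
    : (jac θ u).det ≠ 0 := by
  obtain ⟨⟨h1, h2⟩, h3, h4⟩ := h
  simp only [dir, Fin.sum_univ_two, PiLp.add_apply, PiLp.smul_apply, smul_eq_mul] at h1 h2 h3 h4
  rw [Matrix.det_fin_two]
  simp only [jac, Matrix.of_apply]
  intro h0
  have : (pd 0 θ u 0 * pd 1 θ u 1 - pd 1 θ u 0 * pd 0 θ u 1) * (a 0 * b 1 - a 1 * b 0) = -1 := by
    have : (a 0 * pd 0 θ u 0 + a 1 * pd 1 θ u 0) * (b 0 * pd 0 θ u 1 + b 1 * pd 1 θ u 1)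
      - (a 0 * pd 0 θ u 1 + a 1 * pd 1 θ u 1) * (b 0 * pd 0 θ u 0 + b 1 * pd 1 θ u 0) = -1 := by
      rw [h1, h2, h3, h4]; ring
    linear_combination this
  rw [h0] at this
  norm_num at this

/-- Around every point there are coordinates adapted to the null curves. -/
theorem IsOneType.exists_ruled_chart (h : IsOneType F G φ C) {p : M} (hN : N ∈ nhds p)
    (hpos : IsPositiveOn F G N) : ∃ e : OpenPartialHomeomorph M Plane, IsChart e ∧
      p ∈ e.source ∧ ∃ q n : ℝ → E42,
        IsRuledOn (F ∘ e.symm) (G ∘ e.symm) (φ ∘ e.symm) C e.target q n := by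
  have he0 : IsChart (chartAt Plane p) := IsManifold.chart_mem_maximalAtlas p
  set e0 := chartAt Plane p with he0_def
  have hp := mem_chart_source Plane p
  have hu := e0.map_source hp
  have h0 := h.chart _ he0
  obtain ⟨a, b, n₂, R, A, k, α, hf⟩ := h0.exists_splitFrame hu (hpos _ he0 _ hu (by
    rw [e0.left_inv hp]; exact mem_of_mem_nhds hN))
  have hX := h0.smooth_X _ hu
  obtain ⟨x, hx⟩ : ∃ x, x = tangentVec (F ∘ e0.symm) (e0 p) a := ⟨_, rfl⟩
  obtain ⟨y, hy⟩ : ∃ y, y = tangentVec (F ∘ e0.symm) (e0 p) b := ⟨_, rfl⟩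
  have t := hf.tetrad
  have hax := hf.act_x
  have hay := hf.act_y
  rw [← hx, ← hy] at t
  rw [← hx] at hax
  rw [← hy] at hay
  -- The new coordinates are ⟨X,x⟩ and ⟨(1/2 + C)X,y⟩ for the frame frozen at p. The second is
  -- constant along the y-curves, since (1/2 + C)y = 0 everywhere. At p the differential sends x to
  -- (0,-1) and y to (-1,0), hence is invertible.
  let L : E42 →L[ℝ] ℝ := ipB.flip x
  let K : E42 →L[ℝ] ℝ := ipB.flip y ∘L ((1 / 2 : ℝ) • ContinuousLinearMap.id ℝ E42 + actL C)
  have hL (w) : L w = ip w x := rfl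
  have hK (w) : K w = ip ((1 / 2 : ℝ) • w + act C w) y := rfl
  let Θ : E42 →L[ℝ] Plane :=
    ((EuclideanSpace.equiv (Fin 2) ℝ).symm : (Fin 2 → ℝ) →L[ℝ] Plane) ∘L
      ContinuousLinearMap.pi ![L, K]
  have hΘ0 (w) : Θ w 0 = ip w x := rfl
  have hΘ1 (w) : Θ w 1 = ip ((1 / 2 : ℝ) • w + act C w) y := rfl
  have hθdir (c : Fin 2 → ℝ) : dir (fun w => Θ ((F ∘ e0.symm) w)) (e0 p) c =
      Θ (tangentVec (F ∘ e0.symm) (e0 p) c) := by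
    simp only [dir, tangentVec, Fin.sum_univ_two, map_add, map_smul, pd_clm Θ _ hX.dAt]
  have hJ : (jac (fun w => Θ ((F ∘ e0.symm) w)) (e0 p)).det ≠ 0 := by
    apply jac_det_of_dir (a := a) (b := b) (r := 0)
    rw [hθdir, hθdir, ← hx, ← hy]
    refine ⟨⟨?_, ?_⟩, ?_, ?_⟩
    · rw [hΘ0, t.xx]
    · rw [hΘ1, hax]
      simp only [ip_add_left, ip_sub_left, ip_smul_left, t.xy, ip_comm (meanCurv _ _) y, t.yp]; ring
    · rw [hΘ0, ip_comm, t.xy]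
    · rw [hΘ1, hay]
      simp only [ip_add_left, ip_smul_left, t.yy]; ring
  obtain ⟨e, he, hpe, hsub, heq, hmem, δ, hδ, htar⟩ := exists_chart he0 hp hN e0.open_target hu
    (fun v hv => Θ.contDiff.contDiffAt.comp v (h0.smooth_X v hv)) hJ
  have h1 := h.chart e he
  set Y := F ∘ e.symm with hY
  have hpos1 : ∀ u ∈ e.target, IsPositiveAt Y (G ∘ e.symm) u := fun u hu =>
    hpos e he u hu (hsub (e.map_target hu)).2
  have hcoord (w) (hw : w ∈ e.target) : Θ (Y w) = w := by
    have hs := e.map_target hw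
    have := heq _ hs
    rw [e.right_inv hw] at this
    conv_rhs => rw [this]
    simp only [Function.comp, hY]
    rw [e0.left_inv (hsub hs).1]
  have hΘpd (u) (hu : u ∈ e.target) (i : Fin 2) :
      Θ (pd i Y u) 1 = if (1 : Fin 2) = i then 1 else 0 := by
    have hev : (fun w : Plane => w 1) =ᶠ[nhds u] fun w => Θ (Y w) 1 := by
      filter_upwards [h1.eventually_mem hu] with w hw
      rw [hcoord w hw]
    have hd : HasPd i (fun w => Θ (Y w)) (Θ (pd i Y u)) u := ((h1.smooth_X u hu).hasPd i).clm Θ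
    have := hd.clm (EuclideanSpace.proj (1 : Fin 2) : Plane →L[ℝ] ℝ)
    exact (this.congr hev).unique (hasPd_coord i 1 u)
  have hzero (u) (hu : u ∈ e.target) :
      (1 / 2 : ℝ) • pd 0 Y u + act C (pd 0 Y u) = 0 ∧ pd 0 (meanCurv Y) u = 0 := by
    obtain ⟨a, b, n, R, A, k, α, hf⟩ := h1.exists_splitFrame hu (hpos1 u hu)
    obtain ⟨c0, d0, hcd0⟩ := exists_frame_comb hf.frame (Pi.single 0 1)
    obtain ⟨c1, d1, hcd1⟩ := exists_frame_comb hf.frame (Pi.single 1 1)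
    have e0 : pd 0 Y u = c0 • tangentVec Y u a + d0 • tangentVec Y u b := by
      rw [← dir_single, hcd0, dir_comb]; rfl
    have e1 : pd 1 Y u = c1 • tangentVec Y u a + d1 • tangentVec Y u b := by
      rw [← dir_single, hcd1, dir_comb]; rfl
    have k0 := hΘpd u hu 0
    have k1 := hΘpd u hu 1
    have hx' : (1 / 2 : ℝ) • tangentVec Y u a + act C (tangentVec Y u a)
        = tangentVec Y u a - R • meanCurv Y u := by rw [hf.act_x]; module
    have hy' : (1 / 2 : ℝ) • tangentVec Y u b + act C (tangentVec Y u b) = 0 := by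
      rw [hf.act_y]; module
    have comb (c d : ℝ) : (1 / 2 : ℝ) • (c • tangentVec Y u a + d • tangentVec Y u b)
        + act C (c • tangentVec Y u a + d • tangentVec Y u b)
        = c • (tangentVec Y u a - R • meanCurv Y u) := by
      have : (1 / 2 : ℝ) • (c • tangentVec Y u a + d • tangentVec Y u b)
          + act C (c • tangentVec Y u a + d • tangentVec Y u b) =
          c • ((1 / 2 : ℝ) • tangentVec Y u a + act C (tangentVec Y u a))
          + d • ((1 / 2 : ℝ) • tangentVec Y u b + act C (tangentVec Y u b)) := by
        rw [act_add, act_smul, act_smul]; module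
      rw [this, hx', hy', smul_zero, add_zero]
    rw [hΘ1, e0, comb, ip_smul_left] at k0
    rw [hΘ1, e1, comb, ip_smul_left] at k1
    -- The second coordinate function has derivative c·⟨x - RH, y₀⟩ on a vector with x-component c,
    -- y₀ being the frozen y. The value 1 on ∂₁ shows the pairing is nonzero, and the value 0 on ∂₀
    -- then forces c = 0.
    have hne : ip (tangentVec Y u a - R • meanCurv Y u) y ≠ 0 := by
      intro h0
      rw [h0] at k1
      norm_num at k1
    have hc0 : c0 = 0 := (mul_eq_zero.1 (by simpa using k0)).resolve_right hne
    refine ⟨by rw [e0, comb, hc0, zero_smul], ?_⟩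
    rw [← dir_single, hcd0, dir_comb, hc0, hf.dH_b, zero_smul, smul_zero, add_zero]
  have hbox : ∀ u ∈ box (e p) δ, u ∈ e.target := fun u hu => by rwa [htar]
  have hbox' : ∀ u ∈ e.target, (!₂[e p 0, u 1] : Plane) ∈ e.target := fun u hu => by
    rw [htar] at hu ⊢; exact mem_box_pair hδ hu
  let Q : E42 →L[ℝ] E42 := (1 / 2 : ℝ) • ContinuousLinearMap.id ℝ E42 + actL C
  have hQ (w) : Q w = (1 / 2 : ℝ) • w + act C w := rfl
  -- The curves q and n are read off on the central line of the box; horizontal segments of the box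
  -- reach every other point.
  refine ⟨e, he, hpe, fun t => Q (Y !₂[e p 0, t]), fun t => -meanCurv Y !₂[e p 0, t],
    h1, hpos1, ?_, ?_, ?_, ?_⟩
  · intro u hu
    have := ContDiffAt.comp (g := Y) (u 1) (h1.smooth_X _ (hbox' u hu))
      (contDiff_pair (e p 0)).contDiffAt
    exact Q.contDiff.contDiffAt.comp _ this
  · intro u hu
    exact ((h1.smooth_H (hbox' u hu)).comp (u 1) (contDiff_pair (e p 0)).contDiffAt).neg
  · intro u hu
    rw [← hQ]
    refine eq_of_pd_zero (c := e p) (δ := δ) (f := fun w => Q (Y w)) (fun w hw => ?_)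
      (by rwa [← htar]) (by rw [← htar]; exact hbox' u hu) rfl
    refine (((h1.smooth_X w (hbox w hw)).hasPd 0).clm Q).of_eq ?_
    exact (hzero w (hbox w hw)).1
  · intro u hu
    rw [neg_neg]
    refine eq_of_pd_zero (c := e p) (δ := δ) (fun w hw => ?_)
      (by rwa [← htar]) (by rw [← htar]; exact hbox' u hu) rfl
    exact ((h1.smooth_H (hbox w hw)).hasPd 0).of_eq (hzero w (hbox w hw)).2

/-- Around every point there are coordinates adapted to the null curves in which `ρ = 1` and the
first coordinate is `-R`. -/
theorem IsOneType.exists_normalized_chart (h : IsOneType F G φ C) {p : M} (hN : N ∈ nhds p)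
    (hpos : IsPositiveOn F G N) : ∃ e : OpenPartialHomeomorph M Plane, IsChart e ∧
      p ∈ e.source ∧ (∃ δ > 0, e.target = box (e p) δ) ∧ ∃ q n : ℝ → E42,
        IsRuledOn (F ∘ e.symm) (G ∘ e.symm) (φ ∘ e.symm) C e.target q n ∧
        ∀ u ∈ e.target, ∃ g A k α,
          RuledEqs (F ∘ e.symm) (φ ∘ e.symm) C q n u g 1 (-u 0) A k α := by
  obtain ⟨e₁, he₁, hp₁, q, n, h₁⟩ := h.exists_ruled_chart hN hpos
  have hu := e₁.map_source hp₁
  set X := F ∘ e₁.symm with hX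
  -- Only the first coordinate changes, so t, and with it the curves q and n, is kept.
  let θ : Plane → Plane := fun w => !₂[-rCoef X q n w, w 1]
  have hθ : ∀ v ∈ e₁.target, ContDiffAt ℝ ∞ θ v := by
    intro v hv
    rw [contDiffAt_piLp]
    intro i
    fin_cases i
    · exact (h₁.contDiffAt_rCoef hv).neg
    · exact (EuclideanSpace.proj (1 : Fin 2) : Plane →L[ℝ] ℝ).contDiff.contDiffAt
  have hJ : (jac θ (e₁ p)).det ≠ 0 := by
    obtain ⟨g, ρ, R, A, k, α, e⟩ := h₁.exists_ruledEqs hu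
    have h0 (i : Fin 2) : pd i θ (e₁ p) 0 = -pd i (rCoef X q n) (e₁ p) := by
      rw [← pd_apply i 0 (hθ _ hu).dAt]; exact pd_neg i
    have h1 (i : Fin 2) : pd i θ (e₁ p) 1 = if (1 : Fin 2) = i then 1 else 0 := by
      rw [← pd_apply i 1 (hθ _ hu).dAt]; exact (hasPd_coord i 1 (e₁ p)).2
    rw [Matrix.det_fin_two]
    simp only [jac, Matrix.of_apply, h0, h1, h₁.pd_rCoef hu e]
    simpa using e.rho_ne
  obtain ⟨e, he, hpe, hsub, heq, hmem, δ, hδ, htar⟩ := exists_chart he₁ hp₁ hN e₁.open_target hu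
    hθ hJ
  have h2 := h.chart e he
  have hw1 (w) (hw : w ∈ e.target) : w = θ (e₁ (e.symm w)) ∧ e₁ (e.symm w) ∈ e₁.target ∧
      e.symm w ∈ e₁.source := by
    have hs := e.map_target hw
    refine ⟨?_, hmem _ hs, (hsub hs).1⟩
    rw [← heq _ hs, e.right_inv hw]
  have hsnd (w) (hw : w ∈ e.target) : w 1 = (e₁ (e.symm w)) 1 := by
    conv_lhs => rw [(hw1 w hw).1]
    rfl
  have hfst (w) (hw : w ∈ e.target) : w 0 = -rCoef X q n (e₁ (e.symm w)) := by
    conv_lhs => rw [(hw1 w hw).1]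
    rfl
  have hr : IsRuledOn (F ∘ e.symm) (G ∘ e.symm) (φ ∘ e.symm) C e.target q n := by
    refine ⟨h2, fun u hu => hpos e he u hu (hsub (e.map_target hu)).2, ?_, ?_, ?_, ?_⟩
    · intro u hu
      rw [hsnd u hu]; exact h₁.smooth_q _ (hw1 u hu).2.1
    · intro u hu
      rw [hsnd u hu]; exact h₁.smooth_n _ (hw1 u hu).2.1
    · intro u hu
      rw [hsnd u hu, ← h₁.q_eq _ (hw1 u hu).2.1]
      simp only [hX, Function.comp]
      rw [e₁.left_inv (hw1 u hu).2.2]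
    · intro u hu
      obtain ⟨t1, t2⟩ := transition_smooth he₁ he hu (hw1 u hu).2.2
      rw [hsnd u hu, ← h₁.H_eq _ (hw1 u hu).2.1, meanCurv_eq_lap,
        lap_congr (comp_chart_eventuallyEq F hu (hw1 u hu).2.2)
          (comp_chart_eventuallyEq F hu (hw1 u hu).2.2), ← meanCurv_eq_lap]
      exact meanCurv_comp (h₁.oneType.smooth_X _ (hw1 u hu).2.1) t1 t2
        (h₁.oneType.det_ne (hw1 u hu).2.1)
  -- R is an invariant: Rn is the normal part of q'. Thus it has the same value in both charts,
  -- where by construction it is minus the new first coordinate.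
  have hR (u) (hu : u ∈ e.target) {g ρ R A k α : ℝ}
      (E : RuledEqs (F ∘ e.symm) (φ ∘ e.symm) C q n u g ρ R A k α) : R = -u 0 := by
    obtain ⟨g', ρ', R', A', k', α', E'⟩ := h₁.exists_ruledEqs (hw1 u hu).2.1
    obtain ⟨t1, t2⟩ := transition_smooth he₁ he hu (hw1 u hu).2.2
    have hev := comp_chart_eventuallyEq F hu (hw1 u hu).2.2
    have hn : nor (F ∘ e.symm) u (deriv q (u 1)) = nor X (e₁ (e.symm u)) (deriv q (u 1)) := by
      have : nor (F ∘ e.symm) u (deriv q (u 1)) = nor (X ∘ (e₁ ∘ e.symm)) u (deriv q (u 1)) := by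
        simp only [nor, metric_congr hev, pd_congr _ hev]; rfl
      rw [this]
      exact nor_comp (h₁.oneType.smooth_X _ (hw1 u hu).2.1).dAt t1.dAt t2 _
    have k1 := E.nor_dq
    have k2 := E'.nor_dq
    rw [hn] at k1
    rw [← hsnd u hu, k1] at k2
    have := smul_left_injective ℝ E.n_ne k2
    rw [this, hfst u hu, neg_neg, h₁.rCoef_eq (hw1 u hu).2.1 E']
  refine ⟨e, he, hpe, ⟨δ, hδ, htar⟩, q, n, hr, fun u hu => ?_⟩
  obtain ⟨g, ρ, R, A, k, α, E⟩ := hr.exists_ruledEqs hu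
  -- The relation ∂₀R = -ρ applied to R = -s.
  have hρ : ρ = 1 := by
    have k1 := hr.pd_rCoef hu E
    have hev : rCoef (F ∘ e.symm) q n =ᶠ[nhds u] fun w => -w 0 := by
      filter_upwards [h2.eventually_mem hu] with w hw
      obtain ⟨g, ρ, R, A, k, α, E⟩ := hr.exists_ruledEqs hw
      rw [hr.rCoef_eq hw E, hR w hw E]
    rw [((hasPd_coord 0 0 u).neg.congr hev).2] at k1
    simp at k1
    exact k1.symm
  have := hR u hu E
  subst hρ this
  exact ⟨g, A, k, α, E⟩

end Charts

/-! ### Pairs of null curves -/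

section Curves

theorem hasDerivAt_clm {V W : Type*} [NormedAddCommGroup V] [NormedSpace ℝ V]
    [NormedAddCommGroup W] [NormedSpace ℝ W] (T : V →L[ℝ] W) {f : ℝ → V} {f' : V} {t : ℝ}
    (hf : HasDerivAt f f' t) : HasDerivAt (fun s => T (f s)) (T f') t :=
  T.hasFDerivAt.comp_hasDerivAt t hf

theorem hasDerivAt_ip {f g : ℝ → E42} {f' g' : E42} {t : ℝ} (hf : HasDerivAt f f' t)
    (hg : HasDerivAt g g' t) :
    HasDerivAt (fun s => ip (f s) (g s)) (ip f' (g t) + ip (f t) g') t := by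
  have := ipB.hasDerivAt_of_bilinear (fun _ => hf) (fun _ => hg)
  rw [add_comm]
  exact this

theorem hasDerivAt_unique {V : Type*} [NormedAddCommGroup V] [NormedSpace ℝ V]
    {f g : ℝ → V} {f' g' : V} {t : ℝ} (hf : HasDerivAt f f' t) (hg : HasDerivAt g g' t)
    (h : ∀ᶠ s in nhds t, f s = g s) : f' = g' :=
  hf.unique (hg.congr_of_eventuallyEq h)

theorem contDiffAt_ip' {f g : ℝ → E42} {t : ℝ} (hf : ContDiffAt ℝ ∞ f t)
    (hg : ContDiffAt ℝ ∞ g t) : ContDiffAt ℝ ∞ (fun v => ip (f v) (g v)) t :=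
  (ipB.contDiff.contDiffAt.comp t hf).clm_apply hg

/-- For a skew endomorphism ⟨v,Cw⟩ = -⟨w,Cv⟩, so c⟨v,w⟩ = -c⟨v,w⟩: eigenspaces with nonzero
eigenvalue are totally null. Most orthogonality relations between the curves come from here. -/
theorem ip_eq_zero_of_act {C : Bivec} (hC : ∀ i j, C i j = -C j i) {c : ℝ} (hc : c ≠ 0) {v w : E42}
    (hv : act C v = c • v) (hw : act C w = c • w) : ip v w = 0 := by
  have h := ev_antisymm hC v w
  rw [ev, ev, hv, hw, ip_smul_right, ip_smul_right, ip_comm w v] at h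
  have : c * ip v w = 0 := by linarith
  exact (mul_eq_zero.1 this).resolve_left hc

theorem act_deriv {C : Bivec} {I : Set ℝ} (hI : IsOpen I) {f : ℝ → E42} {c : ℝ}
    (hf : ∀ t ∈ I, ContDiffAt ℝ ∞ f t) (h : ∀ t ∈ I, act C (f t) = c • f t) {t : ℝ} (ht : t ∈ I) :
    act C (deriv f t) = c • deriv f t := by
  have hd := hasDerivAt_of_contDiffAt (hf t ht)
  refine hasDerivAt_unique (hasDerivAt_clm (actL C) hd) (hd.const_smul c) ?_
  filter_upwards [hI.mem_nhds ht] with s hs using h s hs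

theorem cubic_eq_zero {a b c d : ℝ} {S : Set ℝ} (hS : S.Infinite)
    (h : ∀ x ∈ S, a * x ^ 3 + b * x ^ 2 + c * x + d = 0) : a = 0 ∧ b = 0 ∧ c = 0 ∧ d = 0 := by
  have h0 : (⟨a, b, c, d⟩ : Cubic ℝ).toPoly = 0 := by
    apply Polynomial.eq_zero_of_infinite_isRoot
    refine hS.mono fun x hx => ?_
    simp [Cubic.toPoly, h x hx]
  have := (Cubic.toPoly_injective _ _).1 (h0.trans Cubic.zero.symm)
  rw [Cubic.ext_iff] at this
  exact this

/-- Two null curves in the eigenspaces of `C` with eigenvalues `-1/2` and `1/2`. -/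
structure IsNullPair (C : Bivec) (I : Set ℝ) (n Q : ℝ → E42) : Prop where
  isOpen : IsOpen I
  antisymm : ∀ i j, C i j = -C j i
  smooth_n : ∀ t ∈ I, ContDiffAt ℝ ∞ n t
  smooth_Q : ∀ t ∈ I, ContDiffAt ℝ ∞ Q t
  act_n : ∀ t ∈ I, act C (n t) = -(1 / 2 : ℝ) • n t
  act_Q : ∀ t ∈ I, act C (Q t) = (1 / 2 : ℝ) • Q t
  n_Q : ∀ t ∈ I, ip (n t) (Q t) = 0
  dn_Q : ∀ t ∈ I, ip (deriv n t) (Q t) ≠ 0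

namespace IsNullPair

variable {C : Bivec} {I : Set ℝ} {n Q : ℝ → E42} (h : IsNullPair C I n Q) {t : ℝ} (ht : t ∈ I)

include h

theorem act_dn : ∀ t ∈ I, act C (deriv n t) = -(1 / 2 : ℝ) • deriv n t := fun _ ht =>
  act_deriv h.isOpen h.smooth_n h.act_n ht

theorem act_ddn : ∀ t ∈ I, act C (deriv (deriv n) t) = -(1 / 2 : ℝ) • deriv (deriv n) t :=
  fun _ ht => act_deriv h.isOpen (fun t ht => contDiffAt_deriv (h.smooth_n t ht)) h.act_dn ht

theorem act_dQ : ∀ t ∈ I, act C (deriv Q t) = (1 / 2 : ℝ) • deriv Q t := fun _ ht =>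
  act_deriv h.isOpen h.smooth_Q h.act_Q ht

theorem act_ddQ : ∀ t ∈ I, act C (deriv (deriv Q) t) = (1 / 2 : ℝ) • deriv (deriv Q) t :=
  fun _ ht => act_deriv h.isOpen (fun t ht => contDiffAt_deriv (h.smooth_Q t ht)) h.act_dQ ht

theorem ip_eq_zero_neg {v w : E42} (hv : act C v = -(1 / 2 : ℝ) • v)
    (hw : act C w = -(1 / 2 : ℝ) • w) : ip v w = 0 :=
  ip_eq_zero_of_act h.antisymm (by norm_num) hv hw

theorem ip_eq_zero_pos {v w : E42} (hv : act C v = (1 / 2 : ℝ) • v)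
    (hw : act C w = (1 / 2 : ℝ) • w) : ip v w = 0 :=
  ip_eq_zero_of_act h.antisymm (by norm_num) hv hw

include ht

theorem n_dQ : ip (n t) (deriv Q t) = -ip (deriv n t) (Q t) := by
  have h1 := hasDerivAt_ip (hasDerivAt_of_contDiffAt (h.smooth_n t ht))
    (hasDerivAt_of_contDiffAt (h.smooth_Q t ht))
  have := hasDerivAt_unique h1 (hasDerivAt_const t (0 : ℝ))
    (by filter_upwards [h.isOpen.mem_nhds ht] with s hs using h.n_Q s hs)
  linarith

/-- The curves n, n' span the eigenplane for -1/2 and Q, Q' the one for 1/2; the last vector is Q'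
scaled and corrected by a multiple of Q to be orthogonal to n'. -/
theorem exists_tetrad : ∃ m, act C m = (1 / 2 : ℝ) • m ∧
    IsTetrad (deriv n t) (-(ip (deriv n t) (Q t))⁻¹ • Q t) (n t) m := by
  have hA := h.dn_Q t ht
  have h1 := h.n_dQ ht
  have h2 := h.n_Q t ht
  have an := h.act_n t ht
  have adn := h.act_dn t ht
  have aQ := h.act_Q t ht
  have adQ := h.act_dQ t ht
  set A := ip (deriv n t) (Q t) with hAdef
  have am : act C (A⁻¹ • deriv Q t - ((A⁻¹) ^ 2 * ip (deriv n t) (deriv Q t)) • Q t) = (1 / 2 : ℝ) •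
      (A⁻¹ • deriv Q t - ((A⁻¹) ^ 2 * ip (deriv n t) (deriv Q t)) • Q t) := by
    rw [act_sub, act_smul, act_smul, aQ, adQ]; module
  have aQ' : act C (-A⁻¹ • Q t) = (1 / 2 : ℝ) • (-A⁻¹ • Q t) := by
    rw [act_smul, aQ]; module
  refine ⟨_, am, h.ip_eq_zero_neg adn adn, h.ip_eq_zero_pos aQ' aQ', ?_,
    h.ip_eq_zero_neg an an, h.ip_eq_zero_pos am am, ?_, h.ip_eq_zero_neg adn an, ?_, ?_,
    h.ip_eq_zero_pos aQ' am⟩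
  · rw [ip_smul_right, ← hAdef]; field_simp
  · rw [ip_sub_right, ip_smul_right, ip_smul_right, h1, h2]; field_simp; ring
  · rw [ip_sub_right, ip_smul_right, ip_smul_right, ← hAdef]; field_simp; ring
  · rw [ip_smul_left, ip_comm, h2]; ring

theorem exists_expand_neg {w : E42} (hw : act C w = -(1 / 2 : ℝ) • w) :
    ∃ r : ℝ, w = ((ip (deriv n t) (Q t))⁻¹ * ip w (Q t)) • deriv n t + r • n t := by
  have hn := h.ip_eq_zero_neg hw (h.act_n t ht)
  have hdn := h.ip_eq_zero_neg hw (h.act_dn t ht)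
  obtain ⟨m, -, T⟩ := h.exists_tetrad ht
  refine ⟨-ip w m, ?_⟩
  conv_lhs => rw [T.expand w]
  rw [hdn, hn, ip_smul_right]
  module

/-- The metric pairs the two totally null eigenplanes perfectly, so a vector of one is detected by a
basis n, n' of the other. -/
theorem eq_zero_of_act_pos {w : E42} (hw : act C w = (1 / 2 : ℝ) • w) (h1 : ip w (n t) = 0)
    (h2 : ip w (deriv n t) = 0) : w = 0 := by
  obtain ⟨m, hm, T⟩ := h.exists_tetrad ht
  apply T.eq_of_ip
  · rw [h2, ip_zero_left]
  · rw [ip_smul_right, h.ip_eq_zero_pos hw (h.act_Q t ht), ip_zero_left, mul_zero]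
  · rw [h1, ip_zero_left]
  · rw [h.ip_eq_zero_pos hw hm, ip_zero_left]

theorem coeff_unique {a b a' b' : ℝ}
    (e : a • deriv n t + b • n t = a' • deriv n t + b' • n t) : a = a' ∧ b = b' := by
  have hA := h.dn_Q t ht
  have e1 := congrArg (fun w => ip w (Q t)) e
  simp only [ip_add_left, ip_smul_left, h.n_Q t ht, mul_zero, add_zero] at e1
  have ha := mul_right_cancel₀ hA e1
  subst ha
  have e2 := congrArg (fun w => ip w (deriv Q t)) (add_left_cancel e)
  simp only [ip_smul_left, h.n_dQ ht] at e2
  exact ⟨rfl, mul_right_cancel₀ (neg_ne_zero.2 hA) e2⟩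

end IsNullPair

/-- The coefficient of `ξ'` in the third order equation. -/
noncomputable def coefB (l₁ l₃ : ℝ → ℝ) (t : ℝ) : ℝ :=
  (-3 * l₁ t * (deriv l₁ t * deriv l₃ t + l₃ t * deriv (deriv l₁) t)
    + 3 * l₃ t * (deriv l₁ t) ^ 2 + (l₁ t) ^ 2 * (2 * deriv (deriv l₃) t + 1))
    / ((l₁ t) ^ 2 * l₃ t)

/-- The coefficient of `n` in `ξ'`. -/
noncomputable def coefC (l₁ l₃ : ℝ → ℝ) (t : ℝ) : ℝ := 27 * l₃ t / l₁ t ^ 3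

theorem hasDerivAt_coefC {l₁ l₃ : ℝ → ℝ} {t : ℝ} (h₁ : ContDiffAt ℝ ∞ l₁ t)
    (h₃ : ContDiffAt ℝ ∞ l₃ t) (h₁n : l₁ t ≠ 0) : HasDerivAt (coefC l₁ l₃)
      (27 * (deriv l₃ t * l₁ t - 3 * l₃ t * deriv l₁ t) / l₁ t ^ 4) t := by
  refine HasDerivAt.congr_deriv (((hasDerivAt_of_contDiffAt h₃).const_mul 27).fun_div
    ((hasDerivAt_of_contDiffAt h₁).fun_pow 3) (pow_ne_zero 3 h₁n)) ?_
  field_simp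
  push_cast
  ring

section Equations

variable {I : Set ℝ} (hI : IsOpen I) {l₁ l₃ : ℝ → ℝ} (h₁ : ∀ t ∈ I, ContDiffAt ℝ ∞ l₁ t)
  (h₃ : ∀ t ∈ I, ContDiffAt ℝ ∞ l₃ t) (h₁n : ∀ t ∈ I, l₁ t ≠ 0) (h₃n : ∀ t ∈ I, l₃ t ≠ 0)
  {n : ℝ → E42} (hn : ∀ t ∈ I, ContDiffAt ℝ ∞ n t)
  (ode : ∀ t ∈ I, deriv (deriv n) t - (deriv l₃ t / l₃ t - 3 * deriv l₁ t / l₁ t) • deriv n t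
      + (1 / l₃ t) • n t = 0)

include h₁ h₃ h₁n hn

theorem hasDerivAt_coefC_smul {t : ℝ} (ht : t ∈ I) :
    HasDerivAt (fun s => coefC l₁ l₃ s • n s)
      ((27 * (deriv l₃ t * l₁ t - 3 * l₃ t * deriv l₁ t) / l₁ t ^ 4) • n t
        + coefC l₁ l₃ t • deriv n t) t := by
  have hc := hasDerivAt_coefC (h₁ t ht) (h₃ t ht) (h₁n t ht)
  have := hc.fun_smul (hasDerivAt_of_contDiffAt (hn t ht))
  rwa [add_comm] at this

include hI h₃n ode

/-- This explains ζ: the third order equation for ξ says exactly that ξ' - c n, with c = 27λ₃/λ₁³,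
solves the homogeneous second order equation. -/
theorem coefC_smul_eq_zeta {t : ℝ} (ht : t ∈ I) :
    deriv (deriv fun s => coefC l₁ l₃ s • n s) t
      + (3 * deriv l₃ t / l₃ t - 3 * deriv l₁ t / l₁ t) • deriv (fun s => coefC l₁ l₃ s • n s) t
      + coefB l₁ l₃ t • (coefC l₁ l₃ t • n t) = zeta l₁ l₃ n t := by
  have d₁ := hasDerivAt_of_contDiffAt (h₁ t ht)
  have d₃ := hasDerivAt_of_contDiffAt (h₃ t ht)
  have d₁' := hasDerivAt_of_contDiffAt (contDiffAt_deriv (h₁ t ht))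
  have d₃' := hasDerivAt_of_contDiffAt (contDiffAt_deriv (h₃ t ht))
  have dn := hasDerivAt_of_contDiffAt (hn t ht)
  have dn' := hasDerivAt_of_contDiffAt (contDiffAt_deriv (hn t ht))
  have n₁ := h₁n t ht
  have n₃ := h₃n t ht
  have hw := fun s hs => (hasDerivAt_coefC_smul h₁ h₃ h₁n hn (t := s) hs).deriv
  have hev : deriv (fun s => coefC l₁ l₃ s • n s) =ᶠ[nhds t] fun s =>
      (27 * (deriv l₃ s * l₁ s - 3 * l₃ s * deriv l₁ s) / l₁ s ^ 4) • n s
        + coefC l₁ l₃ s • deriv n s := by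
    filter_upwards [hI.mem_nhds ht] with s hs using hw s hs
  have hc := hasDerivAt_coefC (h₁ t ht) (h₃ t ht) n₁
  have hc' := ((((d₃'.fun_mul d₁).fun_sub ((d₃.const_mul 3).fun_mul d₁')).const_mul 27).fun_div
    (d₁.fun_pow 4) (pow_ne_zero 4 n₁))
  have h2 := ((hc'.fun_smul dn).fun_add (hc.fun_smul dn')).congr_of_eventuallyEq hev
  have hode : deriv (deriv n) t = (deriv l₃ t / l₃ t - 3 * deriv l₁ t / l₁ t) • deriv n t
      - (1 / l₃ t) • n t := by
    have := ode t ht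
    rw [sub_add, sub_eq_zero] at this
    exact this
  rw [h2.deriv, hw t ht, hode, zeta, coefB, coefC]
  match_scalars
  · field_simp
    ring
  · field_simp
    ring

/-- Differentiating ⟨n,Q⟩ = 0 and ⟨n',Q⟩ = 1/λ₃ and using the equation for n'' gives the pairings of
Q' and Q'' with n and n'. The left-hand side lies in the eigenplane for 1/2 and pairs to zero with
both, so it vanishes. -/
theorem IsNullPair.ode_Q {C : Bivec} {Q : ℝ → E42} (h : IsNullPair C I n Q)
    (hA : ∀ t ∈ I, ip (deriv n t) (Q t) = 1 / l₃ t) {t : ℝ} (ht : t ∈ I) :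
    deriv (deriv Q) t + (3 * deriv l₃ t / l₃ t - 3 * deriv l₁ t / l₁ t) • deriv Q t
      + coefB l₁ l₃ t • Q t = 0 := by
  have hode (s) (hs : s ∈ I) : deriv (deriv n) s =
      (deriv l₃ s / l₃ s - 3 * deriv l₁ s / l₁ s) • deriv n s - (1 / l₃ s) • n s := by
    have := ode s hs
    rw [sub_add, sub_eq_zero] at this
    exact this
  have dA (s) (hs : s ∈ I) : HasDerivAt (fun s => 1 / l₃ s) (-deriv l₃ s / l₃ s ^ 2) s := by
    simpa using (hasDerivAt_of_contDiffAt (h₃ s hs)).fun_inv (h₃n s hs)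
  have a1 (s) (hs : s ∈ I) : ip (deriv n s) (deriv Q s) = -deriv l₃ s / l₃ s ^ 2
      - (deriv l₃ s / l₃ s - 3 * deriv l₁ s / l₁ s) * (1 / l₃ s) := by
    have e := hasDerivAt_unique
      (hasDerivAt_ip (hasDerivAt_of_contDiffAt (contDiffAt_deriv (hn s hs)))
        (hasDerivAt_of_contDiffAt (h.smooth_Q s hs))) (dA s hs)
        (by filter_upwards [hI.mem_nhds hs] with r hr using hA r hr)
    rw [hode s hs, ip_sub_left, ip_smul_left, ip_smul_left, h.n_Q s hs, hA s hs] at e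
    linarith
  have d₁ := hasDerivAt_of_contDiffAt (h₁ t ht)
  have d₃ := hasDerivAt_of_contDiffAt (h₃ t ht)
  have d₁' := hasDerivAt_of_contDiffAt (contDiffAt_deriv (h₁ t ht))
  have d₃' := hasDerivAt_of_contDiffAt (contDiffAt_deriv (h₃ t ht))
  have dn := hasDerivAt_of_contDiffAt (hn t ht)
  have dn' := hasDerivAt_of_contDiffAt (contDiffAt_deriv (hn t ht))
  have dQ' := hasDerivAt_of_contDiffAt (contDiffAt_deriv (h.smooth_Q t ht))
  have n₁ := h₁n t ht
  have n₃ := h₃n t ht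
  have nQ := h.n_dQ ht
  have e1 := hasDerivAt_unique (hasDerivAt_ip dn dQ') (dA t ht).fun_neg
    (by filter_upwards [hI.mem_nhds ht] with r hr using (h.n_dQ hr).trans (by rw [hA r hr]))
  have e2 := hasDerivAt_unique (hasDerivAt_ip dn' dQ')
    ((d₃'.fun_neg.fun_div (d₃.fun_pow 2) (pow_ne_zero 2 n₃)).fun_sub
      (((d₃'.fun_div d₃ n₃).fun_sub ((d₁'.const_mul 3).fun_div d₁ n₁)).fun_mul (dA t ht)))
    (by filter_upwards [hI.mem_nhds ht] with r hr using a1 r hr)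
  rw [hode t ht, ip_sub_left, ip_smul_left, ip_smul_left, nQ, a1 t ht, hA t ht] at e2
  rw [a1 t ht] at e1
  apply h.eq_zero_of_act_pos ht
  · rw [act_add, act_add, act_smul, act_smul, h.act_ddQ t ht, h.act_dQ t ht, h.act_Q t ht]
    module
  · rw [ip_add_left, ip_add_left, ip_smul_left, ip_smul_left, ip_comm _ (n t), ip_comm _ (n t),
      ip_comm _ (n t), nQ, h.n_Q t ht, hA t ht, eq_sub_of_add_eq' e1]
    field_simp
    ring
  · rw [ip_add_left, ip_add_left, ip_smul_left, ip_smul_left, ip_comm _ (deriv n t),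
      ip_comm _ (deriv n t), ip_comm _ (deriv n t), a1 t ht, hA t ht,
      eq_sub_of_add_eq' e2, coefB]
    field_simp
    push_cast
    ring

end Equations

end Curves

/-! ### Integration of the equations in adapted coordinates -/

/-- Coordinates in which the equations are normalized. -/
structure IsNormalizedOn (X : Plane → E42) (G : Plane → Bivec) (φ : Plane → ℝ) (C : Bivec)
    (c : Plane) (δ : ℝ) (q n : ℝ → E42) : Prop where
  pos : 0 < δ
  ruled : IsRuledOn X G φ C (box c δ) q n
  eqs : ∀ u ∈ box c δ, ∃ g A k α, RuledEqs X φ C q n u g 1 (-u 0) A k α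

/-- The function `λ₃`. -/
noncomputable def lam3 (q n : ℝ → E42) (t : ℝ) : ℝ := (ip (deriv n t) (deriv q t))⁻¹

/-- The coefficient of `n` in `∂₀X`. -/
noncomputable def fCoef (X : Plane → E42) (q n : ℝ → E42) (w : Plane) : ℝ :=
  -(lam3 q n (w 1) * ip (pd 0 X w + lam3 q n (w 1) • deriv n (w 1)) (deriv (deriv q) (w 1)))

namespace IsNormalizedOn

variable {X : Plane → E42} {G : Plane → Bivec} {φ : Plane → ℝ} {C : Bivec} {c : Plane} {δ : ℝ}
  {q n : ℝ → E42} (h : IsNormalizedOn X G φ C c δ q n)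

include h

omit h in
theorem mem_pair {s t : ℝ} (hs : |s - c 0| < δ) (ht : t ∈ Set.Ioo (c 1 - δ) (c 1 + δ)) :
    (!₂[s, t] : Plane) ∈ box c δ :=
  ⟨by simpa using hs, by
    rw [abs_lt]
    exact ⟨by have := ht.1; simp; linarith, by have := ht.2; simp; linarith⟩⟩

theorem mem_pair' {t : ℝ} (ht : t ∈ Set.Ioo (c 1 - δ) (c 1 + δ)) :
    (!₂[c 0, t] : Plane) ∈ box c δ := mem_pair (by simpa using h.pos) ht

omit h in
theorem snd_mem {u : Plane} (hu : u ∈ box c δ) : u 1 ∈ Set.Ioo (c 1 - δ) (c 1 + δ) := by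
  have := abs_lt.1 hu.2
  exact ⟨by linarith, by linarith⟩

theorem isNullPair : IsNullPair C (Set.Ioo (c 1 - δ) (c 1 + δ)) n (deriv q) := by
  refine ⟨isOpen_Ioo, h.ruled.oneType.antisymm, ?_, ?_, ?_, ?_, ?_, ?_⟩ <;> intro t ht <;>
    have hu := h.mem_pair' ht <;> obtain ⟨g, A, k, α, e⟩ := h.eqs _ hu
  · exact h.ruled.smooth_n _ hu
  · exact contDiffAt_deriv (h.ruled.smooth_q _ hu)
  · exact e.act_n
  · exact e.act_dq
  · exact e.ip_n_dq
  · have := e.dn_dq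
    change ip (deriv n t) (deriv q t) = A at this
    rw [this]; exact e.A_ne

theorem smooth_n {t : ℝ} (ht : t ∈ Set.Ioo (c 1 - δ) (c 1 + δ)) : ContDiffAt ℝ ∞ n t :=
  h.isNullPair.smooth_n t ht

theorem smooth_dq {t : ℝ} (ht : t ∈ Set.Ioo (c 1 - δ) (c 1 + δ)) : ContDiffAt ℝ ∞ (deriv q) t :=
  h.isNullPair.smooth_Q t ht

theorem smooth_lam3 {t : ℝ} (ht : t ∈ Set.Ioo (c 1 - δ) (c 1 + δ)) :
    ContDiffAt ℝ ∞ (lam3 q n) t :=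
  (contDiffAt_ip' (contDiffAt_deriv (h.smooth_n ht)) (h.smooth_dq ht)).inv
    (h.isNullPair.dn_Q t ht)

theorem lam3_ne {t : ℝ} (ht : t ∈ Set.Ioo (c 1 - δ) (c 1 + δ)) : lam3 q n t ≠ 0 :=
  inv_ne_zero (h.isNullPair.dn_Q t ht)

omit h in
theorem dn_dq (t : ℝ) :
    ip (deriv n t) (deriv q t) = 1 / lam3 q n t := by rw [lam3, one_div, inv_inv]

variable {u : Plane} (hu : u ∈ box c δ)

include hu

theorem smooth_X : ContDiffAt ℝ ∞ X u := h.ruled.oneType.smooth_X u hu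

theorem smooth_fCoef : ContDiffAt ℝ ∞ (fCoef X q n) u := by
  have ht := snd_mem hu
  have hl := contDiffAt_comp_snd (h.smooth_lam3 ht)
  exact (hl.mul (contDiffAt_ip ((contDiffAt_pd 0 (h.smooth_X hu)).add
    (hl.smul (contDiffAt_comp_snd (contDiffAt_deriv (h.smooth_n ht)))))
    (contDiffAt_comp_snd (contDiffAt_deriv (h.smooth_dq ht))))).neg

/-- With ρ = 1 the equation n' = -A∂₀X + αn is solved for ∂₀X; thus λ₃ = 1/A and f = α/A. -/
theorem pd_zero_X : pd 0 X u = -lam3 q n (u 1) • deriv n (u 1) + fCoef X q n u • n (u 1) := by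
  obtain ⟨g, A, k, α, e⟩ := h.eqs u hu
  have hA := e.A_ne
  have hl : lam3 q n (u 1) = A⁻¹ := by rw [lam3, e.dn_dq]
  have h1 : pd 0 X u = -A⁻¹ • deriv n (u 1) + (A⁻¹ * α) • n (u 1) := by
    have e1 : A • pd 0 X u = -deriv n (u 1) + α • n (u 1) := by
      rw [e.dn, inv_one]; module
    have := congrArg (fun w => A⁻¹ • w) e1
    simp only [smul_smul, inv_mul_cancel₀ hA, one_smul] at this
    rw [this]; module
  have h2 : fCoef X q n u = A⁻¹ * α := by
    have h3 : pd 0 X u + lam3 q n (u 1) • deriv n (u 1) = (A⁻¹ * α) • n (u 1) := by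
      rw [h1, hl]; module
    rw [fCoef, h3, ip_smul_left, h.ruled.ip_n_ddq hu, hl, e.dn_dq]
    field_simp
  rw [h2, hl]; exact h1

/-- From ∂₀X = -λ₃n' + fn one gets ∂₀∂₀X = (∂₀f)n, so k = ∂₀f. With R = -s and φ = -4Ak, the
relation φR = -2α becomes α = -2Aks, that is f = -2s∂₀f. -/
theorem fCoef_eqs : fCoef X q n u = -2 * u 0 * pd 0 (fCoef X q n) u ∧
    φ u = -4 * (lam3 q n (u 1))⁻¹ * pd 0 (fCoef X q n) u := by
  obtain ⟨g, A, k, α, e⟩ := h.eqs u hu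
  have hA := e.A_ne
  have ht := snd_mem hu
  have hl : lam3 q n (u 1) = A⁻¹ := by rw [lam3, e.dn_dq]
  have hd : HasPd 0 (pd 0 X) (pd 0 (fCoef X q n) u • n (u 1)) u := by
    have hev : pd 0 X =ᶠ[nhds u] fun w =>
        -lam3 q n (w 1) • deriv n (w 1) + fCoef X q n w • n (w 1) := by
      filter_upwards [(isOpen_box c δ).mem_nhds hu] with w hw using h.pd_zero_X hw
    refine HasPd.of_eq (((((hasPd_comp_snd 0 (hasDerivAt_of_contDiffAt (h.smooth_lam3 ht))).neg.smul
      (h.ruled.hasPd_dn hu 0)).add (((h.smooth_fCoef hu).hasPd 0).smul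
      (h.ruled.hasPd_n hu 0))).congr hev)) ?_
    simp
  have hk : pd 0 (fCoef X q n) u = k := by
    have h1 := e.nor_00
    rw [hd.2] at h1
    have hsm (c : ℝ) (w : E42) : nor X u (c • w) = c • nor X u w := by
      simp only [nor_eq_tanOp, tanOp_smul]; module
    rw [hsm, nor_eq_tanOp, tanOp_of_normal X e.n_pd, sub_zero, one_pow, one_mul] at h1
    exact smul_left_injective ℝ e.n_ne h1
  have hf : fCoef X q n u = A⁻¹ * α := by
    have h1 := h.pd_zero_X hu
    have h2 : A • pd 0 X u = -deriv n (u 1) + α • n (u 1) := by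
      rw [e.dn, inv_one]; module
    rw [h1, hl, smul_add, smul_smul, smul_smul, mul_neg, mul_inv_cancel₀ hA] at h2
    have h3 := add_left_cancel (h2.trans (by rw [neg_one_smul]))
    have := smul_left_injective ℝ e.n_ne h3
    rw [← this]; field_simp
  have h4 := e.phi_R
  rw [e.phi_eq] at h4
  refine ⟨?_, ?_⟩
  · rw [hf, hk, show α = -2 * A * k * u 0 by linarith]; field_simp
  · rw [e.phi_eq, hk, hl, inv_inv]; ring

/-- By f = -2s∂₀f the function sf² is constant along each line t = const. If such a line met s = 0
this constant would be 0, so at a point of the line with s ≠ 0 both f and ∂₀f, hence φ, would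
vanish. -/
theorem fst_ne_zero : u 0 ≠ 0 := by
  intro h0
  obtain ⟨s, hs, hs0⟩ : ∃ s, |s - c 0| < δ ∧ s ≠ 0 := by
    by_cases hc : c 0 = 0
    · refine ⟨δ / 2, ?_, by have := h.pos; positivity⟩
      rw [hc, sub_zero, abs_of_pos (by have := h.pos; positivity)]
      linarith [h.pos]
    · exact ⟨c 0, by simpa using h.pos, hc⟩
  have hv := mem_pair hs (snd_mem hu)
  have hconst : (fun w : Plane => w 0 * (fCoef X q n w * fCoef X q n w)) u =
      (fun w : Plane => w 0 * (fCoef X q n w * fCoef X q n w)) !₂[s, u 1] := by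
    refine eq_of_pd_zero (c := c) (δ := δ)
      (f := fun w : Plane => w 0 * (fCoef X q n w * fCoef X q n w)) (fun w hw => ?_) hu hv rfl
    have hf := (h.smooth_fCoef hw).hasPd 0
    have hm := (hasPd_coord 0 0 w).mul (hf.mul hf)
    refine hm.of_eq ?_
    obtain ⟨h1, -⟩ := h.fCoef_eqs hw
    simp only [if_true]
    linear_combination fCoef X q n w * h1
  obtain ⟨h1, h2⟩ := h.fCoef_eqs hv
  have hf : fCoef X q n !₂[s, u 1] = 0 := by
    simp only [h0, zero_mul] at hconst
    have := hconst.symm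
    simpa [hs0] using this
  rw [hf] at h1
  have hk : pd 0 (fCoef X q n) !₂[s, u 1] = 0 := by
    have := h1.symm
    simpa [hs0] using this
  rw [hk, mul_zero] at h2
  exact h.ruled.oneType.phi_ne _ hv h2

omit hu in
-- The first coordinate never vanishes on the box, whose horizontal sections are intervals, so its
-- sign σ is that at the centre.
theorem exists_sign : ∃ σ : ℝ, σ * σ = 1 ∧ ∀ u ∈ box c δ, 0 < σ * u 0 := by
  have hc : c ∈ box c δ := ⟨by simpa using h.pos, by simpa using h.pos⟩
  have key (σ : ℝ) (hσ : σ * σ = 1) (hc0 : 0 < σ * c 0) : ∀ u ∈ box c δ, 0 < σ * u 0 := by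
    intro u hu
    by_contra hneg
    have h1 := hu.1
    have hab : |σ| = 1 := by
      have := abs_mul_abs_self σ
      rw [hσ] at this
      nlinarith [abs_nonneg σ]
    have h2 : |(0 : ℝ) - c 0| < δ := by
      refine lt_of_le_of_lt ?_ h1
      have e1 : |u 0 - c 0| = |σ * u 0 - σ * c 0| := by
        rw [← mul_sub, abs_mul, hab, one_mul]
      have e2 : |0 - c 0| = |σ * c 0| := by rw [abs_mul, hab, one_mul, zero_sub, abs_neg]
      rw [e1, e2, abs_of_pos hc0]
      refine le_trans ?_ (neg_le_abs _)
      linarith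
    exact h.fst_ne_zero (mem_pair h2 (snd_mem hu)) rfl
  rcases lt_or_gt_of_ne (h.fst_ne_zero hc) with h0 | h0
  · exact ⟨-1, by norm_num, key _ (by norm_num) (by linarith)⟩
  · exact ⟨1, by norm_num, key _ (by norm_num) (by linarith)⟩

end IsNormalizedOn

/-- The square root of the first coordinate. -/
noncomputable def sqrtCoord (σ : ℝ) (u : Plane) : ℝ := √(σ * u 0)

/-- The function `κ` with `∂₀X = -λ₃ n' + (σ κ / (2 √(σ s))) n`. -/
noncomputable def kap (X : Plane → E42) (q n : ℝ → E42) (σ c₀ : ℝ) (t : ℝ) : ℝ :=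
  2 * σ * sqrtCoord σ !₂[c₀, t] * fCoef X q n !₂[c₀, t]

/-- The curve `ξ`. -/
noncomputable def xiCurve (X : Plane → E42) (q n : ℝ → E42) (σ c₀ : ℝ) (t : ℝ) : E42 :=
  X !₂[c₀, t] + (c₀ * lam3 q n t) • deriv n t
    - (kap X q n σ c₀ t * sqrtCoord σ !₂[c₀, t]) • n t

namespace IsNormalizedOn

variable {X : Plane → E42} {G : Plane → Bivec} {φ : Plane → ℝ} {C : Bivec} {c : Plane} {δ : ℝ}
  {q n : ℝ → E42} (h : IsNormalizedOn X G φ C c δ q n) {σ : ℝ} (hσ : σ * σ = 1)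
  (hpos : ∀ u ∈ box c δ, 0 < σ * u 0)

include h hσ hpos

omit h hσ in
theorem sqrtCoord_pos {u : Plane} (hu : u ∈ box c δ) : 0 < sqrtCoord σ u :=
  Real.sqrt_pos.2 (hpos u hu)

omit h in
theorem sqrtCoord_sq {u : Plane} (hu : u ∈ box c δ) :
    u 0 = σ * sqrtCoord σ u ^ 2 := by
  rw [sqrtCoord, Real.sq_sqrt (hpos u hu).le, ← mul_assoc, hσ, one_mul]

omit h hσ in
theorem hasPd_sqrtCoord {u : Plane} (hu : u ∈ box c δ) :
    HasPd 0 (sqrtCoord σ) (σ / (2 * sqrtCoord σ u)) u ∧ HasPd 1 (sqrtCoord σ) 0 u := by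
  have hs (i : Fin 2) : HasPd i (fun w : Plane => σ * w 0) _ u :=
    (hasPd_const σ).mul (hasPd_coord i 0 u)
  have hne := (hpos u hu).ne'
  have key (i : Fin 2) {d : ℝ} (hd : HasPd i (fun w : Plane => σ * w 0) d u) :
      HasPd i (sqrtCoord σ) (d / (2 * sqrtCoord σ u)) u := by
    have hf := hd.1.hasFDerivAt.sqrt hne
    refine ⟨hf.differentiableAt, ?_⟩
    change fderiv ℝ (fun w : Plane => √(σ * w 0)) u _ = _
    rw [hf.fderiv]
    have := hd.2
    simp only [pd] at this
    simp only [smul_apply, smul_eq_mul, this, sqrtCoord]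
    ring
  exact ⟨(key 0 (hs 0)).of_eq (by simp), (key 1 (hs 1)).of_eq (by simp)⟩

/-- The equation f = -2s∂₀f says that f√(σs) is independent of s. -/
theorem kap_eq {u : Plane} (hu : u ∈ box c δ) :
    kap X q n σ (c 0) (u 1) = 2 * σ * sqrtCoord σ u * fCoef X q n u := by
  refine eq_of_pd_zero (c := c) (δ := δ) (f := fun w => 2 * σ * sqrtCoord σ w * fCoef X q n w)
    (fun w hw => ?_) (h.mem_pair' (snd_mem hu)) hu rfl
  refine HasPd.of_eq ((((hasPd_const (2 * σ)).mul (hasPd_sqrtCoord hpos hw).1)).mul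
    ((h.smooth_fCoef hw).hasPd 0)) ?_
  obtain ⟨h1, -⟩ := h.fCoef_eqs hw
  have hτ := (sqrtCoord_pos hpos hw).ne'
  rw [sqrtCoord_sq hσ hpos hw] at h1
  field_simp
  linear_combination h1 + (fCoef X q n w) * hσ

theorem fCoef_eq {u : Plane} (hu : u ∈ box c δ) :
    fCoef X q n u = σ * kap X q n σ (c 0) (u 1) / (2 * sqrtCoord σ u) := by
  have hτ := (sqrtCoord_pos hpos hu).ne'
  rw [h.kap_eq hσ hpos hu]
  field_simp
  linear_combination (-fCoef X q n u) * hσ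

omit hσ hpos in
theorem smooth_kap {t : ℝ} (ht : t ∈ Set.Ioo (c 1 - δ) (c 1 + δ)) :
    ContDiffAt ℝ ∞ (kap X q n σ (c 0)) t := by
  have hu := h.mem_pair' ht
  have hf : ContDiffAt ℝ ∞ (fun t => fCoef X q n !₂[c 0, t]) t :=
    ContDiffAt.comp (g := fCoef X q n) t (h.smooth_fCoef hu) (contDiff_pair (c 0)).contDiffAt
  exact (contDiffAt_const (c := 2 * σ * √(σ * c 0))).mul hf

omit hσ hpos in
theorem smooth_xi {t : ℝ} (ht : t ∈ Set.Ioo (c 1 - δ) (c 1 + δ)) :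
    ContDiffAt ℝ ∞ (xiCurve X q n σ (c 0)) t := by
  have hu := h.mem_pair' ht
  have hf : ContDiffAt ℝ ∞ (fun t => X !₂[c 0, t]) t :=
    (h.smooth_X hu).comp t (contDiff_pair (c 0)).contDiffAt
  exact (hf.add ((contDiffAt_const.mul (h.smooth_lam3 ht)).smul
    (contDiffAt_deriv (h.smooth_n ht)))).sub (((h.smooth_kap ht).mul
    (contDiffAt_const (c := √(σ * c 0)))).smul (h.smooth_n ht))

/-- Integration of ∂₀X = -λ₃n' + σκ/(2√(σs)) n in s; the curve ξ is the constant of integration. -/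
theorem X_eq {u : Plane} (hu : u ∈ box c δ) :
    X u = -(u 0 * lam3 q n (u 1)) • deriv n (u 1)
      + (kap X q n σ (c 0) (u 1) * sqrtCoord σ u) • n (u 1) + xiCurve X q n σ (c 0) (u 1) := by
  have hW : xiCurve X q n σ (c 0) (u 1) = X u + (u 0 * lam3 q n (u 1)) • deriv n (u 1)
      - (kap X q n σ (c 0) (u 1) * sqrtCoord σ u) • n (u 1) := by
    refine eq_of_pd_zero (c := c) (δ := δ) (f := fun w : Plane =>
      X w + (w 0 * lam3 q n (w 1)) • deriv n (w 1)
      - (kap X q n σ (c 0) (w 1) * sqrtCoord σ w) • n (w 1)) (fun w hw => ?_)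
      (h.mem_pair' (snd_mem hu)) hu rfl
    have ht := snd_mem hw
    have hm := (((h.smooth_X hw).hasPd 0).add (((hasPd_coord 0 0 w).mul
      (hasPd_comp_snd 0 (hasDerivAt_of_contDiffAt (h.smooth_lam3 ht)))).smul
      (h.ruled.hasPd_dn hw 0))).sub (((hasPd_comp_snd 0 (hasDerivAt_of_contDiffAt
      (h.smooth_kap (σ := σ) ht))).mul (hasPd_sqrtCoord hpos hw).1).smul (h.ruled.hasPd_n hw 0))
    refine hm.of_eq ?_
    have hτ := (sqrtCoord_pos hpos hw).ne'
    rw [h.pd_zero_X hw, h.fCoef_eq hσ hpos hw]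
    simp only [one_ne_zero, if_false, zero_smul, smul_zero, if_true, one_mul, mul_zero, add_zero,
      zero_mul, zero_add]
    rw [show kap X q n σ (c 0) (w 1) * (σ / (2 * sqrtCoord σ w))
      = σ * kap X q n σ (c 0) (w 1) / (2 * sqrtCoord σ w) by ring]
    module
  rw [hW]; module

/-- The equations along the curve `ξ`. -/
theorem curve_eqs {t : ℝ} (ht : t ∈ Set.Ioo (c 1 - δ) (c 1 + δ)) : ∃ p : ℝ,
    deriv (deriv n) t = p • deriv n t - (1 / lam3 q n t) • n t ∧
    deriv (kap X q n σ (c 0)) t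
      = (deriv (lam3 q n) t / lam3 q n t + p) * kap X q n σ (c 0) t / 2 ∧
    deriv (xiCurve X q n σ (c 0)) t = deriv q t
      - (σ * kap X q n σ (c 0) t ^ 2 / (2 * lam3 q n t)) • n t := by
  have np := h.isNullPair
  have hl := h.lam3_ne ht
  obtain ⟨r, hr⟩ := np.exists_expand_neg ht (np.act_ddn t ht)
  generalize (ip (deriv n t) (deriv q t))⁻¹ * ip (deriv (deriv n) t) (deriv q t) = p at hr
  set κ := kap X q n σ (c 0) with hκ
  set l := lam3 q n with hlam
  set ξ := xiCurve X q n σ (c 0) with hξ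
  -- Subtract q' = ∂₁X + g∂₀X - sn from the t-derivative of the integrated formula, with n'' = pn' +
  -- rn. The coefficient g depends on s in an unknown way and is eliminated below.
  have hX {u : Plane} (hu : u ∈ box c δ) (hut : u 1 = t) : ∃ g : ℝ, deriv ξ t - deriv q t =
      (g * l t + u 0 * deriv l t + u 0 * l t * p - κ t * sqrtCoord σ u) • deriv n t
      + (-(g * fCoef X q n u) + u 0 + u 0 * l t * r - deriv κ t * sqrtCoord σ u) • n t := by
    obtain ⟨g, A, k, α, e⟩ := h.eqs u hu
    subst hut
    have hev : X =ᶠ[nhds u] fun w : Plane => -(w 0 * l (w 1)) • deriv n (w 1)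
        + (κ (w 1) * sqrtCoord σ w) • n (w 1) + ξ (w 1) := by
      filter_upwards [(isOpen_box c δ).mem_nhds hu] with w hw using h.X_eq hσ hpos hw
    have hm := ((((((hasPd_coord 1 0 u).mul
      (hasPd_comp_snd 1 (hasDerivAt_of_contDiffAt (h.smooth_lam3 ht)))).neg).smul
      (h.ruled.hasPd_dn hu 1)).add (((hasPd_comp_snd 1 (hasDerivAt_of_contDiffAt
      (h.smooth_kap ht))).mul (hasPd_sqrtCoord hpos hu).2).smul (h.ruled.hasPd_n hu 1))).add
      (hasPd_comp_snd 1 (hasDerivAt_of_contDiffAt (h.smooth_xi ht)))).congr hev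
    have h1 := hm.2
    simp only [zero_ne_one, if_false, if_true, one_smul, zero_mul, zero_add, smul_eq_mul, one_mul,
      mul_zero, add_zero, ← hlam, ← hκ, ← hξ, hr] at h1
    refine ⟨g, ?_⟩
    rw [e.dq, h1, h.pd_zero_X hu, ← hlam]
    module
  have hA := np.dn_Q t ht
  obtain ⟨g₀, hg₀⟩ := hX (h.mem_pair' ht) rfl
  -- a and b are evaluated on the central line, but ξ' - q' does not depend on s, so they are the
  -- coefficients for every s.
  obtain ⟨a, ha⟩ : ∃ a, a = g₀ * l t + c 0 * deriv l t + c 0 * l t * p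
    - κ t * sqrtCoord σ !₂[c 0, t] := ⟨_, rfl⟩
  obtain ⟨b, hb⟩ : ∃ b, b = -(g₀ * fCoef X q n !₂[c 0, t]) + c 0 + c 0 * l t * r
    - deriv κ t * sqrtCoord σ !₂[c 0, t] := ⟨_, rfl⟩
  have hab : deriv ξ t - deriv q t = a • deriv n t + b • n t := by rw [ha, hb]; exact hg₀
  -- the resulting polynomial identity in `√(σ s)`
  let S : Set ℝ := (fun s => √(σ * s)) '' Metric.ball (c 0) δ
  have hS : S.Infinite := by
    refine Set.Infinite.image ?_ ?_
    · intro s hs s' hs' hss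
      have h1 := hpos _ (mem_pair (c := c) (s := s) (by simpa [Real.dist_eq] using hs) ht)
      have h2 := hpos _ (mem_pair (c := c) (s := s') (by simpa [Real.dist_eq] using hs') ht)
      have h3 := (Real.sqrt_inj (le_of_lt h1) (le_of_lt h2)).1 hss
      simp only [Matrix.cons_val_zero] at h3
      have hσ0 : σ ≠ 0 := by rintro rfl; simp at hσ
      exact mul_left_cancel₀ hσ0 h3
    · rw [Real.ball_eq_Ioo]
      exact Set.Ioo_infinite (by linarith [h.pos])
  have hpoly : ∀ τ ∈ S, (2 * l t * σ * (1 + l t * r)) * τ ^ 3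
      + (l t * ((deriv l t / l t + p) * κ t - 2 * deriv κ t)) * τ ^ 2
      + (-(2 * l t * b) - σ * κ t ^ 2) * τ + (-(σ * κ t * a)) = 0 := by
    rintro _ ⟨s, hs, rfl⟩
    have hu := mem_pair (c := c) (s := s) (by simpa [Real.dist_eq] using hs) ht
    obtain ⟨g, hg⟩ := hX hu rfl
    rw [hab] at hg
    obtain ⟨e1, e2⟩ := np.coeff_unique ht hg
    have hτ := (sqrtCoord_pos hpos hu).ne'
    have hs2 := sqrtCoord_sq hσ hpos hu
    rw [h.fCoef_eq hσ hpos hu, hs2] at e2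
    rw [hs2] at e1
    change (2 * l t * σ * (1 + l t * r)) * sqrtCoord σ !₂[s, t] ^ 3
      + (l t * ((deriv l t / l t + p) * κ t - 2 * deriv κ t)) * sqrtCoord σ !₂[s, t] ^ 2
      + (-(2 * l t * b) - σ * κ t ^ 2) * sqrtCoord σ !₂[s, t] + (-(σ * κ t * a)) = 0
    change b = -(g * (σ * κ t / (2 * sqrtCoord σ !₂[s, t])))
      + σ * sqrtCoord σ !₂[s, t] ^ 2 + σ * sqrtCoord σ !₂[s, t] ^ 2 * l t * r
      - deriv κ t * sqrtCoord σ !₂[s, t] at e2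
    generalize sqrtCoord σ !₂[s, t] = τ at *
    have e2' : 2 * τ * b = -(g * (σ * κ t)) + 2 * σ * τ ^ 3 + 2 * σ * τ ^ 3 * l t * r
        - 2 * deriv κ t * τ ^ 2 := by
      rw [e2]; field_simp
    have e3 : l t * (deriv l t / l t) = deriv l t := by field_simp
    -- With f = σκ/(2τ) and s = στ², the n'-equation determines g λ₃, and substitution into the
    -- n-equation multiplied by 2τλ₃ removes g.
    linear_combination (-(l t)) * e2' - σ * κ t * e1 + τ ^ 2 * κ t * e3
      - (τ ^ 2 * κ t * (deriv l t + l t * p)) * hσ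
  obtain ⟨k1, k2, k3, k4⟩ := cubic_eq_zero hS hpoly
  have hσ0 : σ ≠ 0 := by rintro rfl; simp at hσ
  have hκ0 : κ t ≠ 0 := by
    intro h0
    have hu := h.mem_pair' ht
    have hf := h.fCoef_eq hσ hpos hu
    change _ = σ * κ t / _ at hf
    rw [h0, mul_zero, zero_div] at hf
    obtain ⟨h1, h2⟩ := h.fCoef_eqs hu
    rw [hf] at h1
    have hk : pd 0 (fCoef X q n) !₂[c 0, t] = 0 := by
      have := h1.symm
      have h0' : (!₂[c 0, t] : Plane) 0 ≠ 0 := h.fst_ne_zero hu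
      change c 0 ≠ 0 at h0'
      simpa [h0'] using this
    rw [hk, mul_zero] at h2
    exact h.ruled.oneType.phi_ne _ hu h2
  have ha0 : a = 0 := by simpa [hσ0, hκ0] using k4
  have hr0 : r = -(1 / l t) := by
    have : 1 + l t * r = 0 := by simpa [hσ0, hl] using k1
    field_simp; linarith
  have hκ' : (deriv l t / l t + p) * κ t - 2 * deriv κ t = 0 := by simpa [hl] using k2
  have hb0 : b = -(σ * κ t ^ 2 / (2 * l t)) := by field_simp; linarith
  refine ⟨p, ?_, by linarith, ?_⟩
  · rw [hr, hr0]; module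
  · rw [ha0, hb0, sub_eq_iff_eq_add] at hab
    rw [hab]; module

/-- Here φ = κ/(λ₃(σs)^(3/2)), so λ₃/κ has the sign of φ. This positivity permits the smooth cube
root that defines λ₁. -/
theorem kap_pos {ε : ℝ} (hφ : ∀ u ∈ box c δ, ε * φ u < 0) {t : ℝ}
    (ht : t ∈ Set.Ioo (c 1 - δ) (c 1 + δ)) :
    0 < -ε * (lam3 q n t / kap X q n σ (c 0) t) := by
  have hu := h.mem_pair' ht
  have hf := h.fCoef_eq hσ hpos hu
  have hτ := sqrtCoord_pos hpos hu
  have hs := sqrtCoord_sq hσ hpos hu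
  obtain ⟨h1, h2⟩ := h.fCoef_eqs hu
  have h3 := hφ _ hu
  have hl := h.lam3_ne ht
  change _ = σ * kap X q n σ (c 0) t / _ at hf
  change _ = -4 * (lam3 q n t)⁻¹ * _ at h2
  rw [hs] at h1
  generalize sqrtCoord σ !₂[c 0, t] = τ at *
  generalize pd 0 (fCoef X q n) !₂[c 0, t] = k at *
  generalize kap X q n σ (c 0) t = κ at *
  generalize lam3 q n t = l at *
  have hσ0 : σ ≠ 0 := by rintro rfl; simp at hσ
  have hk : κ = -4 * τ ^ 3 * k := by
    rw [hf] at h1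
    field_simp at h1
    linear_combination h1
  have hφ' : φ !₂[c 0, t] = κ / (l * τ ^ 3) := by
    rw [h2, hk]; field_simp
  rw [hφ'] at h3
  have hκ0 : κ ≠ 0 := by rintro rfl; simp at h3
  have e : -ε * (l / κ) = -(ε * (κ / (l * τ ^ 3))) * ((l / κ) ^ 2 * τ ^ 3) := by field_simp
  rw [e]
  exact mul_pos (by linarith) (by positivity)

/-- In normalized coordinates the surface is given by the model. -/
theorem exists_model_of_sign {ε : ℝ} (hε : ε * ε = 1) (hφ : ∀ u ∈ box c δ, ε * φ u < 0) :
    ∃ (l₁ l₃ : ℝ → ℝ) (ξ : ℝ → E42), IsAdmissible (c 1 - δ) (c 1 + δ) l₁ l₃ n ξ ∧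
      ∀ u ∈ box c δ, 0 < -(u 0 * l₁ (u 1)) ∧ X u = modelMap ε l₁ l₃ n ξ (u 0) (u 1) := by
  have np := h.isNullPair
  obtain ⟨l, hl⟩ : ∃ l, l = lam3 q n := ⟨_, rfl⟩
  obtain ⟨κ, hκ⟩ : ∃ κ, κ = kap X q n σ (c 0) := ⟨_, rfl⟩
  obtain ⟨ξ, hξ⟩ : ∃ ξ, ξ = xiCurve X q n σ (c 0) := ⟨_, rfl⟩
  have hlS : ∀ t ∈ Set.Ioo (c 1 - δ) (c 1 + δ), ContDiffAt ℝ ∞ l t := fun t ht => by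
    rw [hl]; exact h.smooth_lam3 ht
  have hκS : ∀ t ∈ Set.Ioo (c 1 - δ) (c 1 + δ), ContDiffAt ℝ ∞ κ t := fun t ht => by
    rw [hκ]; exact h.smooth_kap ht
  have hξS : ∀ t ∈ Set.Ioo (c 1 - δ) (c 1 + δ), ContDiffAt ℝ ∞ ξ t := fun t ht => by
    rw [hξ]; exact h.smooth_xi ht
  have hlne : ∀ t ∈ Set.Ioo (c 1 - δ) (c 1 + δ), l t ≠ 0 := fun t ht => by
    rw [hl]; exact h.lam3_ne ht
  have hA : ∀ t ∈ Set.Ioo (c 1 - δ) (c 1 + δ), ip (deriv n t) (deriv q t) = 1 / l t :=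
    fun t ht => by rw [hl]; exact dn_dq t
  have hpos' : ∀ t ∈ Set.Ioo (c 1 - δ) (c 1 + δ), 0 < -ε * (l t / κ t) := fun t ht => by
    rw [hl, hκ]; exact h.kap_pos hσ hpos hφ ht
  have hκne : ∀ t ∈ Set.Ioo (c 1 - δ) (c 1 + δ), κ t ≠ 0 := fun t ht h0 => by
    have := hpos' t ht
    rw [h0] at this; simp at this
  have hcurve : ∀ t ∈ Set.Ioo (c 1 - δ) (c 1 + δ), ∃ p : ℝ,
      deriv (deriv n) t = p • deriv n t - (1 / l t) • n t ∧
      deriv κ t = (deriv l t / l t + p) * κ t / 2 ∧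
      deriv ξ t = deriv q t - (σ * κ t ^ 2 / (2 * l t)) • n t := fun t ht => by
    rw [hl, hκ, hξ]; exact h.curve_eqs hσ hpos ht
  have h6 : √6 * √6 = (6 : ℝ) := Real.mul_self_sqrt (by norm_num)
  have h6p : 0 < √6 := Real.sqrt_pos.2 (by norm_num)
  -- Put λ₁ = -σm² with m > 0, so that √(-sλ₁) = √(σs)·m. The coefficient of n in the model equals
  -- κ√(σs) exactly when m³κ = -3√6 ελ₃, which is how m is chosen.
  obtain ⟨m, hm⟩ : ∃ m : ℝ → ℝ, m = fun t => (3 * √6 * (-ε * (l t / κ t))) ^ (1 / 3 : ℝ) := ⟨_, rfl⟩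
  have hBpos : ∀ t ∈ Set.Ioo (c 1 - δ) (c 1 + δ), 0 < 3 * √6 * (-ε * (l t / κ t)) := fun t ht =>
    mul_pos (by positivity) (hpos' t ht)
  have hmpos : ∀ t ∈ Set.Ioo (c 1 - δ) (c 1 + δ), 0 < m t := fun t ht => by
    rw [hm]; exact Real.rpow_pos_of_pos (hBpos t ht) _
  have hm3 : ∀ t ∈ Set.Ioo (c 1 - δ) (c 1 + δ), m t ^ 3 * κ t = -ε * (3 * √6) * l t :=
      fun t ht => by
    have : m t ^ 3 = 3 * √6 * (-ε * (l t / κ t)) := by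
      rw [hm]
      simp only
      rw [← Real.rpow_natCast, ← Real.rpow_mul (hBpos t ht).le]
      norm_num
    rw [this]
    have := hκne t ht
    field_simp
  have hmS : ∀ t ∈ Set.Ioo (c 1 - δ) (c 1 + δ), ContDiffAt ℝ ∞ m t := fun t ht => by
    rw [hm]
    exact ContDiffAt.rpow_const_of_ne (contDiffAt_const.mul (contDiffAt_const.mul
      ((hlS t ht).div (hκS t ht) (hκne t ht)))) (hBpos t ht).ne'
  have hσ0 : σ ≠ 0 := by rintro rfl; simp at hσ
  obtain ⟨l₁, hl₁⟩ : ∃ l₁ : ℝ → ℝ, l₁ = fun t => -σ * m t ^ 2 := ⟨_, rfl⟩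
  have hl₁S : ∀ t ∈ Set.Ioo (c 1 - δ) (c 1 + δ), ContDiffAt ℝ ∞ l₁ t := fun t ht => by
    rw [hl₁]; exact contDiffAt_const.mul ((hmS t ht).pow 2)
  have hl₁ne : ∀ t ∈ Set.Ioo (c 1 - δ) (c 1 + δ), l₁ t ≠ 0 := fun t ht => by
    rw [hl₁]; exact mul_ne_zero (neg_ne_zero.2 hσ0) (pow_ne_zero 2 (hmpos t ht).ne')
  have hdl₁ : ∀ t ∈ Set.Ioo (c 1 - δ) (c 1 + δ), deriv l₁ t = -σ * (2 * m t * deriv m t) :=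
      fun t ht => by
    have := ((hasDerivAt_of_contDiffAt (hmS t ht)).fun_pow 2).const_mul (-σ)
    rw [hl₁, this.deriv]; simp
  have hp : ∀ t ∈ Set.Ioo (c 1 - δ) (c 1 + δ), deriv (deriv n) t
      - (deriv l t / l t - 3 * deriv l₁ t / l₁ t) • deriv n t + (1 / l t) • n t = 0 := fun t ht => by
    obtain ⟨p, e1, e2, -⟩ := hcurve t ht
    have hder := hasDerivAt_unique (((hasDerivAt_of_contDiffAt (hmS t ht)).fun_pow 3).fun_mul
      (hasDerivAt_of_contDiffAt (hκS t ht))) ((hasDerivAt_of_contDiffAt (hlS t ht)).const_mul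
      (-ε * (3 * √6))) (by filter_upwards [isOpen_Ioo.mem_nhds ht] with s hs using hm3 s hs)
    have hm0 := (hmpos t ht).ne'
    have hκ0 := hκne t ht
    have hl0 := hlne t ht
    -- The logarithmic derivative of m³κ = const·λ₃, combined with 2κ'/κ = λ₃'/λ₃ + p and λ₁'/λ₁ =
    -- 2m'/m.
    have e3 : p = deriv l t / l t - 3 * deriv l₁ t / l₁ t := by
      have e4 : 3 * deriv l₁ t / l₁ t = 6 * deriv m t / m t := by
        rw [hdl₁ t ht, hl₁]; field_simp; ring
      rw [e4]
      push_cast at hder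
      rw [e2] at hder
      have e5 : 3 * m t ^ 2 * deriv m t * κ t + m t ^ 3 * ((deriv l t / l t + p) * κ t / 2)
          = m t ^ 3 * κ t * (deriv l t / l t) := by
        rw [hm3 t ht]
        have : -ε * (3 * √6) * l t * (deriv l t / l t) = -ε * (3 * √6) * deriv l t := by field_simp
        rw [this, ← hder]
      have hne : m t ^ 3 * κ t ≠ 0 := mul_ne_zero (pow_ne_zero 3 hm0) hκ0
      apply mul_left_cancel₀ hne
      have e6 : m t ^ 3 * κ t * (6 * deriv m t / m t) = 6 * m t ^ 2 * deriv m t * κ t := by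
        field_simp
      rw [mul_sub, e6]
      linear_combination 2 * e5
    rw [e1, ← e3]; module
  have hdξ : ∀ t ∈ Set.Ioo (c 1 - δ) (c 1 + δ), deriv ξ t = deriv q t + coefC l₁ l t • n t :=
      fun t ht => by
    obtain ⟨p, -, -, e⟩ := hcurve t ht
    have hm0 := (hmpos t ht).ne'
    have hl0 := hlne t ht
    -- Squaring m³κ = -3√6 ελ₃ gives κ²m⁶ = 54λ₃², and λ₁³ = -σm⁶, whence the constant 27.
    have e1 : coefC l₁ l t = -(σ * κ t ^ 2 / (2 * l t)) := by
      have e2 : (m t ^ 3 * κ t) ^ 2 = 54 * l t ^ 2 := by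
        rw [hm3 t ht]
        linear_combination (9 * l t ^ 2 * (ε * ε)) * h6 + 54 * l t ^ 2 * hε
      rw [coefC, hl₁]
      field_simp
      linear_combination (σ * σ * (σ * σ)) * e2 + (54 * l t ^ 2 * (σ * σ + 1)) * hσ
    rw [e, e1]; module
  have hcn : ∀ t ∈ Set.Ioo (c 1 - δ) (c 1 + δ), HasDerivAt (fun s => coefC l₁ l s • n s)
      (deriv (fun s => coefC l₁ l s • n s) t) t := fun t ht =>
    (hasDerivAt_coefC_smul hl₁S hlS hl₁ne (fun t ht => h.smooth_n ht) ht).differentiableAt.hasDerivAt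
  have hcnS : ∀ t ∈ Set.Ioo (c 1 - δ) (c 1 + δ),
      ContDiffAt ℝ ∞ (fun s => coefC l₁ l s • n s) t := fun t ht =>
    (((contDiffAt_const.mul (hlS t ht)).div ((hl₁S t ht).pow 3)
      (pow_ne_zero 3 (hl₁ne t ht))).smul (h.smooth_n ht))
  have hddξ : ∀ t ∈ Set.Ioo (c 1 - δ) (c 1 + δ), deriv (deriv ξ) t
      = deriv (deriv q) t + deriv (fun s => coefC l₁ l s • n s) t := fun t ht =>
    hasDerivAt_unique (hasDerivAt_of_contDiffAt (contDiffAt_deriv (hξS t ht)))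
      ((hasDerivAt_of_contDiffAt (h.smooth_dq ht)).fun_add (hcn t ht))
      (by filter_upwards [isOpen_Ioo.mem_nhds ht] with s hs using hdξ s hs)
  have hdddξ : ∀ t ∈ Set.Ioo (c 1 - δ) (c 1 + δ), deriv (deriv (deriv ξ)) t
      = deriv (deriv (deriv q)) t + deriv (deriv fun s => coefC l₁ l s • n s) t := fun t ht =>
    hasDerivAt_unique
      (hasDerivAt_of_contDiffAt (contDiffAt_deriv (contDiffAt_deriv (hξS t ht))))
      ((hasDerivAt_of_contDiffAt (contDiffAt_deriv (h.smooth_dq ht))).fun_add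
        (hasDerivAt_of_contDiffAt (contDiffAt_deriv (hcnS t ht))))
      (by filter_upwards [isOpen_Ioo.mem_nhds ht] with s hs using hddξ s hs)
  have nullD (t) (ht : t ∈ Set.Ioo (c 1 - δ) (c 1 + δ)) : ip (deriv n t) (n t) = 0 :=
    np.ip_eq_zero_neg (np.act_dn t ht) (np.act_n t ht)
  have nullN (t) (ht : t ∈ Set.Ioo (c 1 - δ) (c 1 + δ)) : ip (n t) (n t) = 0 :=
    np.ip_eq_zero_neg (np.act_n t ht) (np.act_n t ht)
  have nullQ (t) (ht : t ∈ Set.Ioo (c 1 - δ) (c 1 + δ)) : ip (deriv q t) (deriv q t) = 0 :=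
    np.ip_eq_zero_pos (np.act_Q t ht) (np.act_Q t ht)
  refine ⟨l₁, l, ξ, ?_, ?_⟩
  · refine ⟨fun t ht => (hl₁S t ht).contDiffWithinAt, fun t ht => (hlS t ht).contDiffWithinAt,
      fun t ht => (h.smooth_n ht).contDiffWithinAt, fun t ht => (hξS t ht).contDiffWithinAt,
      hl₁ne, hlne, nullN, ?_, ?_, ?_, ?_, hp, ?_⟩ <;> intro t ht
    · exact np.ip_eq_zero_neg (np.act_dn t ht) (np.act_dn t ht)
    · rw [hdξ t ht, ip_add_right, ip_smul_right, np.n_Q t ht, nullN t ht]; ring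
    · rw [hdξ t ht]
      simp only [ip_add_left, ip_add_right, ip_smul_left, ip_smul_right, np.n_Q t ht,
        ip_comm (deriv q t) (n t), nullN t ht, nullQ t ht]
      ring
    · rw [hdξ t ht, ip_add_right, ip_smul_right, hA t ht, nullD t ht]; ring
    -- Since ξ' = q' + c n, the equation for ξ is the homogeneous equation for q' plus the operator
    -- applied to c n, which is ζ.
    · have k1 := np.ode_Q isOpen_Ioo hl₁S hlS hl₁ne hlne (fun t ht => h.smooth_n ht) hp hA ht
      have k2 := coefC_smul_eq_zeta isOpen_Ioo hl₁S hlS hl₁ne hlne (fun t ht => h.smooth_n ht) hp ht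
      rw [← k2, hdddξ t ht, hddξ t ht, hdξ t ht]
      change _ + _ + coefB l₁ l t • _ = _
      rw [← sub_eq_zero]
      refine Eq.trans ?_ k1
      module
  · intro u hu
    have ht := snd_mem hu
    have hm0 := hmpos _ ht
    have hl0 := hlne _ ht
    have hτ := hpos u hu
    have e0 : -(u 0 * l₁ (u 1)) = σ * u 0 * m (u 1) ^ 2 := by rw [hl₁]; ring
    refine ⟨by rw [e0]; positivity, ?_⟩
    have e1 : √(-(u 0 * l₁ (u 1))) = sqrtCoord σ u * m (u 1) := by
      rw [e0, Real.sqrt_mul hτ.le, Real.sqrt_sq hm0.le]; rfl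
    have e2 : ε * (3 * √6 * l (u 1) * √(-(u 0 * l₁ (u 1))) / l₁ (u 1) ^ 2)
        = -(κ (u 1) * sqrtCoord σ u) := by
      rw [e1, hl₁]
      have h3 := hm3 _ ht
      have hκ' : κ (u 1) = -ε * (3 * √6) * l (u 1) / m (u 1) ^ 3 := by
        rw [eq_div_iff (pow_ne_zero 3 hm0.ne')]; linear_combination h3
      rw [hκ', show (fun t => -σ * m t ^ 2) (u 1) ^ 2 = (σ * σ) * m (u 1) ^ 4 by ring, hσ, one_mul]
      field_simp
    rw [modelMap, e2, h.X_eq hσ hpos hu, ← hl, ← hκ, ← hξ]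
    module

omit hσ hpos in
theorem exists_model {ε : ℝ} (hε : ε * ε = 1) (hφ : ∀ u ∈ box c δ, ε * φ u < 0) :
    ∃ (l₁ l₃ : ℝ → ℝ) (ξ : ℝ → E42), IsAdmissible (c 1 - δ) (c 1 + δ) l₁ l₃ n ξ ∧
      ∀ u ∈ box c δ, 0 < -(u 0 * l₁ (u 1)) ∧ X u = modelMap ε l₁ l₃ n ξ (u 0) (u 1) := by
  obtain ⟨σ, hσ, hpos⟩ := h.exists_sign
  exact h.exists_model_of_sign hσ hpos hε hφ

end IsNormalizedOn

/-! ### Surfaces with pointwise 1-type Gauss map are congruent to the model -/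

section Forward

variable {M : Type*} [TopologicalSpace M] [ChartedSpace Plane M] [IsManifold (𝓡 2) ∞ M]
  {F : M → E42}

omit [IsManifold (𝓡 2) ∞ M] in
theorem isOneType_of_isGaussMap (hF : IsQuasiMinimalSurface F)
    (hcurv : HasNonvanishingNormalCurv F) {G : M → Bivec} {φ : M → ℝ} {C : Bivec}
    (hG : IsGaussMap F G) (hφ : ∀ p, φ p ≠ 0) (hC : ∀ i j, C i j = -C j i)
    (hlap : ∀ e : OpenPartialHomeomorph M Plane, IsChart e → ∀ u ∈ e.target,
      lap (F ∘ e.symm) (G ∘ e.symm) u = φ (e.symm u) • (G (e.symm u) + C)) :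
    IsOneType F G φ C :=
  ⟨hF.1, fun e he => ⟨e.open_target, fun _ hv => contDiffAt_comp_chart_symm hF.1 he hv,
    fun _ hv => contDiffAt_comp_chart_symm hG.1 he hv, hF.2 e he, hcurv e he, hG.2 e he,
    fun _ _ => hφ _, hC, hlap e he⟩⟩

theorem IsOneType.isCongruentToModelNear {G : M → Bivec} {φ : M → ℝ} {C : Bivec}
    (h : IsOneType F G φ C) {ε : ℝ} (hε : ε * ε = 1) (hφ : ∀ p, ε * φ p < 0) (p : M) :
    IsCongruentToModelNear F ε p := by
  obtain ⟨G', C', N, h', hN, hpos⟩ := h.exists_positive p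
  obtain ⟨e, he, hp, ⟨δ, hδ, htar⟩, q, n, hr, heqs⟩ := h'.exists_normalized_chart hN hpos
  rw [htar] at hr heqs
  have hno : IsNormalizedOn (F ∘ e.symm) (G' ∘ e.symm) (φ ∘ e.symm) C' (e p) δ q n :=
    ⟨hδ, hr, heqs⟩
  obtain ⟨l₁, l₃, ξ, hadm, hX⟩ := hno.exists_model hε fun u _ => hφ (e.symm u)
  -- The curves are those of the surface itself, so the identity isometry suffices.
  refine ⟨_, _, l₁, l₃, n, ξ, hadm, LinearEquiv.refl ℝ E42, 0, fun _ _ => rfl, e, he, hp,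
    fun u hu => ?_⟩
  rw [htar] at hu
  obtain ⟨k1, k2⟩ := hX u hu
  exact ⟨IsNormalizedOn.snd_mem hu, k1, by rw [← k2, add_zero]; rfl⟩

theorem exists_isCongruentToModelNear [ConnectedSpace M] (hF : IsQuasiMinimalSurface F)
    (hcurv : HasNonvanishingNormalCurv F) (h : HasPointwiseOneTypeGaussMap F) :
    ∃ ε : ℝ, (ε = 1 ∨ ε = -1) ∧ ∀ p : M, IsCongruentToModelNear F ε p := by
  obtain ⟨G, φ, C, hG, hφs, hφ, hC, hlap⟩ := h
  have h1 := isOneType_of_isGaussMap hF hcurv hG hφ hC hlap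
  -- φ is continuous and never zero on a connected space; this makes a single ε work at all points.
  have hsign : (∀ p, φ p < 0) ∨ ∀ p, 0 < φ p := by
    by_contra hcon
    push Not at hcon
    obtain ⟨⟨a, ha⟩, b, hb⟩ := hcon
    obtain ⟨p, hp⟩ := mem_range_of_exists_le_of_exists_ge hφs.continuous ⟨b, hb⟩ ⟨a, ha⟩
    exact hφ p hp
  rcases hsign with hs | hs
  · exact ⟨1, Or.inl rfl, h1.isCongruentToModelNear (by norm_num) fun p => by linarith [hs p]⟩
  · exact ⟨-1, Or.inr rfl, h1.isCongruentToModelNear (by norm_num) fun p => by linarith [hs p]⟩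

end Forward

/-! ### The geometry of the model -/

section ModelCurves

theorem hasDerivAt_wedge {f g : ℝ → E42} {f' g' : E42} {t : ℝ} (hf : HasDerivAt f f' t)
    (hg : HasDerivAt g g' t) :
    HasDerivAt (fun s => wedge (f s) (g s)) (wedge f' (g t) + wedge (f t) g') t := by
  have := wedgeB.hasDerivAt_of_bilinear (fun _ => hf) (fun _ => hg)
  rw [add_comm]
  exact this

/-- The curve `Q = ξ' - c n`. -/
noncomputable def qCurve (l₁ l₃ : ℝ → ℝ) (n ξ : ℝ → E42) (t : ℝ) : E42 :=
  deriv ξ t - coefC l₁ l₃ t • n t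

/-- The function `2 λ₃' / λ₃ - 3 λ₁' / λ₁`. -/
noncomputable def coefU (l₁ l₃ : ℝ → ℝ) (t : ℝ) : ℝ :=
  2 * deriv l₃ t / l₃ t - 3 * deriv l₁ t / l₁ t

/-- The constant bivector associated to the model. -/
noncomputable def modelC (l₁ l₃ : ℝ → ℝ) (n ξ : ℝ → E42) (t : ℝ) : Bivec :=
  (l₃ t / 2) • (wedge (n t) (deriv (qCurve l₁ l₃ n ξ) t)
    - wedge (deriv n t) (qCurve l₁ l₃ n ξ t) + coefU l₁ l₃ t • wedge (n t) (qCurve l₁ l₃ n ξ t))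

namespace IsAdmissible

variable {α β : ℝ} {l₁ l₃ : ℝ → ℝ} {n ξ : ℝ → E42} (h : IsAdmissible α β l₁ l₃ n ξ)

include h

theorem cd_l₁ : ∀ t ∈ Set.Ioo α β, ContDiffAt ℝ ∞ l₁ t := fun _ ht =>
  h.smooth_l₁.contDiffAt (isOpen_Ioo.mem_nhds ht)

theorem cd_l₃ : ∀ t ∈ Set.Ioo α β, ContDiffAt ℝ ∞ l₃ t := fun _ ht =>
  h.smooth_l₃.contDiffAt (isOpen_Ioo.mem_nhds ht)

theorem cd_n : ∀ t ∈ Set.Ioo α β, ContDiffAt ℝ ∞ n t := fun _ ht =>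
  h.smooth_n.contDiffAt (isOpen_Ioo.mem_nhds ht)

theorem cd_ξ : ∀ t ∈ Set.Ioo α β, ContDiffAt ℝ ∞ ξ t := fun _ ht =>
  h.smooth_ξ.contDiffAt (isOpen_Ioo.mem_nhds ht)

theorem cd_Cn : ∀ t ∈ Set.Ioo α β, ContDiffAt ℝ ∞ (fun s => coefC l₁ l₃ s • n s) t := fun t ht =>
  ((contDiffAt_const.mul (h.cd_l₃ t ht)).div ((h.cd_l₁ t ht).pow 3)
    (pow_ne_zero 3 (h.l₁_ne t ht))).smul (h.cd_n t ht)

theorem cd_Q : ∀ t ∈ Set.Ioo α β, ContDiffAt ℝ ∞ (qCurve l₁ l₃ n ξ) t := fun t ht =>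
  (contDiffAt_deriv (h.cd_ξ t ht)).sub (h.cd_Cn t ht)

theorem cd_U : ∀ t ∈ Set.Ioo α β, ContDiffAt ℝ ∞ (coefU l₁ l₃) t := fun t ht =>
  ((contDiffAt_const.mul (contDiffAt_deriv (h.cd_l₃ t ht))).div (h.cd_l₃ t ht) (h.l₃_ne t ht)).sub
    ((contDiffAt_const.mul (contDiffAt_deriv (h.cd_l₁ t ht))).div (h.cd_l₁ t ht) (h.l₁_ne t ht))

theorem ddn {t : ℝ} (ht : t ∈ Set.Ioo α β) : deriv (deriv n) t =
    (deriv l₃ t / l₃ t - 3 * deriv l₁ t / l₁ t) • deriv n t - (1 / l₃ t) • n t := by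
  have := h.ode_n t ht
  rw [sub_add, sub_eq_zero] at this
  exact this

theorem n_dn {t : ℝ} (ht : t ∈ Set.Ioo α β) : ip (n t) (deriv n t) = 0 := by
  have hd := hasDerivAt_of_contDiffAt (h.cd_n t ht)
  have := hasDerivAt_unique (hasDerivAt_ip hd hd) (hasDerivAt_const t 0)
    (by filter_upwards [isOpen_Ioo.mem_nhds ht] with s hs using h.n_n s hs)
  rw [ip_comm (deriv n t)] at this
  linarith

theorem n_Q {t : ℝ} (ht : t ∈ Set.Ioo α β) : ip (n t) (qCurve l₁ l₃ n ξ t) = 0 := by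
  rw [qCurve, ip_sub_right, ip_smul_right, h.n_ξ' t ht, h.n_n t ht]; ring

theorem dn_Q {t : ℝ} (ht : t ∈ Set.Ioo α β) :
    ip (deriv n t) (qCurve l₁ l₃ n ξ t) = 1 / l₃ t := by
  rw [qCurve, ip_sub_right, ip_smul_right, h.n'_ξ' t ht, ip_comm, h.n_dn ht]; ring

theorem Q_Q {t : ℝ} (ht : t ∈ Set.Ioo α β) :
    ip (qCurve l₁ l₃ n ξ t) (qCurve l₁ l₃ n ξ t) = 0 := by
  simp only [qCurve, ip_sub_right, ip_smul_right, ip_sub_left, ip_smul_left, ip_comm (deriv ξ t) (n t),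
    h.n_ξ' t ht, h.n_n t ht, h.ξ'_ξ' t ht]
  ring

theorem dQ {t : ℝ} (ht : t ∈ Set.Ioo α β) : deriv (qCurve l₁ l₃ n ξ) t
    = deriv (deriv ξ) t - deriv (fun s => coefC l₁ l₃ s • n s) t :=
  ((hasDerivAt_of_contDiffAt (contDiffAt_deriv (h.cd_ξ t ht))).fun_sub
    (hasDerivAt_of_contDiffAt (h.cd_Cn t ht))).deriv

/-- Subtracting the operator applied to c n from the third order equation cancels ζ. -/
theorem ddQ {t : ℝ} (ht : t ∈ Set.Ioo α β) : deriv (deriv (qCurve l₁ l₃ n ξ)) t =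
    -(3 * deriv l₃ t / l₃ t - 3 * deriv l₁ t / l₁ t) • deriv (qCurve l₁ l₃ n ξ) t
      - coefB l₁ l₃ t • qCurve l₁ l₃ n ξ t := by
  have e1 : deriv (deriv (qCurve l₁ l₃ n ξ)) t = deriv (deriv (deriv ξ)) t
      - deriv (deriv fun s => coefC l₁ l₃ s • n s) t :=
    hasDerivAt_unique (hasDerivAt_of_contDiffAt (contDiffAt_deriv (h.cd_Q t ht)))
      ((hasDerivAt_of_contDiffAt (contDiffAt_deriv (contDiffAt_deriv (h.cd_ξ t ht)))).fun_sub
        (hasDerivAt_of_contDiffAt (contDiffAt_deriv (h.cd_Cn t ht))))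
      (by filter_upwards [isOpen_Ioo.mem_nhds ht] with s hs using h.dQ hs)
  have e2 := h.ode_ξ t ht
  have e3 := coefC_smul_eq_zeta isOpen_Ioo h.cd_l₁ h.cd_l₃ h.l₁_ne h.l₃_ne h.cd_n h.ode_n ht
  rw [← e3] at e2
  change _ + _ + coefB l₁ l₃ t • _ = _ at e2
  rw [e1, h.dQ ht, qCurve]
  rw [← sub_eq_zero] at e2 ⊢
  refine Eq.trans ?_ e2
  module

theorem Q_dQ {t : ℝ} (ht : t ∈ Set.Ioo α β) :
    ip (qCurve l₁ l₃ n ξ t) (deriv (qCurve l₁ l₃ n ξ) t) = 0 := by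
  have hd := hasDerivAt_of_contDiffAt (h.cd_Q t ht)
  have := hasDerivAt_unique (hasDerivAt_ip hd hd) (hasDerivAt_const t 0)
    (by filter_upwards [isOpen_Ioo.mem_nhds ht] with s hs using h.Q_Q hs)
  rw [ip_comm (deriv _ t)] at this
  linarith

theorem n_dQ {t : ℝ} (ht : t ∈ Set.Ioo α β) :
    ip (n t) (deriv (qCurve l₁ l₃ n ξ) t) = -(1 / l₃ t) := by
  have := hasDerivAt_unique (hasDerivAt_ip (hasDerivAt_of_contDiffAt (h.cd_n t ht))
    (hasDerivAt_of_contDiffAt (h.cd_Q t ht))) (hasDerivAt_const t 0)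
    (by filter_upwards [isOpen_Ioo.mem_nhds ht] with s hs using h.n_Q hs)
  rw [h.dn_Q ht] at this
  linarith

theorem dn_dQ {t : ℝ} (ht : t ∈ Set.Ioo α β) :
    ip (deriv n t) (deriv (qCurve l₁ l₃ n ξ) t) = -(coefU l₁ l₃ t / l₃ t) := by
  have dA : HasDerivAt (fun s => 1 / l₃ s) (-deriv l₃ t / l₃ t ^ 2) t := by
    simpa using (hasDerivAt_of_contDiffAt (h.cd_l₃ t ht)).fun_inv (h.l₃_ne t ht)
  have := hasDerivAt_unique
    (hasDerivAt_ip (hasDerivAt_of_contDiffAt (contDiffAt_deriv (h.cd_n t ht)))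
    (hasDerivAt_of_contDiffAt (h.cd_Q t ht))) dA
    (by filter_upwards [isOpen_Ioo.mem_nhds ht] with s hs using h.dn_Q hs)
  rw [h.ddn ht, ip_sub_left, ip_smul_left, ip_smul_left, h.dn_Q ht, h.n_Q ht] at this
  have hl := h.l₃_ne t ht
  rw [eq_sub_of_add_eq' this, coefU]
  field_simp
  ring

/-- On differentiation the two n'∧Q' terms cancel, and n'', Q'' are replaced by means of the linear
equations. Cancellation of n∧Q' forces u = 2λ₃'/λ₃ - 3λ₁'/λ₁, the n'∧Q terms then cancel too, and
the n∧Q terms cancel by the form of `coefB`. -/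
theorem modelC_const {t t' : ℝ} (ht : t ∈ Set.Ioo α β) (ht' : t' ∈ Set.Ioo α β) :
    modelC l₁ l₃ n ξ t = modelC l₁ l₃ n ξ t' := by
  have hd (t) (ht : t ∈ Set.Ioo α β) : HasDerivAt (modelC l₁ l₃ n ξ) 0 t := by
    have d₁ := hasDerivAt_of_contDiffAt (h.cd_l₁ t ht)
    have d₃ := hasDerivAt_of_contDiffAt (h.cd_l₃ t ht)
    have d₁' := hasDerivAt_of_contDiffAt (contDiffAt_deriv (h.cd_l₁ t ht))
    have d₃' := hasDerivAt_of_contDiffAt (contDiffAt_deriv (h.cd_l₃ t ht))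
    have dn := hasDerivAt_of_contDiffAt (h.cd_n t ht)
    have dn' := hasDerivAt_of_contDiffAt (contDiffAt_deriv (h.cd_n t ht))
    have dq := hasDerivAt_of_contDiffAt (h.cd_Q t ht)
    have dq' := hasDerivAt_of_contDiffAt (contDiffAt_deriv (h.cd_Q t ht))
    have n₁ := h.l₁_ne t ht
    have n₃ := h.l₃_ne t ht
    have dU : HasDerivAt (coefU l₁ l₃) _ t := ((d₃'.const_mul 2).fun_div d₃ n₃).fun_sub
      ((d₁'.const_mul 3).fun_div d₁ n₁)
    refine HasDerivAt.congr_deriv ((d₃.div_const 2).fun_smul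
      (((hasDerivAt_wedge dn dq').fun_sub (hasDerivAt_wedge dn' dq)).fun_add
        (dU.fun_smul (hasDerivAt_wedge dn dq)))) ?_
    rw [h.ddn ht, h.ddQ ht, coefU, coefB]
    simp only [wedge_sub_left, wedge_sub_right, wedge_smul_left, wedge_smul_right]
    match_scalars <;> field_simp <;> ring
  exact isOpen_Ioo.is_const_of_deriv_eq_zero isPreconnected_Ioo
    (fun s hs => (hd s hs).differentiableAt.differentiableWithinAt) (fun s hs => (hd s hs).deriv)
    ht ht'

omit h in
theorem modelC_antisymm (t : ℝ) (i j : Fin 4) :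
    modelC l₁ l₃ n ξ t i j = -modelC l₁ l₃ n ξ t j i := by
  simp only [modelC, wedge, Pi.smul_apply, Pi.add_apply, Pi.sub_apply, smul_eq_mul]; ring

theorem act_modelC {t : ℝ} (ht : t ∈ Set.Ioo α β) :
    act (modelC l₁ l₃ n ξ t) (n t) = -(1 / 2 : ℝ) • n t ∧
    act (modelC l₁ l₃ n ξ t) (deriv n t) = -(1 / 2 : ℝ) • deriv n t ∧
    act (modelC l₁ l₃ n ξ t) (qCurve l₁ l₃ n ξ t) = (1 / 2 : ℝ) • qCurve l₁ l₃ n ξ t := by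
  have n₃ := h.l₃_ne t ht
  have hsa : ∀ w, act (modelC l₁ l₃ n ξ t) w = (l₃ t / 2) •
      ((ip (deriv (qCurve l₁ l₃ n ξ) t) w • n t - ip (n t) w • deriv (qCurve l₁ l₃ n ξ) t)
      - (ip (qCurve l₁ l₃ n ξ t) w • deriv n t - ip (deriv n t) w • qCurve l₁ l₃ n ξ t)
      + coefU l₁ l₃ t • (ip (qCurve l₁ l₃ n ξ t) w • n t - ip (n t) w • qCurve l₁ l₃ n ξ t)) := by
    intro w
    rw [modelC, ← act_wedge, ← act_wedge, ← act_wedge]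
    ext i
    simp only [act, Pi.smul_apply, Pi.add_apply, Pi.sub_apply, smul_eq_mul]
    ring
  refine ⟨?_, ?_, ?_⟩
  · rw [hsa, ip_comm _ (n t), ip_comm (qCurve l₁ l₃ n ξ t), ip_comm (deriv n t), h.n_dQ ht,
      h.n_n t ht, h.n_Q ht, h.n_dn ht]
    match_scalars <;> field_simp <;> simp
  · rw [hsa, ip_comm _ (deriv n t), ip_comm (qCurve l₁ l₃ n ξ t), h.dn_dQ ht,
      h.n'_n' t ht, h.dn_Q ht, h.n_dn ht]
    match_scalars <;> field_simp <;> ring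
  · rw [hsa, ip_comm (deriv (qCurve l₁ l₃ n ξ) t), h.Q_dQ ht, h.n_Q ht, h.Q_Q ht, h.dn_Q ht]
    match_scalars <;> field_simp <;> simp

end IsAdmissible

end ModelCurves

/-! ### The Laplacian of the Gauss map of the model -/

section ModelSurface

theorem HasPd.inv {i : Fin 2} {f : Plane → ℝ} {f' : ℝ} {u : Plane} (hf : HasPd i f f' u)
    (h : f u ≠ 0) : HasPd i (fun v => (f v)⁻¹) (-f' * ((f u)⁻¹ * (f u)⁻¹)) u := by
  have hd := (hasDerivAt_inv h).comp_hasFDerivAt u hf.1.hasFDerivAt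
  refine ⟨hd.differentiableAt, ?_⟩
  have := hd.fderiv
  change fderiv ℝ (fun v => (f v)⁻¹) u = _ at this
  have h2 := hf.2
  simp only [pd] at h2 ⊢
  rw [this]
  simp only [smul_apply, smul_eq_mul, h2]
  field_simp

/-- The Laplacian in coordinates with `g₀₀ = 0`, `g₀₁ = -1`, `g₁₁ = 2g`. -/
theorem lap_of_null_coord {V : Type*} [NormedAddCommGroup V] [NormedSpace ℝ V] {X : Plane → E42}
    {f : Plane → V} {u : Plane} (hX : ContDiffAt ℝ ∞ X u) (hf : ContDiffAt ℝ ∞ f u)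
    {g : Plane → ℝ} {g₀ : ℝ} (hg : HasPd 0 g g₀ u)
    (h00 : ∀ᶠ w in nhds u, ip (pd 0 X w) (pd 0 X w) = 0)
    (h01 : ∀ᶠ w in nhds u, ip (pd 0 X w) (pd 1 X w) = -1)
    (h11 : ∀ᶠ w in nhds u, ip (pd 1 X w) (pd 1 X w) = 2 * g w) :
    lap X f u = (2 : ℝ) • pd 0 (pd 1 f) u + (2 * g u) • pd 0 (pd 0 f) u
      + (2 * g₀) • pd 0 f u := by
  have d0 (i) := (contDiffAt_pd 0 hX).hasPd i
  have d1 (i) := (contDiffAt_pd 1 hX).hasPd i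
  have e1 := ((d0 0).ip (d0 0)).unique ((hasPd_const 0).congr h00)
  have e2 := ((d0 1).ip (d0 1)).unique ((hasPd_const 0).congr h00)
  have e3 := ((d0 0).ip (d1 0)).unique ((hasPd_const (-1)).congr h01)
  have e4 := ((d1 0).ip (d1 0)).unique (((hasPd_const 2).mul hg).congr h11)
  have c1 := h00.self_of_nhds
  have c2 := h01.self_of_nhds
  have c3 := h11.self_of_nhds
  have hc := pd_comm hX 1 0
  have hcf := pd_comm hf 1 0
  rw [hc] at e2
  have hdet : (metric X u).det = -1 := by rw [metric_det, c1, c2, c3]; ring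
  have i00 : (metric X u)⁻¹ 0 0 = -(2 * g u) := by rw [metric_inv_00, hdet, c3]; norm_num
  have i01 : (metric X u)⁻¹ 0 1 = -1 := by rw [metric_inv_01, hdet, c2]; norm_num
  have i11 : (metric X u)⁻¹ 1 1 = 0 := by rw [metric_inv_11, hdet, c1]; norm_num
  have i10 : (metric X u)⁻¹ 1 0 = -1 := by rw [metric_inv_symm, i01]
  have a00 : ip (pd 0 (pd 0 X) u) (pd 0 X u) = 0 := by
    rw [ip_comm (pd 0 X u)] at e1; linarith
  have a01 : ip (pd 0 (pd 1 X) u) (pd 0 X u) = 0 := by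
    rw [ip_comm (pd 0 X u)] at e2; linarith
  have a11 : ip (pd 0 (pd 1 X) u) (pd 1 X u) = g₀ := by
    rw [ip_comm (pd 1 X u)] at e4; linarith
  have a10 : ip (pd 0 (pd 0 X) u) (pd 1 X u) = 0 := by
    rw [ip_comm (pd 0 X u), a01] at e3; linarith
  simp only [lap, christoffel, Fin.sum_univ_two, i00, i01, i10, i11, hc, hcf, a00, a01, a11, a10]
  module

variable {α β : ℝ} {l₁ l₃ : ℝ → ℝ} {n ξ : ℝ → E42}

/-- The square root in the model. -/
noncomputable def wM (l₁ : ℝ → ℝ) (u : Plane) : ℝ := √(-(u 0 * l₁ (u 1)))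

/-- The coefficient of `n` in `∂₀X` for the model. -/
noncomputable def fM (ε : ℝ) (l₁ l₃ : ℝ → ℝ) (u : Plane) : ℝ :=
  ε * (3 * √6) / 2 * (l₃ (u 1) * ((l₁ (u 1))⁻¹ * (wM l₁ u)⁻¹))

/-- The derivative of `fM`. -/
noncomputable def kM (ε : ℝ) (l₁ l₃ : ℝ → ℝ) (u : Plane) : ℝ :=
  ε * (3 * √6) / 4 * (l₃ (u 1) * ((wM l₁ u)⁻¹ * ((wM l₁ u)⁻¹ * (wM l₁ u)⁻¹)))

/-- The coefficient `g` for the model. -/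
noncomputable def gM (ε : ℝ) (l₁ l₃ : ℝ → ℝ) (u : Plane) : ℝ :=
  -(u 0 * coefU l₁ l₃ (u 1)) + 2 * (u 0 * (fM ε l₁ l₃ u * (l₃ (u 1))⁻¹))

/-- The Gauss map of the model. -/
noncomputable def gaussM (ε : ℝ) (l₁ l₃ : ℝ → ℝ) (n ξ : ℝ → E42) (u : Plane) : Bivec :=
  wedge (u 0 • n (u 1) + qCurve l₁ l₃ n ξ (u 1))
    (fM ε l₁ l₃ u • n (u 1) - l₃ (u 1) • deriv n (u 1))

/-- The factor `φ` for the model. -/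
noncomputable def phiM (ε : ℝ) (l₁ l₃ : ℝ → ℝ) (u : Plane) : ℝ :=
  -4 * (kM ε l₁ l₃ u * (l₃ (u 1))⁻¹)

/-- `X` is the model surface on `T`. -/
structure IsModelOn (X : Plane → E42) (ε α β : ℝ) (l₁ l₃ : ℝ → ℝ) (n ξ : ℝ → E42)
    (T : Set Plane) : Prop where
  adm : IsAdmissible α β l₁ l₃ n ξ
  sign : ε * ε = 1
  isOpen : IsOpen T
  smooth : ∀ u ∈ T, ContDiffAt ℝ ∞ X u
  mem : ∀ u ∈ T, u 1 ∈ Set.Ioo α β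
  pos : ∀ u ∈ T, 0 < -(u 0 * l₁ (u 1))
  eq : ∀ u ∈ T, X u = modelMap ε l₁ l₃ n ξ (u 0) (u 1)

namespace IsModelOn

variable {X : Plane → E42} {ε : ℝ} {T : Set Plane} (h : IsModelOn X ε α β l₁ l₃ n ξ T)
  {u : Plane} (hu : u ∈ T)

include h hu

theorem wM_pos : 0 < wM l₁ u := Real.sqrt_pos.2 (h.pos u hu)

theorem fst_eq : u 0 = -(wM l₁ u ^ 2 * (l₁ (u 1))⁻¹) := by
  have := h.adm.l₁_ne _ (h.mem u hu)
  rw [wM, Real.sq_sqrt (h.pos u hu).le]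
  field_simp

theorem hasPd_wM : HasPd 0 (wM l₁) (-l₁ (u 1) / (2 * wM l₁ u)) u ∧
    HasPd 1 (wM l₁) (-(u 0 * deriv l₁ (u 1)) / (2 * wM l₁ u)) u := by
  have hne := (h.pos u hu).ne'
  have hl := hasDerivAt_of_contDiffAt (h.adm.cd_l₁ _ (h.mem u hu))
  have key (i : Fin 2) {d : ℝ} (hd : HasPd i (fun w : Plane => -(w 0 * l₁ (w 1))) d u) :
      HasPd i (wM l₁) (d / (2 * wM l₁ u)) u := by
    have hf := hd.1.hasFDerivAt.sqrt hne
    refine ⟨hf.differentiableAt, ?_⟩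
    change fderiv ℝ (fun w : Plane => √(-(w 0 * l₁ (w 1)))) u _ = _
    rw [hf.fderiv]
    have := hd.2
    simp only [pd] at this
    simp only [smul_apply, smul_eq_mul, this, wM]
    ring
  exact ⟨(key 0 ((hasPd_coord 0 0 u).mul (hasPd_comp_snd 0 hl)).neg).of_eq (by simp),
    (key 1 ((hasPd_coord 1 0 u).mul (hasPd_comp_snd 1 hl)).neg).of_eq (by simp)⟩

theorem contDiffAt_wM : ContDiffAt ℝ ∞ (wM l₁) u :=
  ContDiffAt.sqrt (((EuclideanSpace.proj (0 : Fin 2) : Plane →L[ℝ] ℝ).contDiff.contDiffAt.mul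
    (contDiffAt_comp_snd (h.adm.cd_l₁ _ (h.mem u hu)))).neg) (h.pos u hu).ne'

theorem contDiffAt_fM : ContDiffAt ℝ ∞ (fM ε l₁ l₃) u :=
  contDiffAt_const.mul ((contDiffAt_comp_snd (h.adm.cd_l₃ _ (h.mem u hu))).mul
    (((contDiffAt_comp_snd (h.adm.cd_l₁ _ (h.mem u hu))).inv (h.adm.l₁_ne _ (h.mem u hu))).mul
      ((h.contDiffAt_wM hu).inv (h.wM_pos hu).ne')))

theorem contDiffAt_phiM : ContDiffAt ℝ ∞ (phiM ε l₁ l₃) u := by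
  have hw := (h.contDiffAt_wM hu).inv (h.wM_pos hu).ne'
  have hl := contDiffAt_comp_snd (h.adm.cd_l₃ _ (h.mem u hu))
  exact contDiffAt_const.mul ((contDiffAt_const.mul (hl.mul (hw.mul (hw.mul hw)))).mul
    (hl.inv (h.adm.l₃_ne _ (h.mem u hu))))

theorem contDiffAt_gaussM : ContDiffAt ℝ ∞ (gaussM ε l₁ l₃ n ξ) u := by
  have ht := h.mem u hu
  have hn := contDiffAt_comp_snd (h.adm.cd_n _ ht)
  have hn' := contDiffAt_comp_snd (contDiffAt_deriv (h.adm.cd_n _ ht))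
  have hl := contDiffAt_comp_snd (h.adm.cd_l₃ _ ht)
  have hq := contDiffAt_comp_snd (h.adm.cd_Q _ ht)
  have h0 : ContDiffAt ℝ ∞ (fun w : Plane => w 0) u :=
    (EuclideanSpace.proj (0 : Fin 2) : Plane →L[ℝ] ℝ).contDiff.contDiffAt
  exact contDiffAt_wedge ((h0.smul hn).add hq) (((h.contDiffAt_fM hu).smul hn).sub (hl.smul hn'))

theorem fM_eq : fM ε l₁ l₃ u = -2 * (u 0 * kM ε l₁ l₃ u) := by
  have := h.adm.l₁_ne _ (h.mem u hu)
  have hw := (h.wM_pos hu).ne'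
  rw [h.fst_eq hu, fM, kM]
  field_simp
  ring

theorem hasPd_fM : HasPd 0 (fM ε l₁ l₃) (kM ε l₁ l₃ u) u ∧
    HasPd 1 (fM ε l₁ l₃) (fM ε l₁ l₃ u * coefU l₁ l₃ (u 1) / 2) u := by
  have ht := h.mem u hu
  have n₁ := h.adm.l₁_ne _ ht
  have n₃ := h.adm.l₃_ne _ ht
  have hw := (h.wM_pos hu).ne'
  obtain ⟨w0, w1⟩ := h.hasPd_wM hu
  have hl₁ (i) := hasPd_comp_snd i (hasDerivAt_of_contDiffAt (h.adm.cd_l₁ _ ht))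
  have hl₃ (i) := hasPd_comp_snd i (hasDerivAt_of_contDiffAt (h.adm.cd_l₃ _ ht))
  refine ⟨HasPd.of_eq ((hasPd_const _).mul ((hl₃ 0).mul (((hl₁ 0).inv n₁).mul (w0.inv hw)))) ?_,
    HasPd.of_eq ((hasPd_const _).mul ((hl₃ 1).mul (((hl₁ 1).inv n₁).mul (w1.inv hw)))) ?_⟩
  · simp [kM]
    field_simp
    ring
  · rw [h.fst_eq hu]
    simp [fM, coefU]
    field_simp
    ring

theorem hasPd_kM : HasPd 0 (kM ε l₁ l₃) (-3 / 2 * (kM ε l₁ l₃ u * (u 0)⁻¹)) u ∧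
    HasPd 1 (kM ε l₁ l₃) (kM ε l₁ l₃ u * coefU l₁ l₃ (u 1) / 2) u := by
  have ht := h.mem u hu
  have n₁ := h.adm.l₁_ne _ ht
  have n₃ := h.adm.l₃_ne _ ht
  have hw := (h.wM_pos hu).ne'
  obtain ⟨w0, w1⟩ := h.hasPd_wM hu
  have hl₃ (i) := hasPd_comp_snd i (hasDerivAt_of_contDiffAt (h.adm.cd_l₃ _ ht))
  refine ⟨HasPd.of_eq ((hasPd_const _).mul ((hl₃ 0).mul ((w0.inv hw).mul
    ((w0.inv hw).mul (w0.inv hw))))) ?_, HasPd.of_eq ((hasPd_const _).mul ((hl₃ 1).mul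
    ((w1.inv hw).mul ((w1.inv hw).mul (w1.inv hw))))) ?_⟩
  · rw [h.fst_eq hu]
    simp [kM]
    field_simp
    ring
  · rw [h.fst_eq hu]
    simp [kM, coefU]
    field_simp
    ring

theorem X_eq : X u = -(u 0 * l₃ (u 1)) • deriv n (u 1)
    + (2 * (u 0 * fM ε l₁ l₃ u)) • n (u 1) + ξ (u 1) := by
  have n₁ := h.adm.l₁_ne _ (h.mem u hu)
  have hw := (h.wM_pos hu).ne'
  have e : ε * (3 * √6 * l₃ (u 1) * √(-(u 0 * l₁ (u 1))) / l₁ (u 1) ^ 2)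
      = -(2 * (u 0 * fM ε l₁ l₃ u)) := by
    change ε * (3 * √6 * l₃ (u 1) * wM l₁ u / l₁ (u 1) ^ 2) = _
    rw [h.fst_eq hu, fM]
    field_simp
  rw [h.eq u hu, modelMap, e]
  module

/-- The coefficient g is the one for which ∂₁X + g∂₀X = sn + Q, a null vector. This and ∂₀X form the
null frame in which `gaussM` is written. -/
theorem pd_X : pd 0 X u = fM ε l₁ l₃ u • n (u 1) - l₃ (u 1) • deriv n (u 1) ∧
    pd 1 X u = u 0 • n (u 1) + qCurve l₁ l₃ n ξ (u 1) - gM ε l₁ l₃ u •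
      (fM ε l₁ l₃ u • n (u 1) - l₃ (u 1) • deriv n (u 1)) := by
  have ht := h.mem u hu
  have n₁ := h.adm.l₁_ne _ ht
  have n₃ := h.adm.l₃_ne _ ht
  have hw := (h.wM_pos hu).ne'
  have hf := h.fM_eq hu
  obtain ⟨f0, f1⟩ := h.hasPd_fM hu
  have hev : X =ᶠ[nhds u] fun w : Plane => -(w 0 * l₃ (w 1)) • deriv n (w 1)
      + (2 * (w 0 * fM ε l₁ l₃ w)) • n (w 1) + ξ (w 1) := by
    filter_upwards [h.isOpen.mem_nhds hu] with w hw using h.X_eq hw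
  have hl₃ (i) := hasPd_comp_snd i (hasDerivAt_of_contDiffAt (h.adm.cd_l₃ _ ht))
  have hn (i) := hasPd_comp_snd i (hasDerivAt_of_contDiffAt (h.adm.cd_n _ ht))
  have hn' (i) := hasPd_comp_snd i (hasDerivAt_of_contDiffAt (contDiffAt_deriv (h.adm.cd_n _ ht)))
  have hξ (i) := hasPd_comp_snd i (hasDerivAt_of_contDiffAt (h.adm.cd_ξ _ ht))
  have key (i : Fin 2) {d : ℝ} (hd : HasPd i (fM ε l₁ l₃) d u) :=
    ((((((hasPd_coord i 0 u).mul (hl₃ i)).neg.smul (hn' i)).add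
      (((hasPd_const 2).mul ((hasPd_coord i 0 u).mul hd)).smul (hn i))).add (hξ i)).congr hev).2
  refine ⟨(key 0 f0).trans ?_, (key 1 f1).trans ?_⟩
  · simp only [one_ne_zero, if_false, if_true, zero_smul, smul_zero, mul_zero, add_zero, one_mul,
      zero_mul, zero_add]
    rw [show 2 * (fM ε l₁ l₃ u + u 0 * kM ε l₁ l₃ u) = fM ε l₁ l₃ u by linarith]
    module
  -- The constant 3√6 in the model is tuned for this identity: it absorbs the n-terms quadratic in f
  -- into ξ' and leaves Q.
  · have hcf : coefC l₁ l₃ (u 1) = -(2 * (u 0 * (fM ε l₁ l₃ u * fM ε l₁ l₃ u)) * (l₃ (u 1))⁻¹) := by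
      have h6 : √6 * √6 = (6 : ℝ) := Real.mul_self_sqrt (by norm_num)
      rw [h.fst_eq hu, fM, coefC]
      field_simp
      linear_combination (-9) * ε ^ 2 * h6 - 54 * h.sign
    simp only [zero_ne_one, if_false, if_true, one_smul, zero_mul, zero_add, smul_eq_mul, one_mul,
      h.adm.ddn ht, qCurve, hcf, gM, coefU]
    match_scalars <;> field_simp <;> ring

theorem ip_frame :
    ip (fM ε l₁ l₃ u • n (u 1) - l₃ (u 1) • deriv n (u 1))
      (fM ε l₁ l₃ u • n (u 1) - l₃ (u 1) • deriv n (u 1)) = 0 ∧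
    ip (u 0 • n (u 1) + qCurve l₁ l₃ n ξ (u 1)) (u 0 • n (u 1) + qCurve l₁ l₃ n ξ (u 1)) = 0 ∧
    ip (u 0 • n (u 1) + qCurve l₁ l₃ n ξ (u 1))
      (fM ε l₁ l₃ u • n (u 1) - l₃ (u 1) • deriv n (u 1)) = -1 := by
  have ht := h.mem u hu
  have n₃ := h.adm.l₃_ne _ ht
  simp only [ip_add_left, ip_add_right, ip_sub_left, ip_sub_right, ip_smul_left, ip_smul_right,
    ip_comm (qCurve l₁ l₃ n ξ (u 1)) (n (u 1)), ip_comm (qCurve l₁ l₃ n ξ (u 1)) (deriv n (u 1)),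
    ip_comm (deriv n (u 1)) (n (u 1)), h.adm.n_n _ ht, h.adm.n_dn ht, h.adm.n'_n' _ ht,
    h.adm.n_Q ht, h.adm.dn_Q ht, h.adm.Q_Q ht]
  refine ⟨by ring, by ring, by field_simp; ring⟩

theorem hasPd_gM : HasPd 0 (gM ε l₁ l₃)
    (-coefU l₁ l₃ (u 1) + fM ε l₁ l₃ u * (l₃ (u 1))⁻¹) u := by
  have ht := h.mem u hu
  have n₃ := h.adm.l₃_ne _ ht
  have hl₃ := hasPd_comp_snd 0 (hasDerivAt_of_contDiffAt (h.adm.cd_l₃ _ ht))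
  have hU := hasPd_comp_snd 0 (hasDerivAt_of_contDiffAt (h.adm.cd_U _ ht))
  have hc := hasPd_coord 0 0 u
  refine HasPd.of_eq ((hc.mul hU).neg.add ((hasPd_const 2).mul
    (hc.mul ((h.hasPd_fM hu).1.mul (hl₃.inv n₃))))) ?_
  have hf := h.fM_eq hu
  simp only [one_ne_zero, if_false, if_true, zero_smul, mul_zero, add_zero, one_mul, zero_mul,
    zero_add, neg_zero]
  linear_combination (l₃ (u 1))⁻¹ * hf

theorem hasPd_gaussM : HasPd 0 (gaussM ε l₁ l₃ n ξ)
    (kM ε l₁ l₃ u • wedge (qCurve l₁ l₃ n ξ (u 1)) (n (u 1))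
      - l₃ (u 1) • wedge (n (u 1)) (deriv n (u 1))) u := by
  have ht := h.mem u hu
  have hl₃ := hasPd_comp_snd 0 (hasDerivAt_of_contDiffAt (h.adm.cd_l₃ _ ht))
  have hn := hasPd_comp_snd 0 (hasDerivAt_of_contDiffAt (h.adm.cd_n _ ht))
  have hn' := hasPd_comp_snd 0 (hasDerivAt_of_contDiffAt (contDiffAt_deriv (h.adm.cd_n _ ht)))
  have hq := hasPd_comp_snd 0 (hasDerivAt_of_contDiffAt (h.adm.cd_Q _ ht))
  refine HasPd.of_eq ((((hasPd_coord 0 0 u).smul hn).add hq).wedge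
    (((h.hasPd_fM hu).1.smul hn).sub (hl₃.smul hn'))) ?_
  simp only [one_ne_zero, if_false, if_true, zero_smul, smul_zero, add_zero, one_smul, sub_zero,
    wedge_add_left, wedge_sub_right, wedge_smul_left, wedge_smul_right, wedge_self]
  module

/-- The Gauss map of the model satisfies `ΔG = φ (G + C)`. -/
theorem lap_gaussM : lap X (gaussM ε l₁ l₃ n ξ) u
    = phiM ε l₁ l₃ u • (gaussM ε l₁ l₃ n ξ u + modelC l₁ l₃ n ξ (u 1)) := by
  have ht := h.mem u hu
  have n₃ := h.adm.l₃_ne _ ht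
  have hmem : ∀ᶠ w in nhds u, w ∈ T := h.isOpen.mem_nhds hu
  have hG := h.contDiffAt_gaussM hu
  have h00 : ∀ᶠ w in nhds u, ip (pd 0 X w) (pd 0 X w) = 0 := by
    filter_upwards [hmem] with w hw
    rw [(h.pd_X hw).1]; exact (h.ip_frame hw).1
  have h01 : ∀ᶠ w in nhds u, ip (pd 0 X w) (pd 1 X w) = -1 := by
    filter_upwards [hmem] with w hw
    obtain ⟨i1, i2, i3⟩ := h.ip_frame hw
    rw [(h.pd_X hw).1, (h.pd_X hw).2, ip_sub_right, ip_smul_right, i1, ip_comm, i3]; ring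
  have h11 : ∀ᶠ w in nhds u, ip (pd 1 X w) (pd 1 X w) = 2 * gM ε l₁ l₃ w := by
    filter_upwards [hmem] with w hw
    obtain ⟨i1, i2, i3⟩ := h.ip_frame hw
    rw [(h.pd_X hw).2, ip_sub_right, ip_sub_left, ip_sub_left, ip_smul_right, ip_smul_right,
      ip_smul_left, ip_smul_left, i1, i2, ip_comm (fM ε l₁ l₃ w • n (w 1) - _), i3]
    ring
  have hev : pd 0 (gaussM ε l₁ l₃ n ξ) =ᶠ[nhds u] fun w =>
      kM ε l₁ l₃ w • wedge (qCurve l₁ l₃ n ξ (w 1)) (n (w 1))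
        - l₃ (w 1) • wedge (n (w 1)) (deriv n (w 1)) := by
    filter_upwards [hmem] with w hw using (h.hasPd_gaussM hw).2
  have hl₃ (i) := hasPd_comp_snd i (hasDerivAt_of_contDiffAt (h.adm.cd_l₃ _ ht))
  have hn (i) := hasPd_comp_snd i (hasDerivAt_of_contDiffAt (h.adm.cd_n _ ht))
  have hn' (i) := hasPd_comp_snd i (hasDerivAt_of_contDiffAt (contDiffAt_deriv (h.adm.cd_n _ ht)))
  have hq (i) := hasPd_comp_snd i (hasDerivAt_of_contDiffAt (h.adm.cd_Q _ ht))
  have key (i : Fin 2) {d : ℝ} (hd : HasPd i (kM ε l₁ l₃) d u) :=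
    (((hd.smul ((hq i).wedge (hn i))).sub ((hl₃ i).smul ((hn i).wedge (hn' i)))).congr hev).2
  have k0 := key 0 (h.hasPd_kM hu).1
  have k1 := key 1 (h.hasPd_kM hu).2
  rw [lap_of_null_coord (h.smooth u hu) hG (h.hasPd_gM hu) h00 h01 h11, pd_comm hG 0 1, k0, k1,
    (h.hasPd_gaussM hu).2]
  have hf := h.fM_eq hu
  have hu0 : u 0 ≠ 0 := by
    intro h0
    have := h.pos u hu
    rw [h0] at this; simp at this
  simp only [one_ne_zero, if_false, if_true, zero_smul, one_smul, smul_zero, add_zero,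
    wedge_self, wedge_zero_left, wedge_zero_right, sub_zero, h.adm.ddn ht]
  -- λ₃' = λ₃(u - p), with p the coefficient of n' in n''. After this substitution the identity is
  -- algebraic in independent symbols.
  have hU : deriv l₃ (u 1) = l₃ (u 1) * (coefU l₁ l₃ (u 1)
      - (deriv l₃ (u 1) / l₃ (u 1) - 3 * deriv l₁ (u 1) / l₁ (u 1))) := by
    have := h.adm.l₁_ne _ ht
    rw [coefU]; field_simp; ring
  generalize deriv l₃ (u 1) / l₃ (u 1) - 3 * deriv l₁ (u 1) / l₁ (u 1) = p at hU ⊢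
  rw [hU, phiM, gaussM, modelC, gM, wedge_comm (n (u 1)) (deriv (qCurve l₁ l₃ n ξ) (u 1)),
    wedge_comm (deriv n (u 1)) (qCurve l₁ l₃ n ξ (u 1)),
    wedge_comm (n (u 1)) (qCurve l₁ l₃ n ξ (u 1))]
  simp only [wedge_sub_right, wedge_add_left, wedge_smul_left, wedge_smul_right, wedge_self, hf]
  generalize kM ε l₁ l₃ u = k
  match_scalars <;> field_simp <;> ring

theorem tangentVec_frame : tangentVec X u ![gM ε l₁ l₃ u, 1]
      = u 0 • n (u 1) + qCurve l₁ l₃ n ξ (u 1) ∧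
    tangentVec X u ![1, 0] = fM ε l₁ l₃ u • n (u 1) - l₃ (u 1) • deriv n (u 1) := by
  obtain ⟨e0, e1⟩ := h.pd_X hu
  constructor
  · simp only [tangentVec, Fin.sum_univ_two, Matrix.cons_val_zero, Matrix.cons_val_one, e0, e1]
    module
  · simp only [tangentVec, Fin.sum_univ_two, Matrix.cons_val_zero, Matrix.cons_val_one, e0]
    module

theorem isLocalGaussMap : IsLocalGaussMap X (gaussM ε l₁ l₃ n ξ) u := by
  obtain ⟨e0, e1⟩ := h.tangentVec_frame hu
  obtain ⟨i1, i2, i3⟩ := h.ip_frame hu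
  refine ⟨![gM ε l₁ l₃ u, 1], ![1, 0], ?_, ?_⟩
  · rw [e0, e1]; exact ⟨i2, i1, i3⟩
  · rw [e0, e1]; rfl

theorem phiM_ne : phiM ε l₁ l₃ u ≠ 0 := by
  have n₃ := h.adm.l₃_ne _ (h.mem u hu)
  have hw := (h.wM_pos hu).ne'
  have hε : ε ≠ 0 := by
    intro h0
    have := h.sign
    rw [h0] at this; simp at this
  have h6 : √6 ≠ 0 := (Real.sqrt_pos.2 (by norm_num)).ne'
  rw [phiM, kM]
  positivity

theorem fst_ne : u 0 ≠ 0 := by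
  intro h0
  have := h.pos u hu
  rw [h0] at this
  simp at this

/-- ∂₀X is a combination of n and n', hence an eigenvector for -1/2. In an eigenvector for 1/2 the
n- and n'-components must vanish; as x = sn + Q with s ≠ 0, no nonzero tangent vector qualifies.
This asymmetry distinguishes C from -C. -/
theorem act_tangentVec :
    act (modelC l₁ l₃ n ξ (u 1)) (tangentVec X u ![1, 0]) = -(1 / 2 : ℝ) • tangentVec X u ![1, 0] ∧
    ∀ v : Fin 2 → ℝ, act (modelC l₁ l₃ n ξ (u 1)) (tangentVec X u v) =
      (1 / 2 : ℝ) • tangentVec X u v → tangentVec X u v = 0 := by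
  have ht := h.mem u hu
  have n₃ := h.adm.l₃_ne _ ht
  obtain ⟨a1, a2, a3⟩ := h.adm.act_modelC ht
  obtain ⟨e0, e1⟩ := h.tangentVec_frame hu
  refine ⟨by rw [e1, act_sub, act_smul, act_smul, a1, a2]; module, fun v hv => ?_⟩
  have hdec : tangentVec X u v = v 1 • (u 0 • n (u 1) + qCurve l₁ l₃ n ξ (u 1))
      + (v 0 - gM ε l₁ l₃ u * v 1) •
        (fM ε l₁ l₃ u • n (u 1) - l₃ (u 1) • deriv n (u 1)) := by
    rw [← e0, ← e1]
    simp only [tangentVec, Fin.sum_univ_two, Matrix.cons_val_zero, Matrix.cons_val_one]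
    module
  rw [hdec] at hv ⊢
  generalize v 0 - gM ε l₁ l₃ u * v 1 = c at hv ⊢
  simp only [act_add, act_sub, act_smul, a1, a2, a3] at hv
  have hz : (v 1 * u 0 + c * fM ε l₁ l₃ u) • n (u 1) - (c * l₃ (u 1)) • deriv n (u 1) = 0 := by
    have := sub_eq_zero.2 hv.symm
    rw [← this]
    module
  have hQ := congrArg (ip (qCurve l₁ l₃ n ξ (u 1))) hz
  have hQ' := congrArg (ip (deriv (qCurve l₁ l₃ n ξ) (u 1))) hz
  simp only [ip_sub_right, ip_smul_right, ip_comm _ (n (u 1)), ip_comm _ (deriv n (u 1)),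
    h.adm.n_Q ht, h.adm.dn_Q ht, ip_zero_right] at hQ
  have hc : c = 0 := by
    field_simp at hQ
    linarith
  subst hc
  simp only [ip_sub_right, ip_smul_right, ip_comm _ (n (u 1)), h.adm.n_dQ ht, ip_zero_right,
    zero_mul, add_zero, sub_zero] at hQ'
  have hv1 : v 1 = 0 := by
    have := h.fst_ne hu
    field_simp at hQ'
    simpa [n₃, this] using hQ'
  rw [hv1]
  module

/-- ⟨C,x∧y⟩ = ⟨x,Cy⟩ = -⟨x,y⟩/2, where y = ∂₀X is an eigenvector for -1/2. -/
theorem bdot_modelC_gaussM :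
    bdot (modelC l₁ l₃ n ξ (u 1)) (gaussM ε l₁ l₃ n ξ u) = 1 / 2 := by
  obtain ⟨e0, e1⟩ := h.tangentVec_frame hu
  have ha := (h.act_tangentVec hu).1
  rw [e1] at ha
  rw [gaussM, bdot_wedge (IsAdmissible.modelC_antisymm _), ev, ha, ip_smul_right,
    (h.ip_frame hu).2.2]
  norm_num

end IsModelOn

end ModelSurface

/-! ### Absorbing the isometry into the curves -/

section Congruence

variable {α β : ℝ} {l₁ l₃ : ℝ → ℝ} {n ξ : ℝ → E42}

/-- No differentiability is needed, because B is invertible. -/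
theorem deriv_equiv_comp (B : E42 ≃L[ℝ] E42) (f : ℝ → E42) :
    deriv (fun t => B (f t)) = fun t => B (deriv f t) := by
  ext1 t
  have := B.comp_fderiv (f := f) (x := t)
  rw [← fderiv_apply_one_eq_deriv, ← fderiv_apply_one_eq_deriv]
  exact congrArg (fun L : ℝ →L[ℝ] E42 => L 1) this

/-- The algebraic conditions are metric, the differential ones linear, and ξ enters only through its
derivatives, so its translation by a constant is harmless. -/
theorem IsAdmissible.map (h : IsAdmissible α β l₁ l₃ n ξ) (B : E42 ≃L[ℝ] E42)
    (hB : ∀ w w', ip (B w) (B w') = ip w w') (c : E42) :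
    IsAdmissible α β l₁ l₃ (fun t => B (n t)) (fun t => B (ξ t) - c) := by
  have dn := deriv_equiv_comp B n
  have dξ : deriv (fun t => B (ξ t) - c) = fun t => B (deriv ξ t) := by
    rw [← deriv_equiv_comp B ξ]
    ext1 t
    exact deriv_sub_const c
  refine ⟨h.smooth_l₁, h.smooth_l₃, B.contDiff.comp_contDiffOn h.smooth_n,
    (B.contDiff.comp_contDiffOn h.smooth_ξ).sub contDiffOn_const, h.l₁_ne, h.l₃_ne,
    fun t ht => ?_, fun t ht => ?_, fun t ht => ?_, fun t ht => ?_, fun t ht => ?_,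
    fun t ht => ?_, fun t ht => ?_⟩
  · rw [hB, h.n_n t ht]
  · rw [dn, hB, h.n'_n' t ht]
  · rw [dξ, hB, h.n_ξ' t ht]
  · rw [dξ, hB, h.ξ'_ξ' t ht]
  · rw [dn, dξ, hB, h.n'_ξ' t ht]
  · have := congrArg B (h.ode_n t ht)
    simp only [map_add, map_sub, map_smul, map_zero] at this
    rw [dn, deriv_equiv_comp]
    exact this
  · have := congrArg B (h.ode_ξ t ht)
    simp only [map_add, map_smul, zeta] at this
    rw [dξ, deriv_equiv_comp, deriv_equiv_comp, zeta, dn]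
    exact this

theorem modelMap_map (B : E42 ≃L[ℝ] E42) (c : E42) (ε s t : ℝ) :
    modelMap ε l₁ l₃ (fun t => B (n t)) (fun t => B (ξ t) - c) s t
      = B (modelMap ε l₁ l₃ n ξ s t) - c := by
  simp only [modelMap, deriv_equiv_comp, map_add, map_sub, map_smul, map_neg]
  abel

variable {M : Type*} [TopologicalSpace M] [ChartedSpace Plane M] {F : M → E42} {ε : ℝ} {p : M}

/-- The isometry in the definition of congruence may be absorbed into the curves. -/
theorem IsCongruentToModelNear.exists_isModelOn (hF : ContMDiff (𝓡 2) 𝓘(ℝ, E42) ∞ F)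
    (hε : ε * ε = 1) (h : IsCongruentToModelNear F ε p) :
    ∃ (α β : ℝ) (l₁ l₃ : ℝ → ℝ) (n ξ : ℝ → E42) (e : OpenPartialHomeomorph M Plane),
      IsChart e ∧ p ∈ e.source ∧ IsModelOn (F ∘ e.symm) ε α β l₁ l₃ n ξ e.target := by
  obtain ⟨α, β, l₁, l₃, n, ξ, hadm, A, v, hA, e, he, hp, hX⟩ := h
  let B : E42 ≃L[ℝ] E42 := A.symm.toContinuousLinearEquiv
  have hB (w w') : ip (B w) (B w') = ip w w' := by
    have := hA (A.symm w) (A.symm w')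
    simp only [LinearEquiv.apply_symm_apply] at this
    exact this.symm
  refine ⟨α, β, l₁, l₃, _, _, e, he, hp, hadm.map B hB (B v), hε, e.open_target,
    fun u hu => contDiffAt_comp_chart_symm hF he hu, fun u hu => (hX u hu).1,
    fun u hu => (hX u hu).2.1, fun u hu => ?_⟩
  rw [modelMap_map, ← (hX u hu).2.2, map_add, add_sub_cancel_right]
  exact (A.symm_apply_apply _).symm

end Congruence

/-! ### Normalized local solutions, their uniqueness and their behaviour under changes of
coordinates -/

section LocalSolution

/-- `(G, φ, C)` solves `ΔG = φ (G + C)` on `U` for a Gauss map `G` of `X`, and is normalized by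
the position of `C` relative to the tangent planes. -/
structure IsLocalSolution (X : Plane → E42) (G : Plane → Bivec) (φ : Plane → ℝ) (C : Bivec)
    (U : Set Plane) : Prop where
  isOpen : IsOpen U
  smooth_X : ∀ u ∈ U, ContDiffAt ℝ ∞ X u
  smooth_G : ∀ u ∈ U, ContDiffAt ℝ ∞ G u
  det_ne : ∀ u ∈ U, (metric X u).det ≠ 0
  gauss : ∀ u ∈ U, IsLocalGaussMap X G u
  phi_ne : ∀ u ∈ U, φ u ≠ 0
  antisymm : ∀ i j, C i j = -C j i
  lap_eq : ∀ u ∈ U, lap X G u = φ u • (G u + C)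
  bdot_eq : ∀ u ∈ U, bdot C (G u) = 1 / 2
  exists_act_eq : ∀ u ∈ U, ∃ b, tangentVec X u b ≠ 0 ∧
    act C (tangentVec X u b) = -(1 / 2 : ℝ) • tangentVec X u b
  eq_zero_of_act_eq : ∀ u ∈ U, ∀ b, act C (tangentVec X u b) = (1 / 2 : ℝ) • tangentVec X u b →
    tangentVec X u b = 0

theorem IsModelOn.isLocalSolution {X : Plane → E42} {ε α β : ℝ} {l₁ l₃ : ℝ → ℝ} {n ξ : ℝ → E42}
    {T : Set Plane} (h : IsModelOn X ε α β l₁ l₃ n ξ T) (hdet : ∀ u ∈ T, (metric X u).det ≠ 0)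
    {t : ℝ} (ht : t ∈ Set.Ioo α β) :
    IsLocalSolution X (gaussM ε l₁ l₃ n ξ) (phiM ε l₁ l₃) (modelC l₁ l₃ n ξ t) T := by
  have hC {u} (hu : u ∈ T) : modelC l₁ l₃ n ξ t = modelC l₁ l₃ n ξ (u 1) :=
    h.adm.modelC_const ht (h.mem u hu)
  refine ⟨h.isOpen, h.smooth, fun u hu => h.contDiffAt_gaussM hu, hdet,
    fun u hu => h.isLocalGaussMap hu, fun u hu => h.phiM_ne hu, IsAdmissible.modelC_antisymm t,
    fun u hu => ?_, fun u hu => ?_, fun u hu => ⟨![1, 0], fun h0 => ?_, ?_⟩, fun u hu => ?_⟩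
  · rw [hC hu, h.lap_gaussM hu]
  · rw [hC hu, h.bdot_modelC_gaussM hu]
  · have := (h.ip_frame hu).2.2
    rw [← (h.tangentVec_frame hu).2, h0, ip_zero_right] at this
    norm_num at this
  · rw [hC hu, (h.act_tangentVec hu).1]
  · rw [hC hu]; exact (h.act_tangentVec hu).2

namespace IsLocalSolution

variable {X : Plane → E42} {G G' : Plane → Bivec} {φ φ' : Plane → ℝ} {C C' : Bivec}
  {U U' : Set Plane} (h : IsLocalSolution X G φ C U)

include h

/-- Two Gauss maps of the same surface differ by a sign s, locally constant on the overlap, so sφ(G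
+ C) = φ'(G' + C'). Pairing with G' and using ⟨C,G⟩ = ⟨C',G'⟩ = 1/2 gives φ = φ', then C' = sC; the
eigenvector condition excludes s = -1. -/
theorem eq_of_mem (h' : IsLocalSolution X G' φ' C' U') {u : Plane} (hu : u ∈ U) (hu' : u ∈ U') :
    G u = G' u ∧ φ u = φ' u ∧ C = C' := by
  set s : Plane → ℝ := fun v => -bdot (G v) (G' v) with hs
  have key : ∀ v, v ∈ U → v ∈ U' → (s v = 1 ∨ s v = -1) ∧ G' v = s v • G v := by
    intro v hv hv'
    have b := (h.gauss v hv).bdot_self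
    have b' := (h'.gauss v hv').bdot_self
    obtain ⟨c, e⟩ := (h.gauss v hv).exists_eq_smul
    obtain ⟨c', e'⟩ := (h'.gauss v hv').exists_eq_smul
    have hc : c ≠ 0 := by
      rintro rfl
      rw [e, zero_smul] at b
      simp [bdot] at b
    have hG' : G' v = (c' / c) • G v := by
      rw [e', e, smul_smul, div_mul_cancel₀ _ hc]
    have hsv : s v = c' / c := by
      simp only [hs, hG', bdot_smul_right, b]; ring
    refine ⟨?_, by rw [hsv, hG']⟩
    rw [hG', ← hsv, bdot_smul_left, bdot_smul_right, b] at b'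
    exact mul_self_eq_one_iff.1 (by linarith)
  -- A continuous function with values ±1 is constant nearby, so the two Laplacians also differ by
  -- the factor s(u).
  have hsc : ContinuousAt s u :=
    (contDiffAt_bdot (h.smooth_G u hu) (h'.smooth_G u hu')).continuousAt.neg
  have hev : G' =ᶠ[nhds u] fun v => s u • G v := by
    filter_upwards [h.isOpen.mem_nhds hu, h'.isOpen.mem_nhds hu',
      hsc.preimage_mem_nhds (Metric.ball_mem_nhds (s u) one_pos)] with v hv hv' hb
    have : s v = s u := by
      have hb' : |s v - s u| < 1 := hb
      rw [abs_lt] at hb'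
      rcases (key v hv hv').1 with a | a <;> rcases (key u hu hu').1 with b | b <;>
        rw [a, b] at hb' ⊢ <;> norm_num at hb'
    rw [(key v hv hv').2, this]
  obtain ⟨hsu, hGu⟩ := key u hu hu'
  have hl := h'.lap_eq u hu'
  rw [lap_congr (Filter.EventuallyEq.refl _ _) hev, lap_smul_const, h.lap_eq u hu] at hl
  have b := (h.gauss u hu).bdot_self
  have b' := (h'.gauss u hu').bdot_self
  have hss : s u * s u = 1 := mul_self_eq_one_iff.2 hsu
  have hφ : φ u = φ' u := by
    have hb := congrArg (fun B => bdot B (G' u)) hl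
    simp only [bdot_smul_left, bdot_add_left, b', h'.bdot_eq u hu'] at hb
    rw [hGu, bdot_smul_right, bdot_smul_right, b, h.bdot_eq u hu] at hb
    linear_combination (-2) * hb - φ u * hss
  have hC : C' = s u • C := by
    rw [← hφ, smul_comm, hGu, smul_add] at hl
    exact (add_left_cancel (smul_right_injective _ (h.phi_ne u hu) hl)).symm
  rcases hsu with e | e
  · rw [e, one_smul] at hC hGu
    exact ⟨hGu.symm, hφ, hC.symm⟩
  -- If C' = -C, the tangent eigenvector of C for -1/2 becomes one of C' for 1/2, which is not
  -- allowed.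
  · obtain ⟨y, hy, hy'⟩ := h.exists_act_eq u hu
    refine absurd (h'.eq_zero_of_act_eq u hu' y ?_) hy
    rw [hC, e, neg_smul, one_smul, neg_act, hy', neg_smul, neg_neg]

theorem comp {Y : Plane → E42} {ψ : Plane → Plane} {V : Set Plane} (hV : IsOpen V)
    (hψ : ∀ w ∈ V, ContDiffAt ℝ ∞ ψ w) (hJ : ∀ w ∈ V, (jac ψ w).det ≠ 0)
    (hm : ∀ w ∈ V, ψ w ∈ U) (hY : Set.EqOn Y (X ∘ ψ) V) :
    IsLocalSolution Y (G ∘ ψ) (φ ∘ ψ) C V := by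
  have hev {w} (hw : w ∈ V) : Y =ᶠ[nhds w] X ∘ ψ := hY.eventuallyEq_of_mem (hV.mem_nhds hw)
  have ht {w} (hw : w ∈ V) (b : Fin 2 → ℝ) :
      tangentVec Y w b = tangentVec X (ψ w) ((jac ψ w).mulVec b) := by
    rw [← tangentVec_comp (h.smooth_X _ (hm w hw)).dAt (hψ w hw).dAt]
    simp only [tangentVec, pd_congr _ (hev hw)]
  have ht' {w} (hw : w ∈ V) (c : Fin 2 → ℝ) :
      tangentVec Y w ((jac ψ w)⁻¹.mulVec c) = tangentVec X (ψ w) c := by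
    rw [ht hw, Matrix.mulVec_mulVec, Matrix.mul_nonsing_inv _ (isUnit_iff_ne_zero.2 (hJ w hw)),
      Matrix.one_mulVec]
  refine ⟨hV, fun w hw => ((h.smooth_X _ (hm w hw)).comp w (hψ w hw)).congr_of_eventuallyEq
    (hev hw), fun w hw => (h.smooth_G _ (hm w hw)).comp w (hψ w hw), fun w hw => ?_,
    fun w hw => ?_, fun w hw => h.phi_ne _ (hm w hw), h.antisymm, fun w hw => ?_,
    fun w hw => h.bdot_eq _ (hm w hw), fun w hw => ?_, fun w hw b hb => ?_⟩
  · rw [metric_congr (hev hw)]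
    rw [metric_comp (h.smooth_X _ (hm w hw)).dAt (hψ w hw).dAt, Matrix.det_mul, Matrix.det_mul,
      Matrix.det_transpose]
    exact mul_ne_zero (mul_ne_zero (hJ w hw) (h.det_ne _ (hm w hw))) (hJ w hw)
  · obtain ⟨a, b, h1, h2⟩ := h.gauss _ (hm w hw)
    refine ⟨(jac ψ w)⁻¹.mulVec a, (jac ψ w)⁻¹.mulVec b, ?_, ?_⟩
    · rwa [ht' hw, ht' hw]
    · rw [ht' hw, ht' hw]; exact h2
  · rw [lap_congr (hev hw) (Filter.EventuallyEq.refl _ _), lap_comp (h.smooth_X _ (hm w hw))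
      (h.smooth_G _ (hm w hw)) (hψ w hw) (hJ w hw) (h.det_ne _ (hm w hw)), h.lap_eq _ (hm w hw)]
    rfl
  · obtain ⟨b, h1, h2⟩ := h.exists_act_eq _ (hm w hw)
    refine ⟨(jac ψ w)⁻¹.mulVec b, ?_, ?_⟩
    · rwa [ht' hw]
    · rwa [ht' hw]
  · rw [ht hw] at hb ⊢
    exact h.eq_zero_of_act_eq _ (hm w hw) _ hb

end IsLocalSolution

end LocalSolution

/-! ### Gluing local solutions over the surface -/

section Backward

variable {M : Type*} [TopologicalSpace M] [ChartedSpace Plane M]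

/-- `(G, φ, C)` solves `ΔG = φ (G + C)` on the open part `S` of the surface. -/
structure IsSolutionOn (F : M → E42) (G : M → Bivec) (φ : M → ℝ) (C : Bivec) (S : Set M) :
    Prop where
  isOpen : IsOpen S
  smooth_G : ∀ p ∈ S, ContMDiffAt (𝓡 2) 𝓘(ℝ, Bivec) ∞ G p
  smooth_φ : ∀ p ∈ S, ContMDiffAt (𝓡 2) 𝓘(ℝ, ℝ) ∞ φ p
  isLocalSolution : ∀ e : OpenPartialHomeomorph M Plane, IsChart e →
    IsLocalSolution (F ∘ e.symm) (G ∘ e.symm) (φ ∘ e.symm) C (e.target ∩ e.symm ⁻¹' S)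

variable {F : M → E42}

theorem IsLocalSolution.isSolutionOn {e : OpenPartialHomeomorph M Plane} (he : IsChart e)
    {G : Plane → Bivec} {φ : Plane → ℝ} {C : Bivec}
    (h : IsLocalSolution (F ∘ e.symm) G φ C e.target) (hφ : ∀ u ∈ e.target, ContDiffAt ℝ ∞ φ u) :
    IsSolutionOn F (G ∘ e) (φ ∘ e) C e.source := by
  refine ⟨e.open_source, fun p hp => ?_, fun p hp => ?_, fun e' he' => ?_⟩
  · exact (h.smooth_G _ (e.map_source hp)).contMDiffAt.comp p
      (contMDiffAt_of_mem_maximalAtlas he hp)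
  · exact (hφ _ (e.map_source hp)).contMDiffAt.comp p (contMDiffAt_of_mem_maximalAtlas he hp)
  · refine h.comp (ψ := e ∘ e'.symm) (e'.symm.isOpen_inter_preimage e.open_source)
      (fun w hw => (transition_smooth he he' hw.1 hw.2).1)
      (fun w hw => (transition_smooth he he' hw.1 hw.2).2) (fun w hw => e.map_source hw.2) ?_
    intro w hw
    simp only [Function.comp, e.left_inv hw.2]

theorem IsSolutionOn.eq_of_mem [IsManifold (𝓡 2) ∞ M] {G G' : M → Bivec} {φ φ' : M → ℝ}
    {C C' : Bivec} {S S' : Set M} (h : IsSolutionOn F G φ C S) (h' : IsSolutionOn F G' φ' C' S')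
    {q : M} (hq : q ∈ S) (hq' : q ∈ S') : G q = G' q ∧ φ q = φ' q ∧ C = C' := by
  have he : IsChart (chartAt Plane q) := IsManifold.chart_mem_maximalAtlas q
  have hs := mem_chart_source Plane q
  have := (h.isLocalSolution _ he).eq_of_mem (h'.isLocalSolution _ he)
    (u := chartAt Plane q q) ⟨mem_chart_target Plane q, by
      rwa [Set.mem_preimage, (chartAt Plane q).left_inv hs]⟩ ⟨mem_chart_target Plane q, by
      rwa [Set.mem_preimage, (chartAt Plane q).left_inv hs]⟩
  simpa only [Function.comp, (chartAt Plane q).left_inv hs] using this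

theorem exists_isSolutionOn (hF : IsQuasiMinimalSurface F) {ε : ℝ} (hε : ε * ε = 1) {p : M}
    (h : IsCongruentToModelNear F ε p) :
    ∃ G φ C S, p ∈ S ∧ IsSolutionOn F G φ C S := by
  obtain ⟨α, β, l₁, l₃, n, ξ, e, he, hp, hm⟩ := h.exists_isModelOn hF.1 hε
  exact ⟨_, _, _, _, hp, (hm.isLocalSolution (fun u hu => (hF.2 e he u hu).1.ne)
    (hm.mem _ (e.map_source hp))).isSolutionOn he fun u hu => hm.contDiffAt_phiM hu⟩

/-- A local solution is chosen around every point and G, φ are defined on the diagonal, G(q) =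
G_q(q). By uniqueness they coincide near p with the solution chosen at p, hence are smooth, and the
bivectors C_p are locally constant in p; connectedness makes them a single C. -/
theorem hasPointwiseOneTypeGaussMap [IsManifold (𝓡 2) ∞ M] [ConnectedSpace M] (hF : IsQuasiMinimalSurface F) {ε : ℝ}
    (hε : ε * ε = 1) (h : ∀ p, IsCongruentToModelNear F ε p) :
    HasPointwiseOneTypeGaussMap F := by
  choose G φ C S hmem hS using fun p => exists_isSolutionOn hF hε (h p)
  have hloc {p q : M} (hq : q ∈ S p) := (hS q).eq_of_mem (hS p) (hmem q) hq
  have hCc : IsLocallyConstant C := (IsLocallyConstant.iff_eventually_eq C).2 fun p => by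
    filter_upwards [(hS p).isOpen.mem_nhds (hmem p)] with q hq using (hloc hq).2.2
  have hC (p q : M) : C p = C q := hCc.apply_eq_of_preconnectedSpace p q
  have hGev (p : M) : (fun q => G q q) =ᶠ[nhds p] G p := by
    filter_upwards [(hS p).isOpen.mem_nhds (hmem p)] with q hq using (hloc hq).1
  have hφev (p : M) : (fun q => φ q q) =ᶠ[nhds p] φ p := by
    filter_upwards [(hS p).isOpen.mem_nhds (hmem p)] with q hq using (hloc hq).2.1
  obtain ⟨p₀⟩ := (inferInstance : Nonempty M)
  have hsol {e : OpenPartialHomeomorph M Plane} (he : IsChart e) {u : Plane} (hu : u ∈ e.target) :=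
    (hS (e.symm u)).isLocalSolution e he
  have hu' {e : OpenPartialHomeomorph M Plane} {u : Plane} (hu : u ∈ e.target) :
      u ∈ e.target ∩ e.symm ⁻¹' S (e.symm u) := ⟨hu, hmem _⟩
  refine ⟨fun q => G q q, fun q => φ q q, C p₀,
    ⟨fun p => ((hS p).smooth_G p (hmem p)).congr_of_eventuallyEq (hGev p),
      fun e he u hu => (hsol he hu).gauss u (hu' hu)⟩,
    fun p => ((hS p).smooth_φ p (hmem p)).congr_of_eventuallyEq (hφev p), fun p => ?_,
    ((hS p₀).isLocalSolution _ (IsManifold.chart_mem_maximalAtlas (I := 𝓡 2) p₀)).antisymm,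
    fun e he u hu => ?_⟩
  · have he : IsChart (chartAt Plane p) := IsManifold.chart_mem_maximalAtlas p
    have := (hsol he (mem_chart_target Plane p)).phi_ne _ (hu' (mem_chart_target Plane p))
    simpa only [Function.comp, (chartAt Plane p).left_inv (mem_chart_source Plane p)] using this
  · have hev : (fun q => G q q) ∘ e.symm =ᶠ[nhds u] G (e.symm u) ∘ e.symm :=
      (e.continuousAt_symm hu).eventually (hGev _)
    rw [lap_congr (Filter.EventuallyEq.refl _ _) hev, (hsol he hu).lap_eq u (hu' hu),
      hC p₀ (e.symm u)]
    rfl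

end Backward

end QuasiMinimal

theorem theorem3p12 {M : Type*} [TopologicalSpace M] [ChartedSpace QuasiMinimal.Plane M]
    [IsManifold (𝓡 2) ∞ M] [ConnectedSpace M] (F : M → QuasiMinimal.E42)
    (hF : QuasiMinimal.IsQuasiMinimalSurface F)
    (hcurv : QuasiMinimal.HasNonvanishingNormalCurv F) :
    QuasiMinimal.HasPointwiseOneTypeGaussMap F ↔
      ∃ ε : ℝ, (ε = 1 ∨ ε = -1) ∧ ∀ p : M, QuasiMinimal.IsCongruentToModelNear F ε p := by
  refine ⟨QuasiMinimal.exists_isCongruentToModelNear hF hcurv, ?_⟩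
  rintro ⟨ε, hε, h⟩
  exact QuasiMinimal.hasPointwiseOneTypeGaussMap hF (mul_self_eq_one_iff.2 hε) h
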